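/- **Theorem 1.4.** Let $G=(V,E)$ be an infinite, connected, locally finite graph with graph distance $d(\cdot,\cdot)$ and closed balls $B(x,n)=\{y\in V: d(x,y)\le n\}$. Let $d'\ge d\ge 2$ be real numbers and $C_{\mathrm{reg}},C_{\mathrm{S}_1}\in(0,\infty)$, and suppose that for every $x\in V$ there are real numbers $N_1(x),N_2(x)<\infty$ such that (a) (volume regularity) $C_{\mathrm{reg}}^{-1}n^d\le |B(x,n)|\le C_{\mathrm{reg}}\,n^d$ for all integers $n\ge N_1(x)$, $n \geq 0$; (b) (local Sobolev inequality) for all integers $n\ge N_2(x)$, $n\geq 0$, and all $u:V\to\mathbb R$ vanishing outside $B(x,n)$, $$\Big(\sum_{y\in B(x,n)}|u(y)|^{\frac{d'}{d'-1}}\Big)^{\frac{d'-1}{d'}}\le C_{\mathrm{S}_1}\,n^{1-\frac d{d'}}\sum_{\{y,z\}\in E,\ \{y,z\}\cap B(x,n)\ne\emptyset}|u(y)-u(z)| .$$ Let $\omega=\{\omega(e)\in(0,\infty):e\in E\}$ be conductances, $\omega(x,y)=\omega(\{x,y\})$ if $\{x,y\}\in E$ and $\omega(x,y)=0$ otherwise,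 and set $\mu^\omega(x)=\sum_{y\sim x}\omega(x,y)$, $\nu^\omega(x)=\sum_{y\sim x}1/\omega(x,y)$. Let $Y=(Y_t)_{t\ge0}$ be the constant speed random walk: at a vertex $x$ it waits an exponential time with mean $1$ and then jumps to $y$ with probability $\omega(x,y)/\mu^\omega(x)$. Write $\mathrm P^\omega_x$ for its law started at $x$, and $q^\omega(t,x,y)=\mathrm P^\omega_x[Y_t=y]/\mu^\omega(y)$ for its heat kernel. For finite non-empty $A\subset V$ and $f:V\to\mathbb R$ let $\|f\|_{p,A}=\big(|A|^{-1}\sum_{x\in A}|f(x)|^p\big)^{1/p}$ if $p<\infty$ and $\|f\|_{\infty,A}=\max_A|f|$. Let $$\bar\mu_p(x)=\limsup_{n\to\infty}\|\mu^\omega\|_{p,B(x,n)},\quad \bar\nu_q(x)=\limsup_{n\to\infty}\|\nu^\omega\|_{q,B(x,n)},\quad \bar\mu_p=\sup_{x\in V}\bar\mu_p(x),\quad \bar\nu_q=\sup_{x\in V}\bar\nu_q(x).$$ Assume that $\bar\mu_p<\infty$ and $\bar\nu_q<\infty$ for some $p,q\in(1,\infty]$ with $\frac1p+\frac1q<\frac2{d'}$,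 and for each $x\in V$ let $N(x)$ be a real number such that $\|\mu^\omega\|_{p,B(x,n)}\le2\bar\mu_p(x)$ and $\|\nu^\omega\|_{q,B(x,n)}\le2\bar\nu_q(x)$ for all integers $n\ge N(x)$, $n\geq 0$. Then there are constants $c_1,c_2,c_3,c_4\in(0,\infty)$ such that for all $t$ and $x\in V$ with $\sqrt t\ge N(x)\vee 2\,(N_1(x)\vee N_2(x))$ and all $y\in V$: (i) if $d(x,y)\le c_1t$, then $q^\omega(t,x,y)\le c_2\,t^{-d/2}\exp\!\big(-c_3\,d(x,y)^2/t\big)$; (ii) if $d(x,y)\ge c_1t$, then $q^\omega(t,x,y)\le c_2\,t^{-d/2}\exp\!\big(-c_4\,d(x,y)\,(1\vee\log(d(x,y)/t))\big)$. The constants depend only on $d,d',C_{\mathrm{reg}},C_{\mathrm{S}_1},p,q$ and on upper bounds for $\bar\mu_p$ and $\bar\nu_q$. -/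

import Mathlib

open MeasureTheory ProbabilityTheory Filter
open scoped ENNReal NNReal

noncomputable section

namespace WeightedGraph

variable {V : Type*}

/-! ### Balls, volume regularity, local Sobolev inequality -/

theorem finite_closedBall (G : SimpleGraph V) [G.LocallyFinite] (x : V) (n : ℕ) :
    {y : V | G.edist x y ≤ n}.Finite := by
  classical
  induction n with
  | zero =>
    refine (Set.finite_singleton x).subset fun y hy => ?_
    have h : G.edist x y ≤ 0 := hy
    exact (SimpleGraph.edist_eq_zero_iff.mp (nonpos_iff_eq_zero.mp h)).symm
  | succ k ih =>
    refine (ih.union (ih.biUnion fun z _ => (G.neighborSet z).toFinite)).subset fun y hy => ?_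
    have hy' : G.edist x y ≤ ((k + 1 : ℕ) : ℕ∞) := hy
    obtain ⟨p, hp⟩ := SimpleGraph.exists_walk_of_edist_ne_top
      (ne_top_of_le_ne_top (ENat.natCast_ne_top _) hy')
    rw [← hp, Nat.cast_le] at hy'
    by_cases h0 : p.length ≤ k
    · left
      exact (SimpleGraph.edist_le p).trans (Nat.cast_le.mpr h0)
    · right
      have hnil : ¬ p.Nil := by
        intro h
        have := SimpleGraph.Walk.length_eq_zero_iff.mpr h
        omega
      simp only [Set.mem_iUnion]
      refine ⟨p.penultimate, ?_, p.adj_penultimate hnil⟩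
      have hl : p.dropLast.length ≤ k := by
        have h2 := SimpleGraph.Walk.length_dropLast_add_one hnil
        omega
      exact (SimpleGraph.edist_le p.dropLast).trans (Nat.cast_le.mpr hl)

/-- The closed ball `B(x, n)` of radius `n` around `x` for the graph distance. -/
def ball (G : SimpleGraph V) [G.LocallyFinite] (x : V) (n : ℕ) : Finset V :=
  (finite_closedBall G x n).toFinset

theorem mem_ball (G : SimpleGraph V) [G.LocallyFinite] (hG : G.Connected) (x y : V) (n : ℕ) :
    y ∈ ball G x n ↔ G.dist x y ≤ n := by
  have h := SimpleGraph.Reachable.coe_dist_eq_edist (hG x y)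
  simp [ball, ← h]

/-- Volume regularity of order `d` for large balls, with constant `C`: for all natural numbers
`n ≥ N₁ x`, `C⁻¹ n ^ d ≤ |B(x, n)| ≤ C n ^ d`. -/
def VolumeRegular (G : SimpleGraph V) [G.LocallyFinite] (d C : ℝ) (N₁ : V → ℝ) : Prop :=
  ∀ (x : V) (n : ℕ), N₁ x ≤ n →
    C⁻¹ * (n : ℝ) ^ d ≤ ((ball G x n).card : ℝ) ∧ ((ball G x n).card : ℝ) ≤ C * (n : ℝ) ^ d

open Classical in
/-- The (non-oriented) edges with at least one endpoint in `B(x, n)`. -/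
def edgesMeetingBall (G : SimpleGraph V) [G.LocallyFinite] (x : V) (n : ℕ) : Finset (Sym2 V) :=
  (ball G x n).biUnion fun y => G.incidenceFinset y

/-- `|u(y) - u(z)|` for the non-oriented edge `{y, z}`. -/
def edgeDiff (u : V → ℝ) : Sym2 V → ℝ :=
  Sym2.lift ⟨fun y z => |u y - u z|, fun y z => abs_sub_comm (u y) (u z)⟩

/-- The local Sobolev inequality `(S¹_{d'})` for large balls, with constant `C`. -/
def LocalSobolev (G : SimpleGraph V) [G.LocallyFinite] (d d' C : ℝ) (N₂ : V → ℝ) : Prop :=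
  ∀ (x : V) (n : ℕ), N₂ x ≤ n → ∀ u : V → ℝ, (∀ y, y ∉ ball G x n → u y = 0) →
    (∑ y ∈ ball G x n, |u y| ^ (d' / (d' - 1))) ^ ((d' - 1) / d') ≤
      C * (n : ℝ) ^ (1 - d / d') * ∑ e ∈ edgesMeetingBall G x n, edgeDiff u e

/-! ### Conductances and their averages -/

/-- A family of conductances: a strictly positive weight for every edge. -/
abbrev Conductances (G : SimpleGraph V) : Type _ := G.edgeSet → Set.Ioi (0 : ℝ)

open Classical in
/-- The conductance matrix `ω(x, y)`. -/
def conductance {G : SimpleGraph V} (ω : Conductances G) (x y : V) : ℝ :=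
  if h : G.Adj x y then (ω ⟨s(x, y), h⟩ : ℝ) else 0

theorem conductance_nonneg {G : SimpleGraph V} (ω : Conductances G) (x y : V) : 0 ≤ conductance ω x y := by
  unfold conductance
  split_ifs with h
  · exact le_of_lt (ω ⟨s(x, y), h⟩).2
  · exact le_rfl

/-- `μ^ω(x) = ∑_{y ∼ x} ω(x, y)`. -/
def mu {G : SimpleGraph V} [G.LocallyFinite] (ω : Conductances G) (x : V) : ℝ :=
  ∑ y ∈ G.neighborFinset x, conductance ω x y

/-- `ν^ω(x) = ∑_{y ∼ x} 1 / ω(x, y)`. -/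
def nu {G : SimpleGraph V} [G.LocallyFinite] (ω : Conductances G) (x : V) : ℝ :=
  ∑ y ∈ G.neighborFinset x, 1 / conductance ω x y

/-- The space-averaged `ℓ^p`-norm of `f` on a non-empty finite set `A`, `p ∈ [1, ∞]`. -/
def avgNorm (p : ℝ≥0∞) (A : Finset V) (f : V → ℝ) : ℝ :=
  if p = ∞ then ⨆ x : A, |f x|
  else ((A.card : ℝ)⁻¹ * ∑ x ∈ A, |f x| ^ p.toReal) ^ (1 / p.toReal)

/-- `limsup_{n → ∞} ‖f‖_{p, B(x, n)}`, as an element of `[0, ∞]`. -/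
def limsupAvg (G : SimpleGraph V) [G.LocallyFinite] (p : ℝ≥0∞) (f : V → ℝ) (x : V) : ℝ≥0∞ :=
  limsup (fun n : ℕ => ENNReal.ofReal (avgNorm p (ball G x n) f)) atTop

/-- For all natural numbers `n ≥ N x`, the average `‖f‖_{p, B(x, n)}` is at most twice its
limit superior as `n → ∞`. -/
def AvgControlled (G : SimpleGraph V) [G.LocallyFinite] (p : ℝ≥0∞) (f : V → ℝ) (N : V → ℝ) :
    Prop :=
  ∀ (x : V) (n : ℕ), N x ≤ n →
    ENNReal.ofReal (avgNorm p (ball G x n) f) ≤ 2 * limsupAvg G p f x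

/-! ### The constant speed random walk and its heat kernel -/

section CSRW

variable {G : SimpleGraph V} [G.LocallyFinite]

theorem mu_nonneg (ω : Conductances G) (x : V) : 0 ≤ mu ω x :=
  Finset.sum_nonneg fun y _ => conductance_nonneg ω x y

variable [MeasurableSpace V]

/-- The jump law from `x`: the next position is `y` with probability `ω(x, y) / μ^ω(x)`.
(A vertex without neighbours, which does not occur in infinite connected graphs, is absorbing.) -/
def jumpLaw (ω : Conductances G) (x : V) : Measure V :=
  if mu ω x = 0 then Measure.dirac x
  else ∑ y ∈ G.neighborFinset x, ENNReal.ofReal (conductance ω x y / mu ω x) • Measure.dirac y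

instance (ω : Conductances G) (x : V) : IsProbabilityMeasure (jumpLaw ω x) := by
  unfold jumpLaw
  split_ifs with h
  · infer_instance
  · constructor
    rw [Measure.finsetSum_apply]
    simp only [Measure.smul_apply, measure_univ, smul_eq_mul, mul_one]
    rw [← ENNReal.ofReal_sum_of_nonneg
      fun y _ => div_nonneg (conductance_nonneg ω x y) (mu_nonneg ω x), ← Finset.sum_div]
    change ENNReal.ofReal (mu ω x / mu ω x) = 1
    rw [div_self h, ENNReal.ofReal_one]

variable [DiscreteMeasurableSpace V]

/-- The transition kernel of the `n`-th jump, given the positions up to time `n`. -/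
def jumpKernel (ω : Conductances G) (n : ℕ) : Kernel (Π _ : Finset.Iic n, V) V where
  toFun z := jumpLaw ω (z ⟨n, Finset.mem_Iic.mpr le_rfl⟩)
  measurable' := (Measurable.of_discrete (f := jumpLaw ω)).comp (measurable_pi_apply _)

instance (ω : Conductances G) (n : ℕ) : IsMarkovKernel (jumpKernel ω n) :=
  ⟨fun z => inferInstanceAs (IsProbabilityMeasure (jumpLaw ω (z ⟨n, _⟩)))⟩

/-- The law `P_x^ω` on pairs (sequence of successive positions, sequence of waiting times):
the positions form the Markov chain with jump laws `ω(x, ·) / μ^ω(x)` started at `x`, and the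
waiting times are i.i.d. exponential with mean `1`, independent of the positions. -/
def walkLaw (ω : Conductances G) (x : V) : Measure ((ℕ → V) × (ℕ → ℝ)) :=
  (Kernel.trajMeasure (X := fun _ : ℕ => V) (Measure.dirac x) (jumpKernel ω)).prod
    (Measure.infinitePi fun _ : ℕ => expMeasure 1)

end CSRW

/-- The number of jumps up to time `t`, when the waiting times are `τ 0, τ 1, …`: the number of
jump times `τ 0 + ⋯ + τ k` that are at most `t` (almost surely finitely many). -/
def jumpCount (t : ℝ) (τ : ℕ → ℝ) : ℕ :=
  {k : ℕ | ∑ i ∈ Finset.range (k + 1), τ i ≤ t}.ncard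

/-- The position `Y_t` of the constant speed random walk at time `t`. -/
def walk (t : ℝ) (s : (ℕ → V) × (ℕ → ℝ)) : V :=
  s.1 (jumpCount t s.2)

/-- The heat kernel `q^ω(t, x, y) = P_x^ω[Y_t = y] / μ^ω(y)` of the constant speed random walk. -/
def heatKernel {G : SimpleGraph V} [G.LocallyFinite] [MeasurableSpace V]
    [DiscreteMeasurableSpace V] (ω : Conductances G) (t : ℝ) (x y : V) : ℝ :=
  (walkLaw ω x).real {s | walk t s = y} / mu ω y

end WeightedGraph

end

open WeightedGraph

noncomputable section

namespace WeightedGraph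

universe u

/-! ### Exponential generating functions -/

section ExpSeries

/-! The heat kernel is compared with kernels of the walk killed outside balls `B(x, R)`. In `n ≤ R`
jumps the walk cannot leave the ball, and the number of jumps up to time `t` is dominated by a
Poisson law, so any bound on the killed kernels along arbitrarily large `R` passes to `heatKernel`
(`heatKernel_le_of_killedKernel_le`). Killed kernels live on finite sets, where differentiation and
summation by parts cost nothing.

On a fixed ball, the `ℓ¹` Sobolev inequality applied to a power of `f`, Cauchy–Schwarz between the
energy and `ν`, and Hölder with the moments of `μ` and `ν` give a Nash inequality
(`nash_of_sobolev`); the condition `1/p + 1/q < 2/d'` is exactly what makes its exponent positive.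
Nash's argument yields the on-diagonal bound `R^(-d) (R²/t)^γ`, which has the right size only for
`R` of order `√t`. The moment of `ν` also gives `1/μ ≤ C R^g` on the ball. Nothing better is
available at a single vertex, since the averages are controlled only on large balls centred at `x`.

Davies' exponential weights give Gaussian decay but cost the starting density `1/μ(y)`. Iterating
the weighted estimate over shrinking distances and times reduces this cost to a term carrying a
stretched exponential factor, which beats `R^g` (`farMass_le_gaussian`). With `R` of order
`max(d(x,y), √t)`, splitting at half time gives the Gaussian bound, and part of the Gaussian absorbs
`(R²/t)^γ`.

To let `R` grow without paying `(R²/t)^γ`, the maximum principle (`killedKernel_le_add`) bounds the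
change from `B(x, R)` to `B(x, 2R)` by the kernel on the annulus, which is at most `C R^(-d)` times
the wanted Gaussian; the dyadic sum converges. If `d(x,y) ≥ t`, Davies' pointwise bound with a
logarithmic slope suffices, because its exponential decay in `d(x,y)` beats every power. -/

theorem summable_pow_div_factorial_mul {a : ℕ → ℝ} {C : ℝ} (ha : ∀ n, |a n| ≤ C) (t : ℝ) :
    Summable fun n : ℕ => t ^ n / n.factorial * a n := by
  refine Summable.of_norm_bounded ((Real.summable_pow_div_factorial |t|).mul_right C) fun n => ?_
  rw [norm_mul, norm_div, norm_pow, Real.norm_eq_abs, Real.norm_natCast, Real.norm_eq_abs]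
  gcongr
  exact ha n

/-- Differentiation shifts the coefficient sequence, so a recursion in the number of jumps becomes
the heat equation. -/
theorem hasDerivAt_tsum_pow_div_factorial_mul {a : ℕ → ℝ} {C : ℝ} (ha : ∀ n, |a n| ≤ C) (t : ℝ) :
    HasDerivAt (fun s : ℝ => ∑' n : ℕ, s ^ n / n.factorial * a n)
      (∑' n : ℕ, t ^ n / n.factorial * a (n + 1)) t := by
  set T : ℝ := |t| + 1
  have hC : 0 ≤ C := (abs_nonneg _).trans (ha 0)
  have hsucc : ∀ (n : ℕ) (y : ℝ), ((n + 1 : ℕ) : ℝ) * y ^ n / (n + 1).factorial * a (n + 1) =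
      y ^ n / n.factorial * a (n + 1) := by
    intro n y
    have h1 : ((n : ℝ) + 1) ≠ 0 := by positivity
    have h2 : (n.factorial : ℝ) ≠ 0 := by positivity
    rw [Nat.factorial_succ]
    push_cast
    field_simp
  have key := hasDerivAt_tsum_of_isPreconnected (𝕜 := ℝ)
    (g := fun (n : ℕ) (s : ℝ) => s ^ n / n.factorial * a n)
    (g' := fun (n : ℕ) (s : ℝ) => (n : ℝ) * s ^ (n - 1) / n.factorial * a n)
    (u := fun n : ℕ => (n : ℝ) * T ^ (n - 1) / n.factorial * C) (t := Metric.ball 0 T)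
    (y₀ := t) (y := t) ?_ Metric.isOpen_ball (convex_ball 0 T).isPreconnected ?_ ?_ ?_
    (summable_pow_div_factorial_mul ha t) ?_
  · rw [Summable.tsum_eq_zero_add] at key
    · simp only [Nat.add_sub_cancel, hsucc] at key
      simpa using key
    · rw [← summable_nat_add_iff 1]
      simp only [Nat.add_sub_cancel, hsucc]
      exact summable_pow_div_factorial_mul (fun n => ha (n + 1)) t
  · rw [← summable_nat_add_iff 1]
    refine ((Real.summable_pow_div_factorial T).mul_right C).congr fun n => ?_
    have h1 : ((n : ℝ) + 1) ≠ 0 := by positivity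
    have h2 : (n.factorial : ℝ) ≠ 0 := by positivity
    rw [Nat.factorial_succ]
    push_cast
    field_simp
  · intro n y _
    exact ((hasDerivAt_pow n y).div_const _).mul_const _
  · intro n y hy
    rw [mem_ball_zero_iff, Real.norm_eq_abs] at hy
    rw [norm_mul, norm_div, norm_mul, norm_pow, Real.norm_natCast, Real.norm_natCast,
      Real.norm_eq_abs, Real.norm_eq_abs]
    gcongr
    exact ha n
  · simp [T]
  · simp [T]

end ExpSeries

/-! ### Heat kernels killed outside a finite set -/

section Killed

variable {V : Type*}

/-- Symmetric non-negative weights `c`, together with a positive speed measure `m` that dominates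
the total weight at each point. -/
structure IsWeight (c : V → V → ℝ) (m : V → ℝ) : Prop where
  symm : ∀ x y, c x y = c y x
  nonneg : ∀ x y, 0 ≤ c x y
  sum_le : ∀ (A : Finset V) x, ∑ y ∈ A, c x y ≤ m x
  pos : ∀ x, 0 < m x

open Classical in
/-- The density of the `n`-step transition probability from `y` of the chain killed outside `A`. -/
def killedIter (c : V → V → ℝ) (m : V → ℝ) (A : Finset V) (y : V) : ℕ → V → ℝ
  | 0, z => if z = y then (m y)⁻¹ else 0
  | n + 1, z => if z ∈ A then (∑ w ∈ A, c z w * killedIter c m A y n w) / m z else 0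

/-- The heat kernel of the continuous-time walk with jump rate `1` that is killed outside `A`. -/
def killedKernel (c : V → V → ℝ) (m : V → ℝ) (A : Finset V) (y : V) (t : ℝ) (z : V) : ℝ :=
  Real.exp (-t) * ∑' n : ℕ, t ^ n / n.factorial * killedIter c m A y n z

/-- The generator of the walk killed outside `A`. -/
def killedGenerator (c : V → V → ℝ) (m : V → ℝ) (A : Finset V) (f : V → ℝ) (z : V) : ℝ :=
  (∑ w ∈ A, c z w * f w) / m z - f z

/-- `u` solves the heat equation on `A` with zero boundary condition outside `A`. -/
def IsHeatSolution (c : V → V → ℝ) (m : V → ℝ) (A : Finset V) (u : ℝ → V → ℝ) : Prop :=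
  ∀ t, ∀ z ∈ A, HasDerivAt (fun s => u s z) (killedGenerator c m A (u t) z) t

variable {c : V → V → ℝ} {m : V → ℝ} {A : Finset V} {y : V}

/-- The Dirichlet form of the killed walk is nonnegative: `2ab ≤ a² + b²` on each pair, then
symmetry of the weights. -/
theorem IsWeight.sum_mul_mul_le (h : IsWeight c m) (f : V → ℝ) :
    ∑ z ∈ A, ∑ w ∈ A, c z w * (f z * f w) ≤ ∑ z ∈ A, m z * f z ^ 2 := by
  have h4 : ∀ z w, c z w * (f z * f w) ≤ (c z w * f z ^ 2 + c w z * f w ^ 2) / 2 := by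
    intro z w
    rw [h.symm w z]
    nlinarith [mul_nonneg (h.nonneg z w) (sq_nonneg (f z - f w))]
  calc _ ≤ ∑ z ∈ A, ∑ w ∈ A, (c z w * f z ^ 2 + c w z * f w ^ 2) / 2 :=
        Finset.sum_le_sum fun z _ => Finset.sum_le_sum fun w _ => h4 z w
    _ = (∑ z ∈ A, ∑ w ∈ A, c z w * f z ^ 2 + ∑ w ∈ A, ∑ z ∈ A, c z w * f z ^ 2) / 2 := by
        rw [← Finset.sum_add_distrib, Finset.sum_div]
        refine Finset.sum_congr rfl fun z _ => ?_
        rw [← Finset.sum_add_distrib, Finset.sum_div]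
    _ = ∑ z ∈ A, ∑ w ∈ A, c z w * f z ^ 2 := by
        rw [Finset.sum_comm (f := fun w z => c z w * f z ^ 2)]
        ring
    _ ≤ _ := by
        refine Finset.sum_le_sum fun z _ => ?_
        rw [← Finset.sum_mul]
        exact mul_le_mul_of_nonneg_right (h.sum_le A z) (sq_nonneg _)

theorem IsWeight.sum_mul_killedGenerator (h : IsWeight c m) (f g : V → ℝ) :
    ∑ z ∈ A, m z * (f z * killedGenerator c m A g z) =
      ∑ z ∈ A, ∑ w ∈ A, c z w * (f z * g w) - ∑ z ∈ A, m z * (f z * g z) := by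
  rw [← Finset.sum_sub_distrib]
  refine Finset.sum_congr rfl fun z _ => ?_
  have hz := (h.pos z).ne'
  have : ∑ w ∈ A, c z w * (f z * g w) = f z * ∑ w ∈ A, c z w * g w := by
    rw [Finset.mul_sum]
    exact Finset.sum_congr rfl fun w _ => by ring
  rw [this, killedGenerator]
  field_simp

theorem IsWeight.sum_mul_killedGenerator_symm (h : IsWeight c m) (f g : V → ℝ) :
    ∑ z ∈ A, m z * (f z * killedGenerator c m A g z) =
      ∑ z ∈ A, m z * (killedGenerator c m A f z * g z) := by
  have h2 : ∀ z, m z * (killedGenerator c m A f z * g z) = m z * (g z * killedGenerator c m A f z) :=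
    fun z => by ring
  simp_rw [h2]
  rw [h.sum_mul_killedGenerator f g, h.sum_mul_killedGenerator g f, Finset.sum_comm]
  congr 1
  · refine Finset.sum_congr rfl fun z _ => Finset.sum_congr rfl fun w _ => ?_
    rw [h.symm w z]; ring
  · exact Finset.sum_congr rfl fun z _ => by ring

theorem killedIter_nonneg (h : IsWeight c m) (n : ℕ) (z : V) : 0 ≤ killedIter c m A y n z := by
  induction n generalizing z with
  | zero =>
    rw [killedIter]
    split_ifs
    · exact inv_nonneg.mpr (h.pos y).le
    · exact le_rfl
  | succ n ih =>
    rw [killedIter]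
    split_ifs
    · exact div_nonneg (Finset.sum_nonneg fun w _ => mul_nonneg (h.nonneg _ _) (ih w)) (h.pos z).le
    · exact le_rfl

theorem killedIter_of_notMem (hy : y ∈ A) (n : ℕ) {z : V} (hz : z ∉ A) :
    killedIter c m A y n z = 0 := by
  cases n with
  | zero =>
    rw [killedIter, if_neg]
    rintro rfl
    exact hz hy
  | succ n => rw [killedIter, if_neg hz]

theorem sum_mul_killedIter_le_one (h : IsWeight c m) (hy : y ∈ A) (n : ℕ) :
    ∑ z ∈ A, m z * killedIter c m A y n z ≤ 1 := by
  classical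
  induction n with
  | zero =>
    simp only [killedIter, mul_ite, mul_zero]
    rw [Finset.sum_ite_eq' A y, if_pos hy, mul_inv_cancel₀ (h.pos y).ne']
  | succ n ih =>
    have : ∀ z ∈ A, m z * killedIter c m A y (n + 1) z =
        ∑ w ∈ A, c z w * killedIter c m A y n w := by
      intro z hz
      rw [killedIter, if_pos hz, mul_div_cancel₀ _ (h.pos z).ne']
    rw [Finset.sum_congr rfl this, Finset.sum_comm]
    refine le_trans (Finset.sum_le_sum fun w _ => ?_) ih
    rw [← Finset.sum_mul]
    refine mul_le_mul_of_nonneg_right ?_ (killedIter_nonneg h n w)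
    simp_rw [h.symm _ w]
    exact h.sum_le A w

/-- Total mass at most one leaves density at most `(m z)⁻¹` at `z`. Uniformity in `n` is what makes
the exponential series converge. -/
theorem killedIter_le (h : IsWeight c m) (hy : y ∈ A) (n : ℕ) (z : V) :
    killedIter c m A y n z ≤ (m z)⁻¹ := by
  by_cases hz : z ∈ A
  · rw [← one_div, le_div_iff₀' (h.pos z)]
    exact (Finset.single_le_sum (f := fun z => m z * killedIter c m A y n z)
      (fun w _ => mul_nonneg (h.pos w).le (killedIter_nonneg h n w)) hz).trans
      (sum_mul_killedIter_le_one h hy n)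
  · rw [killedIter_of_notMem hy n hz]
    exact inv_nonneg.mpr (h.pos z).le

theorem abs_killedIter_le (h : IsWeight c m) (hy : y ∈ A) (n : ℕ) (z : V) :
    |killedIter c m A y n z| ≤ (m z)⁻¹ := by
  rw [abs_of_nonneg (killedIter_nonneg h n z)]
  exact killedIter_le h hy n z

theorem summable_killedIter (h : IsWeight c m) (hy : y ∈ A) (t : ℝ) (z : V) :
    Summable fun n : ℕ => t ^ n / n.factorial * killedIter c m A y n z :=
  summable_pow_div_factorial_mul (fun n => abs_killedIter_le h hy n z) t

theorem killedKernel_nonneg (h : IsWeight c m) {t : ℝ} (ht : 0 ≤ t) (z : V) :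
    0 ≤ killedKernel c m A y t z :=
  mul_nonneg (Real.exp_pos _).le
    (tsum_nonneg fun n => mul_nonneg (by positivity) (killedIter_nonneg h n z))

theorem killedKernel_of_notMem (hy : y ∈ A) (t : ℝ) {z : V} (hz : z ∉ A) :
    killedKernel c m A y t z = 0 := by
  simp [killedKernel, killedIter_of_notMem hy _ hz]

open Classical in
theorem killedKernel_zero (z : V) :
    killedKernel c m A y 0 z = if z = y then (m y)⁻¹ else 0 := by
  rw [killedKernel, tsum_eq_single 0]
  · simp [killedIter]
  · intro n hn
    simp [hn]

theorem sum_mul_killedKernel_le_one (h : IsWeight c m) (hy : y ∈ A) {t : ℝ} (ht : 0 ≤ t) :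
    ∑ z ∈ A, m z * killedKernel c m A y t z ≤ 1 := by
  have h1 : ∑ z ∈ A, m z * killedKernel c m A y t z =
      Real.exp (-t) * ∑' n : ℕ, t ^ n / n.factorial * ∑ z ∈ A, m z * killedIter c m A y n z := by
    simp_rw [Finset.mul_sum]
    rw [Summable.tsum_finsetSum, Finset.mul_sum]
    · refine Finset.sum_congr rfl fun z _ => ?_
      rw [killedKernel, mul_left_comm, ← tsum_mul_left]
      congr 2
      ext n
      ring
    · intro z _
      refine ((summable_killedIter h hy t z).mul_left (m z)).congr fun n => by ring
  have hexp : ∑' n : ℕ, t ^ n / n.factorial = Real.exp t := by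
    rw [Real.exp_eq_exp_ℝ, NormedSpace.exp_eq_tsum_div]
  rw [h1]
  have habs : ∀ n, |∑ z ∈ A, m z * killedIter c m A y n z| ≤ 1 := fun n => by
    rw [abs_of_nonneg (Finset.sum_nonneg fun z _ =>
      mul_nonneg (h.pos z).le (killedIter_nonneg h n z))]
    exact sum_mul_killedIter_le_one h hy n
  calc _ ≤ Real.exp (-t) * ∑' n : ℕ, t ^ n / n.factorial := by
        refine mul_le_mul_of_nonneg_left ?_ (Real.exp_pos _).le
        refine Summable.tsum_le_tsum (fun n => ?_) (summable_pow_div_factorial_mul habs t)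
          (Real.summable_pow_div_factorial t)
        exact mul_le_of_le_one_right (by positivity) (sum_mul_killedIter_le_one h hy n)
    _ = 1 := by rw [hexp, ← Real.exp_add]; simp

theorem isHeatSolution_killedKernel (h : IsWeight c m) (hy : y ∈ A) :
    IsHeatSolution c m A (killedKernel c m A y) := by
  intro t z hz
  have h1 := hasDerivAt_tsum_pow_div_factorial_mul (fun n => abs_killedIter_le h hy n z) t
  have h2 : HasDerivAt (fun s : ℝ => Real.exp (-s)) (-Real.exp (-t)) t := by
    simpa using (hasDerivAt_neg t).exp
  have h3 := h2.mul h1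
  refine h3.congr_deriv ?_
  have h4 : ∑' n : ℕ, t ^ n / n.factorial * killedIter c m A y (n + 1) z =
      (∑ w ∈ A, c z w * ∑' n : ℕ, t ^ n / n.factorial * killedIter c m A y n w) / m z := by
    simp_rw [← tsum_mul_left]
    rw [← Summable.tsum_finsetSum fun w _ => (summable_killedIter h hy t w).mul_left (c z w),
      ← tsum_div_const]
    congr 1
    ext n
    rw [killedIter, if_pos hz, ← mul_div_assoc, Finset.mul_sum]
    congr 1
    exact Finset.sum_congr rfl fun w _ => by ring
  rw [h4, killedGenerator]
  have h5 : ∑ w ∈ A, c z w * killedKernel c m A y t w =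
      Real.exp (-t) * ∑ w ∈ A, c z w * ∑' n : ℕ, t ^ n / n.factorial * killedIter c m A y n w := by
    rw [Finset.mul_sum]
    exact Finset.sum_congr rfl fun w _ => by rw [killedKernel]; ring
  rw [h5, killedKernel]
  ring

/-- The pairing of `u r` with `v (s + t - r)` is constant in `r` because the killed generator is
symmetric. Chapman–Kolmogorov and the symmetry of the kernel follow. -/
theorem IsHeatSolution.sum_mul_eq (h : IsWeight c m) {u v : ℝ → V → ℝ}
    (hu : IsHeatSolution c m A u) (hv : IsHeatSolution c m A v) (s t : ℝ) :
    ∑ z ∈ A, m z * (u s z * v t z) = ∑ z ∈ A, m z * (u 0 z * v (s + t) z) := by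
  have hd : ∀ r : ℝ, HasDerivAt (fun r => ∑ z ∈ A, m z * (u r z * v (s + t - r) z)) 0 r := by
    intro r
    have h1 : HasDerivAt (fun r => ∑ z ∈ A, m z * (u r z * v (s + t - r) z))
        (∑ z ∈ A, m z * (killedGenerator c m A (u r) z * v (s + t - r) z +
          u r z * -killedGenerator c m A (v (s + t - r)) z)) r := by
      refine HasDerivAt.fun_sum fun z hz => HasDerivAt.const_mul _ ?_
      refine (hu r z hz).mul ?_
      have h2 : HasDerivAt (fun r : ℝ => s + t - r) (-1) r := by
        simpa using (hasDerivAt_id r).const_sub (s + t)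
      simpa [Function.comp_def] using (hv (s + t - r) z hz).comp r h2
    refine h1.congr_deriv ?_
    simp_rw [mul_add, mul_neg]
    rw [Finset.sum_add_distrib, Finset.sum_neg_distrib, h.sum_mul_killedGenerator_symm]
    ring
  have := is_const_of_deriv_eq_zero (fun r => (hd r).differentiableAt) (fun r => (hd r).deriv) s 0
  simpa using this

theorem sum_mul_killedKernel_zero_mul (h : IsWeight c m) (hy : y ∈ A) (f : V → ℝ) :
    ∑ z ∈ A, m z * (killedKernel c m A y 0 z * f z) = f y := by
  classical
  simp only [killedKernel_zero, ite_mul, zero_mul, mul_ite, mul_zero]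
  rw [Finset.sum_ite_eq' A y, if_pos hy, ← mul_assoc, mul_inv_cancel₀ (h.pos y).ne', one_mul]

theorem killedKernel_add (h : IsWeight c m) {x : V} (hx : x ∈ A) (hy : y ∈ A) (s t : ℝ) :
    killedKernel c m A y (s + t) x =
      ∑ z ∈ A, m z * (killedKernel c m A x s z * killedKernel c m A y t z) := by
  rw [(isHeatSolution_killedKernel h hx).sum_mul_eq h (isHeatSolution_killedKernel h hy),
    sum_mul_killedKernel_zero_mul h hx]

theorem killedKernel_symm (h : IsWeight c m) {x : V} (hx : x ∈ A) (hy : y ∈ A) (t : ℝ) :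
    killedKernel c m A y t x = killedKernel c m A x t y := by
  have h1 := killedKernel_add h hx hy t 0
  have h2 := killedKernel_add h hy hx 0 t
  rw [add_zero] at h1
  rw [zero_add] at h2
  rw [h1, h2]
  exact Finset.sum_congr rfl fun z _ => by ring

/-- Davies' weighted `ℓ²` bound. -/
theorem IsHeatSolution.weighted_sq_le (h : IsWeight c m) {u : ℝ → V → ℝ}
    (hu : IsHeatSolution c m A u) (hu0 : ∀ t, 0 ≤ t → ∀ z, 0 ≤ u t z) {ψ : V → ℝ} {lam : ℝ}
    (hψ : ∀ z w, c z w ≠ 0 → |ψ z - ψ w| ≤ lam) {s t : ℝ} (hs : 0 ≤ s) (hst : s ≤ t) :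
    ∑ z ∈ A, m z * (Real.exp (ψ z) * u t z) ^ 2 ≤
      Real.exp (2 * (Real.cosh lam - 1) * (t - s)) *
        ∑ z ∈ A, m z * (Real.exp (ψ z) * u s z) ^ 2 := by
  set W : ℝ → ℝ := fun r => ∑ z ∈ A, m z * (Real.exp (ψ z) * u r z) ^ 2 with hW
  set Λ : ℝ := 2 * (Real.cosh lam - 1) with hΛ
  have hWd : ∀ r, HasDerivAt W (2 * ∑ z ∈ A, m z * ((Real.exp (ψ z) ^ 2 * u r z) *
      killedGenerator c m A (u r) z)) r := by
    intro r
    rw [Finset.mul_sum]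
    refine HasDerivAt.fun_sum fun z hz => ?_
    refine ((((hu r z hz).const_mul (Real.exp (ψ z))).fun_pow 2).const_mul (m z)).congr_deriv ?_
    ring
  have hbound : ∀ r, 0 ≤ r → 2 * ∑ z ∈ A, m z * ((Real.exp (ψ z) ^ 2 * u r z) *
      killedGenerator c m A (u r) z) ≤ Λ * W r := by
    intro r hr
    rw [h.sum_mul_killedGenerator (fun z => Real.exp (ψ z) ^ 2 * u r z) (u r)]
    set w : V → ℝ := fun z => Real.exp (ψ z) * u r z
    have e1 : ∑ z ∈ A, m z * (Real.exp (ψ z) ^ 2 * u r z * u r z) = W r :=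
      Finset.sum_congr rfl fun z _ => by ring
    -- With `w = exp(ψ) u`, the cross term carries `exp(ψ z - ψ v)`; averaging it with its image
    -- under swapping `z` and `v` leaves `cosh (ψ z - ψ v)`, which is at most `cosh lam` wherever `c
    -- z v ≠ 0`.
    have e2 : ∑ z ∈ A, ∑ v ∈ A, c z v * (Real.exp (ψ z) ^ 2 * u r z * u r v) =
        ∑ z ∈ A, ∑ v ∈ A, c z v * (Real.cosh (ψ z - ψ v) * (w z * w v)) := by
      have e3 : ∀ z v, Real.exp (ψ z) ^ 2 * u r z * u r v =
          Real.exp (ψ z - ψ v) * (w z * w v) := by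
        intro z v
        have : Real.exp (ψ z) = Real.exp (ψ z - ψ v) * Real.exp (ψ v) := by
          rw [← Real.exp_add]; ring_nf
        simp only [w]
        nth_rewrite 1 [pow_two]
        nth_rewrite 2 [this]
        ring
      simp_rw [e3]
      have e4 : ∑ z ∈ A, ∑ v ∈ A, c z v * (Real.exp (ψ z - ψ v) * (w z * w v)) =
          ∑ z ∈ A, ∑ v ∈ A, c z v * (Real.exp (-(ψ z - ψ v)) * (w z * w v)) := by
        rw [Finset.sum_comm]
        refine Finset.sum_congr rfl fun z _ => Finset.sum_congr rfl fun v _ => ?_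
        rw [h.symm v z, neg_sub]
        ring
      have e5 : ∑ z ∈ A, ∑ v ∈ A, c z v * (Real.cosh (ψ z - ψ v) * (w z * w v)) =
          (∑ z ∈ A, ∑ v ∈ A, c z v * (Real.exp (ψ z - ψ v) * (w z * w v)) +
          ∑ z ∈ A, ∑ v ∈ A, c z v * (Real.exp (-(ψ z - ψ v)) * (w z * w v))) / 2 := by
        rw [← Finset.sum_add_distrib, Finset.sum_div]
        refine Finset.sum_congr rfl fun z _ => ?_
        rw [← Finset.sum_add_distrib, Finset.sum_div]
        refine Finset.sum_congr rfl fun v _ => ?_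
        rw [Real.cosh_eq]
        ring
      rw [e5, ← e4]
      ring
    have e6 : ∑ z ∈ A, ∑ v ∈ A, c z v * (Real.cosh (ψ z - ψ v) * (w z * w v)) ≤
        Real.cosh lam * W r := by
      have hw : ∀ z, 0 ≤ w z := fun z => mul_nonneg (Real.exp_pos _).le (hu0 r hr z)
      have e7 : ∀ z v, c z v * (Real.cosh (ψ z - ψ v) * (w z * w v)) ≤
          Real.cosh lam * ((c z v * w z ^ 2 + c v z * w v ^ 2) / 2) := by
        intro z v
        by_cases hc : c z v = 0
        · rw [← h.symm z v, hc]; simp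
        · have h1 : Real.cosh (ψ z - ψ v) ≤ Real.cosh lam := by
            rw [Real.cosh_le_cosh]
            exact (hψ z v hc).trans (le_abs_self _)
          have h2 : w z * w v ≤ (w z ^ 2 + w v ^ 2) / 2 := by nlinarith [sq_nonneg (w z - w v)]
          have h3 : 0 < Real.cosh lam := Real.cosh_pos _
          rw [← h.symm z v]
          calc c z v * (Real.cosh (ψ z - ψ v) * (w z * w v))
              ≤ c z v * (Real.cosh lam * ((w z ^ 2 + w v ^ 2) / 2)) := by
                refine mul_le_mul_of_nonneg_left ?_ (h.nonneg _ _)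
                exact mul_le_mul h1 h2 (mul_nonneg (hw z) (hw v)) h3.le
            _ = _ := by ring
      have e8 : ∑ z ∈ A, ∑ v ∈ A, c z v * w z ^ 2 ≤ W r := by
        refine Finset.sum_le_sum fun z _ => ?_
        rw [← Finset.sum_mul]
        exact mul_le_mul_of_nonneg_right (h.sum_le A z) (sq_nonneg _)
      calc _ ≤ ∑ z ∈ A, ∑ v ∈ A, Real.cosh lam * ((c z v * w z ^ 2 + c v z * w v ^ 2) / 2) :=
            Finset.sum_le_sum fun z _ => Finset.sum_le_sum fun v _ => e7 z v
        _ = Real.cosh lam * ((∑ z ∈ A, ∑ v ∈ A, c z v * w z ^ 2 +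
              ∑ v ∈ A, ∑ z ∈ A, c z v * w z ^ 2) / 2) := by
            rw [← Finset.sum_add_distrib, Finset.sum_div, Finset.mul_sum]
            refine Finset.sum_congr rfl fun z _ => ?_
            rw [← Finset.sum_add_distrib, Finset.sum_div, Finset.mul_sum]
        _ = Real.cosh lam * ∑ z ∈ A, ∑ v ∈ A, c z v * w z ^ 2 := by
            rw [Finset.sum_comm (f := fun v z => c z v * w z ^ 2)]
            ring
        _ ≤ _ := mul_le_mul_of_nonneg_left e8 (Real.cosh_pos _).le
    rw [e1, e2, hΛ]
    linarith
  -- Grönwall's argument for `W' ≤ Λ W`.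
  have hanti : AntitoneOn (fun r => Real.exp (-(Λ * r)) * W r) (Set.Ici 0) := by
    have hd : ∀ r, HasDerivAt (fun r => Real.exp (-(Λ * r)) * W r)
        (Real.exp (-(Λ * r)) * -Λ * W r + Real.exp (-(Λ * r)) *
          (2 * ∑ z ∈ A, m z * ((Real.exp (ψ z) ^ 2 * u r z) *
            killedGenerator c m A (u r) z))) r := by
      intro r
      have h1 : HasDerivAt (fun r : ℝ => Real.exp (-(Λ * r))) (Real.exp (-(Λ * r)) * -Λ) r := by
        refine HasDerivAt.exp ?_
        simpa using ((hasDerivAt_id r).const_mul Λ).fun_neg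
      exact h1.mul (hWd r)
    refine antitoneOn_of_deriv_nonpos (convex_Ici 0)
      (fun r _ => (hd r).continuousAt.continuousWithinAt)
      (fun r _ => (hd r).differentiableAt.differentiableWithinAt) fun r hr => ?_
    rw [interior_Ici] at hr
    rw [(hd r).deriv]
    have := mul_le_mul_of_nonneg_left (hbound r (le_of_lt hr)) (Real.exp_pos (-(Λ * r))).le
    linarith
  have hfin := hanti (Set.mem_Ici.mpr hs) (Set.mem_Ici.mpr (hs.trans hst)) hst
  simp only at hfin
  have h9 : Real.exp (Λ * (t - s)) = Real.exp (-(Λ * s)) * Real.exp (Λ * t) := by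
    rw [← Real.exp_add]; ring_nf
  have h10 : Real.exp (-(Λ * t)) * Real.exp (Λ * t) = 1 := by
    rw [← Real.exp_add]; simp
  calc W t = (Real.exp (-(Λ * t)) * W t) * Real.exp (Λ * t) := by
        rw [mul_right_comm, h10, one_mul]
    _ ≤ (Real.exp (-(Λ * s)) * W s) * Real.exp (Λ * t) :=
        mul_le_mul_of_nonneg_right hfin (Real.exp_pos _).le
    _ = _ := by rw [h9]; ring

/-- Comparison of the kernels killed outside `A ⊆ A'`: they differ by at most the supremum of the
larger one over `A' \ A`. -/
theorem killedKernel_le_add (h : IsWeight c m) {A' : Finset V} (hA : A ⊆ A') {x : V}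
    (hx : x ∈ A) (hy : y ∈ A) {t M : ℝ} (ht : 0 ≤ t) (hM0 : 0 ≤ M)
    (hM : ∀ s, 0 ≤ s → s ≤ t → ∀ w ∈ A', w ∉ A → killedKernel c m A' y s w ≤ M) :
    killedKernel c m A' y t x ≤ killedKernel c m A y t x + M := by
  classical
  set v := killedKernel c m A x with hv
  set u := killedKernel c m A' y with hu
  -- Maximum principle in Duhamel form: `u - M` is a subsolution on `A`, so its pairing with the
  -- time-reversed smaller kernel decreases from `s = 0` to `s = t`, where it equals `u t x - M`.
  set Φ : ℝ → ℝ := fun s => ∑ z ∈ A, m z * (v (t - s) z * (u s z - M)) with hΦ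
  have hd : ∀ s, HasDerivAt Φ (∑ z ∈ A, m z * (v (t - s) z * killedGenerator c m A' (u s) z) -
      ∑ z ∈ A, m z * (v (t - s) z * killedGenerator c m A (fun z => u s z - M) z)) s := by
    intro s
    rw [h.sum_mul_killedGenerator_symm (v (t - s)), ← Finset.sum_sub_distrib]
    refine HasDerivAt.fun_sum fun z hz => ?_
    have h2 : HasDerivAt (fun r : ℝ => t - r) (-1) s := by
      simpa using (hasDerivAt_id s).const_sub t
    have h3 : HasDerivAt (fun r => v (t - r) z) (-killedGenerator c m A (v (t - s)) z) s := by
      simpa [Function.comp_def] using (isHeatSolution_killedKernel h hx (t - s) z hz).comp s h2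
    have h4 := (isHeatSolution_killedKernel h (hA hy) s z (hA hz)).sub_const M
    refine ((h3.mul h4).const_mul (m z)).congr_deriv ?_
    ring
  have hanti : AntitoneOn Φ (Set.Icc 0 t) := by
    refine antitoneOn_of_deriv_nonpos (convex_Icc 0 t)
      (fun r _ => (hd r).continuousAt.continuousWithinAt)
      (fun r _ => (hd r).differentiableAt.differentiableWithinAt) fun s hs => ?_
    rw [interior_Icc] at hs
    rw [(hd s).deriv, ← Finset.sum_sub_distrib]
    refine Finset.sum_nonpos fun z hz => ?_
    rw [← mul_sub, ← mul_sub]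
    refine mul_nonpos_of_nonneg_of_nonpos (h.pos z).le (mul_nonpos_of_nonneg_of_nonpos
      (killedKernel_nonneg h (sub_nonneg.mpr hs.2.le) z) ?_)
    have hsplit : ∑ w ∈ A', c z w * u s w =
        ∑ w ∈ A' \ A, c z w * u s w + ∑ w ∈ A, c z w * u s w :=
      (Finset.sum_sdiff hA).symm
    have hsplit' : ∑ w ∈ A' \ A, c z w + ∑ w ∈ A, c z w ≤ m z := by
      rw [Finset.sum_sdiff hA]
      exact h.sum_le A' z
    have h5 : ∑ w ∈ A' \ A, c z w * u s w ≤ (∑ w ∈ A' \ A, c z w) * M := by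
      rw [Finset.sum_mul]
      refine Finset.sum_le_sum fun w hw => mul_le_mul_of_nonneg_left ?_ (h.nonneg z w)
      rw [Finset.mem_sdiff] at hw
      exact hM s hs.1.le hs.2.le w hw.1 hw.2
    have h6 : ∑ w ∈ A, c z w * (u s w - M) = ∑ w ∈ A, c z w * u s w - (∑ w ∈ A, c z w) * M := by
      simp_rw [mul_sub]
      rw [Finset.sum_sub_distrib, Finset.sum_mul]
    -- The flow from `A' \ A` is at most `M` times the weight to that set, and the total weight at
    -- `z` is at most `m z`; hence the numerator is nonpositive.
    have h7 : killedGenerator c m A' (u s) z - killedGenerator c m A (fun z => u s z - M) z =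
        (∑ w ∈ A' \ A, c z w * u s w + (∑ w ∈ A, c z w) * M - m z * M) / m z := by
      simp only [killedGenerator]
      rw [h6, hsplit]
      have := (h.pos z).ne'
      field_simp
      ring
    rw [h7]
    refine div_nonpos_of_nonpos_of_nonneg ?_ (h.pos z).le
    nlinarith
  have h8 := hanti (Set.left_mem_Icc.mpr ht) (Set.right_mem_Icc.mpr ht) ht
  have h9 : Φ t = u t x - M := by
    simp only [hΦ, sub_self]
    exact sum_mul_killedKernel_zero_mul h hx (fun z => u t z - M)
  have h10 : Φ 0 ≤ killedKernel c m A y t x := by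
    have h11 : ∀ z ∈ A, m z * (v (t - 0) z * (u 0 z - M)) ≤
        m z * (killedKernel c m A y 0 z * v t z) := by
      intro z hz
      rw [sub_zero, mul_comm (killedKernel c m A y 0 z)]
      refine mul_le_mul_of_nonneg_left (mul_le_mul_of_nonneg_left ?_
        (killedKernel_nonneg h ht z)) (h.pos z).le
      rw [hu, killedKernel_zero, killedKernel_zero]
      linarith
    refine (Finset.sum_le_sum h11).trans ?_
    rw [sum_mul_killedKernel_zero_mul h hy, killedKernel_symm h hx hy]
  linarith

end Killed

/-! ### From a Nash inequality to on-diagonal decay -/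

section Nash

variable {V : Type*} {c : V → V → ℝ} {m : V → ℝ} {A : Finset V} {y : V}

/-- The `ℓ²` norm of the killed kernel decays polynomially under a Nash inequality on `A`. -/
theorem sum_mul_killedKernel_sq_le_of_nash (h : IsWeight c m) (hy : y ∈ A) {β S : ℝ} (hβ : 0 < β)
    (hS : 0 < S)
    (hN : ∀ f : V → ℝ, (∀ z, 0 ≤ f z) → (∀ z, z ∉ A → f z = 0) → ∑ z ∈ A, m z * f z ≤ 1 →
      (∑ z ∈ A, m z * f z ^ 2) ^ (1 + β) ≤
        S * (∑ z ∈ A, m z * f z ^ 2 - ∑ z ∈ A, ∑ w ∈ A, c z w * (f z * f w)))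
    {t : ℝ} (ht : 0 < t) :
    ∑ z ∈ A, m z * killedKernel c m A y t z ^ 2 ≤ (S / (2 * β * t)) ^ (1 / β) := by
  set u := killedKernel c m A y
  set F : ℝ → ℝ := fun s => ∑ z ∈ A, m z * u s z ^ 2 with hF
  set E : ℝ → ℝ := fun s => F s - ∑ z ∈ A, ∑ w ∈ A, c z w * (u s z * u s w) with hE
  have hF0 : ∀ s, 0 ≤ F s := fun s =>
    Finset.sum_nonneg fun z _ => mul_nonneg (h.pos z).le (sq_nonneg _)
  have hd : ∀ s, HasDerivAt F (-2 * E s) s := by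
    intro s
    have h1 : HasDerivAt F (∑ z ∈ A, m z * (2 * (u s z * killedGenerator c m A (u s) z))) s := by
      refine HasDerivAt.fun_sum fun z hz => ?_
      refine (((isHeatSolution_killedKernel h hy s z hz).fun_pow 2).const_mul (m z)).congr_deriv ?_
      simp only [u]
      ring
    refine h1.congr_deriv ?_
    have h2 := h.sum_mul_killedGenerator (A := A) (u s) (u s)
    have h3 : ∑ z ∈ A, m z * (2 * (u s z * killedGenerator c m A (u s) z)) =
        2 * ∑ z ∈ A, m z * (u s z * killedGenerator c m A (u s) z) := by
      rw [Finset.mul_sum]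
      exact Finset.sum_congr rfl fun z _ => by ring
    have h4 : ∑ z ∈ A, m z * (u s z * u s z) = F s :=
      Finset.sum_congr rfl fun z _ => by ring
    rw [h3, h2, h4, hE]
    ring
  have hnash : ∀ s, 0 ≤ s → F s ^ (1 + β) ≤ S * E s := fun s hs =>
    hN (u s) (fun z => killedKernel_nonneg h hs z) (fun z hz => killedKernel_of_notMem hy s hz)
      (sum_mul_killedKernel_le_one h hy hs)
  have hE0 : ∀ s, 0 ≤ s → 0 ≤ E s := fun s hs =>
    nonneg_of_mul_nonneg_right ((Real.rpow_nonneg (hF0 s) _).trans (hnash s hs)) hS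
  have hanti : AntitoneOn F (Set.Ici 0) := by
    refine antitoneOn_of_deriv_nonpos (convex_Ici 0)
      (fun r _ => (hd r).continuousAt.continuousWithinAt)
      (fun r _ => (hd r).differentiableAt.differentiableWithinAt) fun r hr => ?_
    rw [interior_Ici] at hr
    rw [(hd r).deriv]
    have := hE0 r (le_of_lt hr)
    linarith
  -- If `F t > 0` then `F` is positive on all of `[0, t]` by monotonicity, so its negative power can
  -- be differentiated.
  rcases (hF0 t).eq_or_lt with h0 | hpos
  · change F t ≤ _
    rw [← h0]
    positivity
  have hFpos : ∀ s ∈ Set.Icc 0 t, 0 < F s := fun s hs =>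
    hpos.trans_le (hanti (Set.mem_Ici.mpr hs.1) (Set.mem_Ici.mpr ht.le) hs.2)
  -- Since `F' = -2E` and `F^(1+β) ≤ S E`, the function `F^(-β)` grows with slope at least `2β/S`;
  -- its value at `0` is then dropped.
  have hmono : MonotoneOn (fun s => F s ^ (-β) - 2 * β / S * s) (Set.Icc 0 t) := by
    have hd2 : ∀ s ∈ Set.Icc 0 t, HasDerivAt (fun s => F s ^ (-β) - 2 * β / S * s)
        (-2 * E s * (-β) * F s ^ (-β - 1) - 2 * β / S) s := fun s hs => by
      have h2 : HasDerivAt (fun s : ℝ => 2 * β / S * s) (2 * β / S) s := by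
        simpa using (hasDerivAt_id s).const_mul (2 * β / S)
      exact ((hd s).rpow_const (Or.inl (hFpos s hs).ne')).sub h2
    refine monotoneOn_of_deriv_nonneg (convex_Icc 0 t)
      (fun r hr => (hd2 r hr).continuousAt.continuousWithinAt)
      (fun r hr => (hd2 r (interior_subset hr)).differentiableAt.differentiableWithinAt)
      fun r hr => ?_
    have hr := interior_subset hr
    rw [(hd2 r hr).deriv]
    have h3 : F r ^ (-β - 1) * F r ^ (1 + β) = 1 := by
      rw [← Real.rpow_add (hFpos r hr)]
      ring_nf
      exact Real.rpow_zero _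
    have h4 : (1 : ℝ) / S ≤ F r ^ (-β - 1) * E r := by
      rw [div_le_iff₀ hS, mul_assoc]
      refine h3.symm.le.trans ?_
      refine mul_le_mul_of_nonneg_left ?_ (Real.rpow_nonneg (hF0 r) _)
      rw [mul_comm]
      exact hnash r hr.1
    have h5 : 2 * β / S = 2 * β * (1 / S) := by ring
    rw [h5]
    nlinarith
  have h6 := hmono (Set.left_mem_Icc.mpr ht.le) (Set.right_mem_Icc.mpr ht.le) ht.le
  simp only [mul_zero, sub_zero] at h6
  have h7 : 2 * β * t / S ≤ F t ^ (-β) := by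
    have : 0 ≤ F 0 ^ (-β) := Real.rpow_nonneg (hF0 0) _
    have h8 : 2 * β * t / S = 2 * β / S * t := by ring
    linarith
  have h9 : F t = (F t ^ (-β)) ^ (-(1 / β)) := by
    rw [← Real.rpow_mul hpos.le]
    have : -β * -(1 / β) = 1 := by field_simp
    rw [this, Real.rpow_one]
  change F t ≤ _
  rw [h9]
  calc (F t ^ (-β)) ^ (-(1 / β)) ≤ (2 * β * t / S) ^ (-(1 / β)) :=
        Real.rpow_le_rpow_of_nonpos (by positivity) h7 (by simp [hβ.le])
    _ = (S / (2 * β * t)) ^ (1 / β) := by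
        rw [Real.rpow_neg (by positivity), ← Real.inv_rpow (by positivity), inv_div]

end Nash

/-! ### Conductances and the energy of powers -/

section Sobolev

variable {V : Type*} {G : SimpleGraph V}

theorem conductance_symm (ω : Conductances G) (x y : V) : conductance ω x y = conductance ω y x := by
  unfold conductance
  by_cases h : G.Adj x y
  · rw [dif_pos h, dif_pos h.symm]
    congr 2
    exact Subtype.ext Sym2.eq_swap
  · rw [dif_neg h, dif_neg fun h' => h h'.symm]

theorem conductance_pos (ω : Conductances G) {x y : V} (h : G.Adj x y) : 0 < conductance ω x y := by
  rw [conductance, dif_pos h]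
  exact (ω ⟨s(x, y), h⟩).2

theorem conductance_of_not_adj (ω : Conductances G) {x y : V} (h : ¬ G.Adj x y) :
    conductance ω x y = 0 := by
  rw [conductance, dif_neg h]

theorem edgeDiff_nonneg (u : V → ℝ) (e : Sym2 V) : 0 ≤ edgeDiff u e := by
  induction e with
  | _ x y => exact abs_nonneg (u x - u y)

variable [G.LocallyFinite]

theorem sum_neighborFinset_eq {A : Finset V} {y : V} {a g : V → ℝ}
    (ha : ∀ z, ¬ G.Adj y z → a z = 0) (hg : ∀ z, z ∉ A → g z = 0) :
    ∑ z ∈ G.neighborFinset y, a z * g z = ∑ z ∈ A, a z * g z := by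
  classical
  have h1 : ∑ z ∈ G.neighborFinset y ∩ A, a z * g z = ∑ z ∈ G.neighborFinset y, a z * g z := by
    refine Finset.sum_subset Finset.inter_subset_left fun z hz hz' => ?_
    rw [hg z fun hA => hz' (Finset.mem_inter.mpr ⟨hz, hA⟩), mul_zero]
  have h2 : ∑ z ∈ G.neighborFinset y ∩ A, a z * g z = ∑ z ∈ A, a z * g z := by
    refine Finset.sum_subset Finset.inter_subset_right fun z hz hz' => ?_
    rw [ha z fun hA => hz' (Finset.mem_inter.mpr ⟨(G.mem_neighborFinset y z).mpr hA, hz⟩), zero_mul]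
  rw [← h1, h2]

theorem sum_le_sum_neighborFinset {A : Finset V} {y : V} {a : V → ℝ} (ha0 : ∀ z, 0 ≤ a z)
    (ha : ∀ z, ¬ G.Adj y z → a z = 0) :
    ∑ z ∈ A, a z ≤ ∑ z ∈ G.neighborFinset y, a z := by
  classical
  have h2 : ∑ z ∈ G.neighborFinset y ∩ A, a z = ∑ z ∈ A, a z := by
    refine Finset.sum_subset Finset.inter_subset_right fun z hz hz' => ?_
    rw [ha z fun hA => hz' (Finset.mem_inter.mpr ⟨(G.mem_neighborFinset y z).mpr hA, hz⟩)]
  rw [← h2]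
  exact Finset.sum_le_sum_of_subset_of_nonneg Finset.inter_subset_left fun z _ _ => ha0 z

theorem isWeight_conductance [Infinite V] (hG : G.Connected) (ω : Conductances G) :
    IsWeight (conductance ω) (mu ω) where
  symm := conductance_symm ω
  nonneg := conductance_nonneg ω
  sum_le A x := sum_le_sum_neighborFinset (conductance_nonneg ω x)
    fun _ h => conductance_of_not_adj ω h
  pos x := by
    obtain ⟨z, hz⟩ := hG.preconnected.exists_adj_of_nontrivial x
    exact Finset.sum_pos' (fun y _ => conductance_nonneg ω x y)
      ⟨z, (G.mem_neighborFinset x z).mpr hz, conductance_pos ω hz⟩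

/-- One neighbour suffices: its conductance is at most `μ`. This turns a moment of `ν` into a
pointwise lower bound for the speed measure. -/
theorem one_div_mu_le_nu [Infinite V] (hG : G.Connected) (ω : Conductances G) (x : V) :
    (mu ω x)⁻¹ ≤ nu ω x := by
  obtain ⟨z, hz⟩ := hG.preconnected.exists_adj_of_nontrivial x
  have hz' := (G.mem_neighborFinset x z).mpr hz
  have h1 : conductance ω x z ≤ mu ω x :=
    Finset.single_le_sum (f := fun y => conductance ω x y) (fun y _ => conductance_nonneg ω x y) hz'
  have h2 : 1 / conductance ω x z ≤ nu ω x :=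
    Finset.single_le_sum (f := fun y => 1 / conductance ω x y)
      (fun y _ => one_div_nonneg.mpr (conductance_nonneg ω x y)) hz'
  rw [← one_div]
  exact (one_div_le_one_div_of_le (conductance_pos ω hz) h1).trans h2

theorem nu_nonneg (ω : Conductances G) (x : V) : 0 ≤ nu ω x :=
  Finset.sum_nonneg fun y _ => one_div_nonneg.mpr (conductance_nonneg ω x y)

/-- Each edge is counted from each of its endpoints in the ball, hence once or twice. -/
theorem sum_edgesMeetingBall_le (u : V → ℝ) (x : V) (n : ℕ) :
    ∑ e ∈ edgesMeetingBall G x n, edgeDiff u e ≤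
      ∑ y ∈ ball G x n, ∑ z ∈ G.neighborFinset y, |u y - u z| := by
  classical
  have h1 : ∀ B : Finset V, ∑ e ∈ B.biUnion (fun y => G.incidenceFinset y), edgeDiff u e ≤
      ∑ y ∈ B, ∑ e ∈ G.incidenceFinset y, edgeDiff u e := by
    intro B
    induction B using Finset.induction_on with
    | empty => simp
    | insert b B hb ih =>
      rw [Finset.biUnion_insert, Finset.sum_insert hb]
      refine le_trans ?_ (add_le_add_right ih _)
      rw [← Finset.sum_union_inter]
      exact le_add_of_nonneg_right (Finset.sum_nonneg fun e _ => edgeDiff_nonneg u e)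
  have h2 : ∀ y, ∑ e ∈ G.incidenceFinset y, edgeDiff u e ≤
      ∑ z ∈ G.neighborFinset y, |u y - u z| := by
    intro y
    have h3 : G.incidenceFinset y ⊆ (G.neighborFinset y).image fun z => s(y, z) := by
      intro e he
      rw [SimpleGraph.mem_incidenceFinset] at he
      obtain ⟨z, rfl⟩ := he.2
      exact Finset.mem_image.mpr ⟨z, (G.mem_neighborFinset y z).mpr he.1, rfl⟩
    refine (Finset.sum_le_sum_of_subset_of_nonneg h3 fun e _ _ => edgeDiff_nonneg u e).trans ?_
    rw [Finset.sum_image]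
    · exact le_rfl
    · intro a _ b _ hab
      exact Sym2.congr_right.mp hab
  unfold edgesMeetingBall
  refine le_trans ?_ ((h1 _).trans (Finset.sum_le_sum fun y _ => h2 y))
  apply le_of_eq
  congr!

/-- For `b ≤ a` Bernoulli's inequality for `(b/a)^s` gives `a^s - b^s ≤ s a^(s-1) (a - b)`; the
second power only makes the bound symmetric. -/
theorem abs_rpow_sub_rpow_le {a b s : ℝ} (ha : 0 ≤ a) (hb : 0 ≤ b) (hs : 1 ≤ s) :
    |a ^ s - b ^ s| ≤ s * (a ^ (s - 1) + b ^ (s - 1)) * |a - b| := by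
  wlog hab : b ≤ a generalizing a b
  · rw [abs_sub_comm, abs_sub_comm a b, add_comm]
    exact this hb ha (le_of_not_ge hab)
  rw [abs_of_nonneg (sub_nonneg.mpr (Real.rpow_le_rpow hb hab (by linarith))),
    abs_of_nonneg (sub_nonneg.mpr hab)]
  rcases ha.eq_or_lt with rfl | hpos
  · have : b = 0 := le_antisymm hab hb
    subst this
    simp
  · have h1 := one_add_mul_self_le_rpow_one_add (s := b / a - 1)
      (by linarith [div_nonneg hb ha]) hs
    rw [add_sub_cancel, Real.div_rpow hb ha, le_div_iff₀ (Real.rpow_pos_of_pos hpos s)] at h1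
    have h2 : a ^ s = a ^ (s - 1) * a := by
      rw [← Real.rpow_add_one hpos.ne']
      ring_nf
    have h3 : (1 + s * (b / a - 1)) * a ^ s = a ^ s + s * (b - a) * a ^ (s - 1) := by
      rw [h2]
      field_simp
    rw [h3] at h1
    have h4 : 0 ≤ s * b ^ (s - 1) * (a - b) :=
      mul_nonneg (mul_nonneg (by linarith) (Real.rpow_nonneg hb _)) (sub_nonneg.mpr hab)
    nlinarith

/-- After the discrete chain rule, Cauchy–Schwarz with `1 = ω^(1/2) ω^(-1/2)` separates the energy
from a `ν`-weighted sum. The constant is `s² · 2 · 4`: a factor `2` because the energy is summed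
over oriented edges, and `4` from `(a + b)² ≤ 2a² + 2b²` together with symmetrisation. -/
theorem sq_sum_abs_rpow_sub_le (ω : Conductances G) {A : Finset V} {f : V → ℝ}
    (hf : ∀ z, 0 ≤ f z) (hfA : ∀ z, z ∉ A → f z = 0) {s : ℝ} (hs : 1 < s) :
    (∑ y ∈ A, ∑ z ∈ G.neighborFinset y, |f y ^ s - f z ^ s|) ^ 2 ≤
      8 * s ^ 2 * (∑ z ∈ A, mu ω z * f z ^ 2 -
        ∑ z ∈ A, ∑ w ∈ A, conductance ω z w * (f z * f w)) *
        ∑ z ∈ A, nu ω z * f z ^ (2 * s - 2) := by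
  set D := ∑ y ∈ A, ∑ z ∈ G.neighborFinset y, (f y ^ (s - 1) + f z ^ (s - 1)) * |f y - f z| with hD
  set E1 := ∑ y ∈ A, ∑ z ∈ G.neighborFinset y, conductance ω y z * (f y - f z) ^ 2 with hE1
  set T1 := ∑ y ∈ A, ∑ z ∈ G.neighborFinset y,
    1 / conductance ω y z * (f y ^ (s - 1) + f z ^ (s - 1)) ^ 2 with hT1
  set T := ∑ z ∈ A, nu ω z * f z ^ (2 * s - 2) with hT
  have hT0 : 0 ≤ T := Finset.sum_nonneg fun z _ => mul_nonneg (nu_nonneg ω z)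
    (Real.rpow_nonneg (hf z) _)
  have h1 : ∑ y ∈ A, ∑ z ∈ G.neighborFinset y, |f y ^ s - f z ^ s| ≤ s * D := by
    rw [hD, Finset.mul_sum]
    refine Finset.sum_le_sum fun y _ => ?_
    rw [Finset.mul_sum]
    refine Finset.sum_le_sum fun z _ => ?_
    rw [← mul_assoc]
    exact abs_rpow_sub_rpow_le (hf y) (hf z) hs.le
  have h2 : D ^ 2 ≤ E1 * T1 := by
    rw [hD, hE1, hT1, Finset.sum_sigma', Finset.sum_sigma', Finset.sum_sigma']
    refine Finset.sum_sq_le_sum_mul_sum_of_sq_le_mul _ (fun i _ => ?_) (fun i _ => ?_) fun i hi => ?_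
    · exact mul_nonneg (conductance_nonneg ω _ _) (sq_nonneg _)
    · exact mul_nonneg (one_div_nonneg.mpr (conductance_nonneg ω _ _)) (sq_nonneg _)
    · rw [Finset.mem_sigma, SimpleGraph.mem_neighborFinset] at hi
      have := (conductance_pos ω hi.2).ne'
      rw [mul_pow, sq_abs]
      refine le_of_eq ?_
      field_simp
  have hsq : ∀ z, (f z ^ (s - 1)) ^ 2 = f z ^ (2 * s - 2) := fun z => by
    rw [← Real.rpow_natCast, ← Real.rpow_mul (hf z)]
    congr 1
    push_cast
    ring
  have hE : E1 ≤ 2 * (∑ z ∈ A, mu ω z * f z ^ 2 -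
      ∑ z ∈ A, ∑ w ∈ A, conductance ω z w * (f z * f w)) := by
    have e1 : ∀ y, ∑ z ∈ G.neighborFinset y, conductance ω y z * (f y - f z) ^ 2 =
        mu ω y * f y ^ 2 + ∑ z ∈ A, conductance ω y z * f z ^ 2 -
          2 * ∑ z ∈ A, conductance ω y z * (f y * f z) := by
      intro y
      rw [← sum_neighborFinset_eq (G := G) (y := y) (fun z hz => conductance_of_not_adj ω hz)
          (fun z hz => show f z ^ 2 = 0 by rw [hfA z hz]; simp),
        ← sum_neighborFinset_eq (G := G) (y := y) (fun z hz => conductance_of_not_adj ω hz)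
          (fun z hz => show f y * f z = 0 by rw [hfA z hz]; simp),
        mu, Finset.sum_mul, ← Finset.sum_add_distrib, Finset.mul_sum, ← Finset.sum_sub_distrib]
      exact Finset.sum_congr rfl fun z _ => by ring
    have e2 : ∑ y ∈ A, ∑ z ∈ A, conductance ω y z * f z ^ 2 ≤ ∑ z ∈ A, mu ω z * f z ^ 2 := by
      rw [Finset.sum_comm]
      refine Finset.sum_le_sum fun z _ => ?_
      rw [← Finset.sum_mul]
      refine mul_le_mul_of_nonneg_right ?_ (sq_nonneg _)
      simp_rw [conductance_symm ω _ z]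
      exact sum_le_sum_neighborFinset (conductance_nonneg ω z) fun _ h => conductance_of_not_adj ω h
    rw [hE1, Finset.sum_congr rfl fun y _ => e1 y, Finset.sum_sub_distrib, Finset.sum_add_distrib,
      ← Finset.mul_sum]
    linarith
  have hT' : T1 ≤ 4 * T := by
    have e1 : T1 ≤ ∑ y ∈ A, (2 * (nu ω y * f y ^ (2 * s - 2)) +
        2 * ∑ z ∈ A, 1 / conductance ω y z * f z ^ (2 * s - 2)) := by
      refine Finset.sum_le_sum fun y _ => ?_
      rw [← sum_neighborFinset_eq (G := G) (y := y)
          (fun z hz => by rw [conductance_of_not_adj ω hz, div_zero])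
          (fun z hz => show f z ^ (2 * s - 2) = 0 by
            rw [hfA z hz, Real.zero_rpow (by linarith)]),
        nu, Finset.sum_mul, Finset.mul_sum, Finset.mul_sum, ← Finset.sum_add_distrib]
      refine Finset.sum_le_sum fun z _ => ?_
      rw [← hsq, ← hsq]
      have h0 : 0 ≤ 1 / conductance ω y z := one_div_nonneg.mpr (conductance_nonneg ω y z)
      nlinarith [mul_nonneg h0 (sq_nonneg (f y ^ (s - 1) - f z ^ (s - 1)))]
    have e2 : ∑ y ∈ A, ∑ z ∈ A, 1 / conductance ω y z * f z ^ (2 * s - 2) ≤ T := by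
      rw [Finset.sum_comm]
      refine Finset.sum_le_sum fun z _ => ?_
      rw [← Finset.sum_mul]
      refine mul_le_mul_of_nonneg_right ?_ (Real.rpow_nonneg (hf z) _)
      simp_rw [conductance_symm ω _ z]
      exact sum_le_sum_neighborFinset (fun w => one_div_nonneg.mpr (conductance_nonneg ω z w))
        fun _ h => by rw [conductance_of_not_adj ω h, div_zero]
    rw [Finset.sum_add_distrib, ← Finset.mul_sum, ← Finset.mul_sum] at e1
    linarith
  have hE10 : 0 ≤ E1 := Finset.sum_nonneg fun y _ => Finset.sum_nonneg fun z _ =>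
    mul_nonneg (conductance_nonneg ω _ _) (sq_nonneg _)
  have hD0 : 0 ≤ ∑ y ∈ A, ∑ z ∈ G.neighborFinset y, |f y ^ s - f z ^ s| :=
    Finset.sum_nonneg fun y _ => Finset.sum_nonneg fun z _ => abs_nonneg _
  calc _ ≤ (s * D) ^ 2 := pow_le_pow_left₀ hD0 h1 2
    _ = s ^ 2 * D ^ 2 := by ring
    _ ≤ s ^ 2 * (E1 * T1) := mul_le_mul_of_nonneg_left h2 (sq_nonneg s)
    _ ≤ s ^ 2 * ((2 * (∑ z ∈ A, mu ω z * f z ^ 2 -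
      ∑ z ∈ A, ∑ w ∈ A, conductance ω z w * (f z * f w))) * (4 * T)) := by
        refine mul_le_mul_of_nonneg_left ?_ (sq_nonneg s)
        exact mul_le_mul hE hT' (Finset.sum_nonneg fun y _ => Finset.sum_nonneg fun z _ =>
          mul_nonneg (one_div_nonneg.mpr (conductance_nonneg ω _ _)) (sq_nonneg _)) (hE10.trans hE)
    _ = _ := by ring

end Sobolev

/-! ### The weighted Nash inequality -/

section SobolevNash

variable {V : Type*} {G : SimpleGraph V} [G.LocallyFinite]

/-- A Nash inequality for the weighted Dirichlet form, with speed measure `mu ω`, from an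
unweighted `ℓ¹` Sobolev inequality and moment bounds on the weights. -/
theorem nash_of_sobolev [Infinite V] (hG : G.Connected) (ω : Conductances G) {A : Finset V}
    {d' p q σ κ s K : ℝ}
    (hd' : 2 ≤ d') (hp : 1 < p) (hq : 1 < q) (hpq : 1 / p + 1 / q < 2 / d')
    (hσ : σ = 1 - 2 / d' + 1 / q) (hκ : κ = (1 - 1 / p) / σ) (hs : s = 2 * (d' - 1) / (d' * σ))
    (hSob : ∀ u : V → ℝ, (∀ y, y ∉ A → u y = 0) →
      (∑ y ∈ A, |u y| ^ (d' / (d' - 1))) ^ ((d' - 1) / d') ≤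
        K * ∑ y ∈ A, ∑ z ∈ G.neighborFinset y, |u y - u z|)
    {f : V → ℝ} (hf : ∀ z, 0 ≤ f z) (hfA : ∀ z, z ∉ A → f z = 0)
    (hf1 : ∑ z ∈ A, mu ω z * f z ≤ 1) :
    (∑ z ∈ A, mu ω z * f z ^ 2) ^ (1 + (1 - 1 / κ)) ≤
      8 * s ^ 2 * K ^ 2 * (∑ z ∈ A, nu ω z ^ q) ^ (1 / q) *
        ((∑ z ∈ A, mu ω z ^ p) ^ (1 / p)) ^ (1 / κ) *
        (∑ z ∈ A, mu ω z * f z ^ 2 - ∑ z ∈ A, ∑ w ∈ A, conductance ω z w * (f z * f w)) := by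
  have hw := isWeight_conductance hG ω
  have hq0 : 0 < 1 / q := by positivity
  have hp0 : 0 < 1 / p := by positivity
  have hq1 : 1 / q < 1 := by rw [div_lt_one (by linarith)]; exact hq
  have hp1 : 1 / p < 1 := by rw [div_lt_one (by linarith)]; exact hp
  have hd1 : 2 / d' ≤ 1 := by rw [div_le_one (by linarith)]; exact hd'
  have hσ0 : 0 < σ := by rw [hσ]; linarith
  have hσp : σ < 1 - 1 / p := by rw [hσ]; linarith
  have hκ1 : 1 < κ := by rw [hκ, one_lt_div hσ0]; exact hσp
  have hκσ : κ * σ = 1 - 1 / p := by rw [hκ]; field_simp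
  have hs1 : 1 < s := by
    rw [hs, one_lt_div (by positivity)]
    have : d' * σ = d' - 2 + d' * (1 / q) := by rw [hσ]; field_simp
    nlinarith
  -- The exponents are tuned so that the Sobolev norm of `f^s` and, after Hölder, both moment terms
  -- are powers of the single quantity `X = ∑ f^r`.
  set r : ℝ := 2 / σ with hr
  have hr0 : 0 < r := by positivity
  have hrs : s * (d' / (d' - 1)) = r := by
    have : d' - 1 ≠ 0 := by linarith
    rw [hs, hr]; field_simp
  have hrs2 : 2 * s - 2 = r * (1 - 1 / q) := by
    have h1 : r * σ = 2 := by rw [hr]; field_simp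
    have h2 : s = r * ((d' - 1) / d') := by rw [hs, hr]; field_simp
    have h3 : (d' - 1) / d' = 1 - 1 / d' := by field_simp
    have h4 : σ = 1 - 2 * (1 / d') + 1 / q := by rw [hσ]; ring
    rw [h4] at h1
    rw [h2, h3]
    linarith
  set X := ∑ z ∈ A, f z ^ r with hX
  set E := ∑ z ∈ A, mu ω z * f z ^ 2 - ∑ z ∈ A, ∑ w ∈ A, conductance ω z w * (f z * f w) with hE
  set N := (∑ z ∈ A, nu ω z ^ q) ^ (1 / q) with hN
  set P := (∑ z ∈ A, mu ω z ^ p) ^ (1 / p) with hP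
  have hmu0 := mu_nonneg ω
  have hP0 : 0 ≤ P := Real.rpow_nonneg (Finset.sum_nonneg fun z _ => Real.rpow_nonneg (hmu0 z) _) _
  have hN0 : 0 ≤ N :=
    Real.rpow_nonneg (Finset.sum_nonneg fun z _ => Real.rpow_nonneg (nu_nonneg ω z) _) _
  have hX0 : 0 ≤ X := Finset.sum_nonneg fun z _ => Real.rpow_nonneg (hf z) _
  rcases hX0.eq_or_lt with h0 | hXpos
  · have hf0 : ∀ z, f z = 0 := by
      intro z
      by_cases hz : z ∈ A
      · have := (Finset.sum_eq_zero_iff_of_nonneg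
          (fun z _ => Real.rpow_nonneg (hf z) r)).mp (h0.symm) z hz
        exact ((Real.rpow_eq_zero (hf z) hr0.ne').mp this)
      · exact hfA z hz
    have h1 : 1 + (1 - 1 / κ) ≠ 0 := by
      have : 1 / κ < 1 := by rw [div_lt_one (by linarith)]; exact hκ1
      linarith
    simp only [hE, hf0]
    simp only [ne_eq, OfNat.ofNat_ne_zero, not_false_eq_true, zero_pow, mul_zero,
      Finset.sum_const_zero, sub_self]
    rw [Real.zero_rpow h1]
  -- the Sobolev inequality for `f ^ s`
  have step1 : X ^ (2 * (d' - 1) / d') ≤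
      8 * s ^ 2 * K ^ 2 * E * ∑ z ∈ A, nu ω z * f z ^ (2 * s - 2) := by
    have h1 := hSob (fun z => f z ^ s) fun z hz => by
      rw [hfA z hz, Real.zero_rpow (by linarith)]
    have h2 : ∑ y ∈ A, |f y ^ s| ^ (d' / (d' - 1)) = X := by
      refine Finset.sum_congr rfl fun z _ => ?_
      rw [abs_of_nonneg (Real.rpow_nonneg (hf z) _), ← Real.rpow_mul (hf z), hrs]
    beta_reduce at h1
    rw [h2] at h1
    have h3 : X ^ (2 * (d' - 1) / d') = (X ^ ((d' - 1) / d')) ^ 2 := by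
      rw [← Real.rpow_natCast, ← Real.rpow_mul hX0]
      congr 1
      push_cast
      ring
    rw [h3]
    calc _ ≤ (K * ∑ y ∈ A, ∑ z ∈ G.neighborFinset y, |f y ^ s - f z ^ s|) ^ 2 :=
          pow_le_pow_left₀ (Real.rpow_nonneg hX0 _) h1 2
      _ = K ^ 2 * (∑ y ∈ A, ∑ z ∈ G.neighborFinset y, |f y ^ s - f z ^ s|) ^ 2 := mul_pow _ _ 2
      _ ≤ K ^ 2 * (8 * s ^ 2 * E * ∑ z ∈ A, nu ω z * f z ^ (2 * s - 2)) :=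
          mul_le_mul_of_nonneg_left (sq_sum_abs_rpow_sub_le ω hf hfA hs1) (sq_nonneg K)
      _ = _ := by ring
  have hE0 : 0 ≤ E := sub_nonneg.mpr (hw.sum_mul_mul_le f)
  have hqc : q.HolderConjugate (1 / (1 - 1 / q)) := by
    rw [Real.holderConjugate_iff]
    refine ⟨hq, ?_⟩
    rw [one_div (1 - 1 / q), inv_inv]
    ring
  have hpc : p.HolderConjugate (1 / (1 - 1 / p)) := by
    rw [Real.holderConjugate_iff]
    refine ⟨hp, ?_⟩
    rw [one_div (1 - 1 / p), inv_inv]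
    ring
  have step2 : ∑ z ∈ A, nu ω z * f z ^ (2 * s - 2) ≤ N * X ^ (1 - 1 / q) := by
    have h1 := Real.inner_le_Lp_mul_Lq_of_nonneg A hqc (f := nu ω) (g := fun z => f z ^ (2 * s - 2))
      (fun z _ => nu_nonneg ω z) (fun z _ => Real.rpow_nonneg (hf z) _)
    refine h1.trans (le_of_eq ?_)
    rw [one_div_one_div]
    congr 2
    refine Finset.sum_congr rfl fun z _ => ?_
    rw [← Real.rpow_mul (hf z), hrs2]
    congr 1
    have : 1 - 1 / q ≠ 0 := by linarith
    rw [mul_assoc, mul_one_div_cancel this, mul_one]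
  -- The Sobolev exponent splits as `σ + (1 - 1/q)`, and the factor `X^(1 - 1/q)` produced by Hölder
  -- cancels since `X > 0`.
  have step3 : X ^ σ ≤ 8 * s ^ 2 * K ^ 2 * N * E := by
    have h1 : X ^ (2 * (d' - 1) / d') = X ^ σ * X ^ (1 - 1 / q) := by
      rw [← Real.rpow_add hXpos]
      congr 1
      rw [hσ]
      field_simp
      ring
    have h2 : X ^ σ * X ^ (1 - 1 / q) ≤ (8 * s ^ 2 * K ^ 2 * N * E) * X ^ (1 - 1 / q) := by
      rw [← h1]
      calc _ ≤ 8 * s ^ 2 * K ^ 2 * E * ∑ z ∈ A, nu ω z * f z ^ (2 * s - 2) := step1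
        _ ≤ 8 * s ^ 2 * K ^ 2 * E * (N * X ^ (1 - 1 / q)) :=
            mul_le_mul_of_nonneg_left step2 (by positivity)
        _ = _ := by ring
    exact le_of_mul_le_mul_right h2 (Real.rpow_pos_of_pos hXpos _)
  set Q := ∑ z ∈ A, mu ω z * f z ^ (2 * κ) with hQ
  have hQ0 : 0 ≤ Q := Finset.sum_nonneg fun z _ => mul_nonneg (hmu0 z) (Real.rpow_nonneg (hf z) _)
  have step4 : Q ≤ P * X ^ (1 - 1 / p) := by
    have h1 := Real.inner_le_Lp_mul_Lq_of_nonneg A hpc (f := mu ω) (g := fun z => f z ^ (2 * κ))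
      (fun z _ => hmu0 z) (fun z _ => Real.rpow_nonneg (hf z) _)
    refine h1.trans (le_of_eq ?_)
    rw [one_div_one_div]
    congr 2
    refine Finset.sum_congr rfl fun z _ => ?_
    rw [← Real.rpow_mul (hf z), ← hκσ, hr]
    congr 1
    have : κ ≠ 0 := by linarith
    field_simp
  have step5 : Q ^ (1 / κ) ≤ P ^ (1 / κ) * X ^ σ := by
    calc Q ^ (1 / κ) ≤ (P * X ^ (1 - 1 / p)) ^ (1 / κ) :=
          Real.rpow_le_rpow hQ0 step4 (by positivity)
      _ = P ^ (1 / κ) * X ^ σ := by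
          rw [Real.mul_rpow hP0 (Real.rpow_nonneg hX0 _), ← Real.rpow_mul hX0, ← hκσ]
          congr 2
          have : κ ≠ 0 := by linarith
          field_simp
  -- Interpolation of the weighted `ℓ²` norm between `ℓ¹`, bounded by `1`, and `ℓ^(2κ)`: the weight
  -- solves `(1 - τ) + 2κτ = 2`, and then `τ (2 - 1/κ) = 1/κ`.
  obtain ⟨τ, hτ⟩ : ∃ τ : ℝ, τ = 1 / (2 * κ - 1) := ⟨_, rfl⟩
  have hk0 : 0 < 2 * κ - 1 := by linarith
  have hτ1 : τ < 1 := by rw [hτ, div_lt_one hk0]; linarith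
  have hτ0 : 0 < τ := by rw [hτ]; positivity
  have hτc : (1 / (1 - τ)).HolderConjugate (1 / τ) := by
    rw [Real.holderConjugate_iff]
    refine ⟨by rw [one_lt_div (by linarith)]; linarith, ?_⟩
    rw [one_div, inv_inv, one_div, inv_inv]
    ring
  have hκτ : 1 * (1 - τ) + 2 * κ * τ = 2 := by rw [hτ]; field_simp; ring
  have step6 : ∑ z ∈ A, mu ω z * f z ^ 2 ≤ Q ^ τ := by
    have h1 := Real.inner_le_Lp_mul_Lq_of_nonneg A hτc
      (f := fun z => (mu ω z * f z) ^ (1 - τ)) (g := fun z => (mu ω z * f z ^ (2 * κ)) ^ τ)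
      (fun z _ => Real.rpow_nonneg (mul_nonneg (hmu0 z) (hf z)) _)
      (fun z _ => Real.rpow_nonneg (mul_nonneg (hmu0 z) (Real.rpow_nonneg (hf z) _)) _)
    rw [one_div_one_div, one_div_one_div] at h1
    have h2 : ∀ z ∈ A, (mu ω z * f z) ^ (1 - τ) * (mu ω z * f z ^ (2 * κ)) ^ τ =
        mu ω z * f z ^ 2 := by
      intro z _
      have hz := hw.pos z
      rw [Real.mul_rpow hz.le (hf z), Real.mul_rpow hz.le (Real.rpow_nonneg (hf z) _),
        ← Real.rpow_mul (hf z)]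
      have h3 : mu ω z ^ (1 - τ) * mu ω z ^ τ = mu ω z := by
        rw [← Real.rpow_add hz]; simp
      have h4 : f z ^ (1 - τ) * f z ^ (2 * κ * τ) = f z ^ 2 := by
        rw [← Real.rpow_add_of_nonneg (hf z) (by linarith) (by positivity), ← Real.rpow_natCast]
        congr 1
        push_cast
        linarith
      calc _ = (mu ω z ^ (1 - τ) * mu ω z ^ τ) * (f z ^ (1 - τ) * f z ^ (2 * κ * τ)) := by ring
        _ = _ := by rw [h3, h4]
    have h5 : ∀ z ∈ A, ((mu ω z * f z) ^ (1 - τ)) ^ (1 / (1 - τ)) = mu ω z * f z := by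
      intro z _
      rw [← Real.rpow_mul (mul_nonneg (hmu0 z) (hf z)), mul_one_div_cancel (by linarith),
        Real.rpow_one]
    have h6 : ∀ z ∈ A, ((mu ω z * f z ^ (2 * κ)) ^ τ) ^ (1 / τ) = mu ω z * f z ^ (2 * κ) := by
      intro z _
      rw [← Real.rpow_mul (mul_nonneg (hmu0 z) (Real.rpow_nonneg (hf z) _)),
        mul_one_div_cancel hτ0.ne', Real.rpow_one]
    rw [Finset.sum_congr rfl h2, Finset.sum_congr rfl h5, Finset.sum_congr rfl h6] at h1
    refine h1.trans ?_
    refine mul_le_of_le_one_left (Real.rpow_nonneg hQ0 _) ?_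
    exact Real.rpow_le_one (Finset.sum_nonneg fun z _ => mul_nonneg (hmu0 z) (hf z)) hf1
      (by linarith)
  have hF0 : 0 ≤ ∑ z ∈ A, mu ω z * f z ^ 2 :=
    Finset.sum_nonneg fun z _ => mul_nonneg (hmu0 z) (sq_nonneg _)
  have hexp : 0 ≤ 1 + (1 - 1 / κ) := by
    have : 1 / κ < 1 := by rw [div_lt_one (by linarith)]; exact hκ1
    linarith
  calc (∑ z ∈ A, mu ω z * f z ^ 2) ^ (1 + (1 - 1 / κ)) ≤ (Q ^ τ) ^ (1 + (1 - 1 / κ)) :=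
        Real.rpow_le_rpow hF0 step6 hexp
    _ = Q ^ (1 / κ) := by
        rw [← Real.rpow_mul hQ0]
        congr 1
        rw [hτ]
        field_simp
        ring
    _ ≤ P ^ (1 / κ) * X ^ σ := step5
    _ ≤ P ^ (1 / κ) * (8 * s ^ 2 * K ^ 2 * N * E) :=
        mul_le_mul_of_nonneg_left step3 (Real.rpow_nonneg hP0 _)
    _ = _ := by ring

end SobolevNash

/-! ### Reduction to finite real exponents -/

section Exponents

/-- The strict inequality leaves a gap `δ`, so an infinite exponent can be traded for a large finite
one whose reciprocal is below `δ/2`; finite exponents are kept. -/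
theorem exists_real_exponents {p q : ℝ≥0∞} {a : ℝ} (hp : 1 < p) (hq : 1 < q)
    (hpq : p⁻¹ + q⁻¹ < ENNReal.ofReal a) :
    ∃ P Q : ℝ, 1 < P ∧ 1 < Q ∧ 1 / P + 1 / Q < a ∧ (p = ∞ ∨ p = ENNReal.ofReal P) ∧
      (q = ∞ ∨ q = ENNReal.ofReal Q) := by
  have ha : 0 < a := by
    by_contra h
    rw [ENNReal.ofReal_of_nonpos (not_lt.mp h)] at hpq
    exact not_lt_zero hpq
  have hpi : p⁻¹ ≠ ∞ := ENNReal.inv_ne_top.mpr (zero_lt_one.trans hp).ne'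
  have hqi : q⁻¹ ≠ ∞ := ENNReal.inv_ne_top.mpr (zero_lt_one.trans hq).ne'
  have h1 : (p⁻¹).toReal + (q⁻¹).toReal < a := by
    rw [← ENNReal.toReal_add hpi hqi]
    exact (ENNReal.lt_ofReal_iff_toReal_lt (ENNReal.add_ne_top.mpr ⟨hpi, hqi⟩)).mp hpq
  set δ := a - ((p⁻¹).toReal + (q⁻¹).toReal) with hδ
  have hδ0 : 0 < δ := by linarith
  have key : ∀ r : ℝ≥0∞, 1 < r → ∃ R : ℝ, 1 < R ∧ 1 / R < (r⁻¹).toReal + δ / 2 ∧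
      (r = ∞ ∨ r = ENNReal.ofReal R) := by
    intro r hr
    by_cases h : r = ∞
    · refine ⟨max 2 (4 / δ), lt_max_of_lt_left one_lt_two, ?_, Or.inl h⟩
      have h2 : 1 / max 2 (4 / δ) ≤ 1 / (4 / δ) :=
        one_div_le_one_div_of_le (by positivity) (le_max_right _ _)
      rw [one_div_div] at h2
      rw [h]
      simp only [ENNReal.inv_top, ENNReal.toReal_zero]
      linarith
    · refine ⟨r.toReal, ?_, ?_, Or.inr (ENNReal.ofReal_toReal h).symm⟩
      · have := (ENNReal.toReal_lt_toReal ENNReal.one_ne_top h).mpr hr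
        simpa using this
      · rw [ENNReal.toReal_inv, one_div]
        linarith
  obtain ⟨P, hP1, hP2, hP3⟩ := key p hp
  obtain ⟨Q, hQ1, hQ2, hQ3⟩ := key q hq
  exact ⟨P, Q, hP1, hQ1, by linarith, hP3, hQ3⟩

/-- Undoes the normalisation by the cardinality. When `p = ∞` the maximum controls the power mean of
every finite order `P`. -/
theorem rpow_sum_le_of_avgNorm_le {V : Type*} {A : Finset V} (hA : A.Nonempty) {p : ℝ≥0∞} {P M : ℝ}
    (hP : 1 < P) (hpP : p = ∞ ∨ p = ENNReal.ofReal P) {f : V → ℝ} (hf : ∀ x, 0 ≤ f x)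
    (hM : avgNorm p A f ≤ M) : (∑ x ∈ A, f x ^ P) ^ (1 / P) ≤ M * (A.card : ℝ) ^ (1 / P) := by
  have hcard : (0 : ℝ) < A.card := by exact_mod_cast hA.card_pos
  have hP0 : 0 < P := by linarith
  have hsum0 : 0 ≤ ∑ x ∈ A, f x ^ P := Finset.sum_nonneg fun x _ => Real.rpow_nonneg (hf x) _
  rcases hpP with h | h
  · rw [avgNorm, if_pos h] at hM
    have h1 : ∀ x ∈ A, f x ≤ M := fun x hx => by
      refine le_trans ?_ hM
      have h2 := le_ciSup (f := fun x : A => |f x|) (Set.finite_range _).bddAbove ⟨x, hx⟩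
      exact (le_abs_self _).trans h2
    obtain ⟨x0, hx0⟩ := hA
    have hM0 : 0 ≤ M := (hf x0).trans (h1 x0 hx0)
    have h3 : ∑ x ∈ A, f x ^ P ≤ M ^ P * A.card := by
      rw [mul_comm, ← nsmul_eq_mul]
      exact Finset.sum_le_card_nsmul _ _ _ fun x hx => Real.rpow_le_rpow (hf x) (h1 x hx) hP0.le
    calc _ ≤ (M ^ P * A.card) ^ (1 / P) := Real.rpow_le_rpow hsum0 h3 (by positivity)
      _ = _ := by
        rw [Real.mul_rpow (Real.rpow_nonneg hM0 _) hcard.le, ← Real.rpow_mul hM0,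
          mul_one_div_cancel hP0.ne', Real.rpow_one]
  · have hpt : p ≠ ∞ := by rw [h]; exact ENNReal.ofReal_ne_top
    rw [avgNorm, if_neg hpt, h, ENNReal.toReal_ofReal hP0.le] at hM
    simp_rw [abs_of_nonneg (hf _)] at hM
    rw [Real.mul_rpow (by positivity) hsum0, Real.inv_rpow hcard.le] at hM
    rw [inv_mul_le_iff₀ (Real.rpow_pos_of_pos hcard _)] at hM
    linarith

end Exponents

/-! ### On-diagonal bounds in balls around `x` -/

section OnDiagonal

/-- Scale-invariant on-diagonal bound, with polynomial loss `(R ^ 2 / t) ^ γ`, for the heat kernel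
killed outside `B(x, R)`, and a polynomial lower bound for the speed measure. -/
structure OnDiagonalBound {V : Type u} {G : SimpleGraph V} [G.LocallyFinite] (ω : Conductances G)
    (x : V) (R : ℕ) (d γ g C₁ C₂ : ℝ) : Prop where
  sq_le : ∀ y ∈ ball G x R, ∀ t : ℝ, 0 < t →
    ∑ z ∈ ball G x R, mu ω z *
      killedKernel (conductance ω) (mu ω) (ball G x R) y t z ^ 2 ≤
      C₁ * (R : ℝ) ^ (-d) * ((R : ℝ) ^ 2 / t) ^ γ
  inv_mu_le : ∀ y ∈ ball G x R, (mu ω y)⁻¹ ≤ C₂ * (R : ℝ) ^ g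

/-- The bound `2 * M` already holds; the added `1` keeps later constants positive when `M = 0`. -/
theorem avgNorm_le_of_avgControlled {V : Type u} {G : SimpleGraph V} [G.LocallyFinite] {p : ℝ≥0∞}
    {f : V → ℝ} {N : V → ℝ} {M : ℝ≥0} (h : AvgControlled G p f N)
    (hM : (⨆ x, limsupAvg G p f x) ≤ M) {x : V} {n : ℕ} (hn : N x ≤ n) :
    avgNorm p (ball G x n) f ≤ 2 * M + 1 := by
  have h1 : ENNReal.ofReal (avgNorm p (ball G x n) f) ≤ ENNReal.ofReal (2 * M) := by
    refine (h x n hn).trans ?_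
    rw [ENNReal.ofReal_mul (by norm_num), ENNReal.ofReal_coe_nnreal]
    simp only [ENNReal.ofReal_ofNat]
    gcongr
    exact (le_iSup (limsupAvg G p f) x).trans hM
  have h2 := (ENNReal.ofReal_le_ofReal_iff (by positivity)).mp h1
  linarith

theorem self_mem_ball {V : Type u} (G : SimpleGraph V) [G.LocallyFinite] (hG : G.Connected) (x : V)
    (n : ℕ) : x ∈ ball G x n := by
  rw [mem_ball G hG]
  simp

/-- The weighted Nash inequality on a ball, with its dependence on the radius `R`. -/
theorem nash_of_sobolev_scaled {V : Type u} [Infinite V] {G : SimpleGraph V} [G.LocallyFinite]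
    (hG : G.Connected) (ω : Conductances G) {A : Finset V} {d d' p q σ κ s CS a b R : ℝ}
    (hd' : 2 ≤ d') (hp : 1 < p) (hq : 1 < q) (hpq : 1 / p + 1 / q < 2 / d')
    (hσ : σ = 1 - 2 / d' + 1 / q) (hκ : κ = (1 - 1 / p) / σ) (hs : s = 2 * (d' - 1) / (d' * σ))
    (hκσ : σ = (1 - 1 / p) / κ) (hκ0 : 0 < κ) (hR0 : 0 < R) (hb0 : 0 < b) (ha0 : 0 < a)
    (hSob : ∀ u : V → ℝ, (∀ y, y ∉ A → u y = 0) →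
      (∑ y ∈ A, |u y| ^ (d' / (d' - 1))) ^ ((d' - 1) / d') ≤
        CS * R ^ (1 - d / d') * ∑ y ∈ A, ∑ z ∈ G.neighborFinset y, |u y - u z|)
    (hP : (∑ z ∈ A, mu ω z ^ p) ^ (1 / p) ≤ b * R ^ (d * (1 / p)))
    (hN : (∑ z ∈ A, nu ω z ^ q) ^ (1 / q) ≤ a * R ^ (d * (1 / q)))
    {f : V → ℝ} (hf : ∀ z, 0 ≤ f z) (hfA : ∀ z, z ∉ A → f z = 0)
    (hf1 : ∑ z ∈ A, mu ω z * f z ≤ 1) :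
    (∑ z ∈ A, mu ω z * f z ^ 2) ^ (1 + (1 - 1 / κ)) ≤
      8 * s ^ 2 * CS ^ 2 * a * b ^ (1 / κ) * R ^ (2 - d * (1 - 1 / κ)) *
        (∑ z ∈ A, mu ω z * f z ^ 2 - ∑ z ∈ A, ∑ w ∈ A, conductance ω z w * (f z * f w)) := by
  have hw := isWeight_conductance hG ω
  have h1 := nash_of_sobolev hG ω hd' hp hq hpq hσ hκ hs hSob hf hfA hf1
  refine h1.trans (mul_le_mul_of_nonneg_right ?_ (sub_nonneg.mpr (hw.sum_mul_mul_le f)))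
  have hSum0 : 0 ≤ ∑ z ∈ A, mu ω z ^ p :=
    Finset.sum_nonneg fun z _ => Real.rpow_nonneg (mu_nonneg ω z) _
  have h2 : ((∑ z ∈ A, mu ω z ^ p) ^ (1 / p)) ^ (1 / κ) ≤
      b ^ (1 / κ) * R ^ (d * (1 / p) * (1 / κ)) := by
    rw [Real.rpow_mul hR0.le, ← Real.mul_rpow hb0.le (Real.rpow_nonneg hR0.le _)]
    exact Real.rpow_le_rpow (Real.rpow_nonneg hSum0 _) hP (by positivity)
  have h3 : (CS * R ^ (1 - d / d')) ^ 2 = CS ^ 2 * R ^ (2 * (1 - d / d')) := by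
    rw [mul_pow, ← Real.rpow_natCast (R ^ (1 - d / d')), ← Real.rpow_mul hR0.le]
    congr 2
    push_cast
    ring
  -- The defining relation `1 - 2/d' + 1/q = (1 - 1/p)/κ` makes `d'` cancel from the power of `R`.
  have h4 : R ^ (2 * (1 - d / d')) * R ^ (d * (1 / q)) * R ^ (d * (1 / p) * (1 / κ)) =
      R ^ (2 - d * (1 - 1 / κ)) := by
    rw [← Real.rpow_add hR0, ← Real.rpow_add hR0]
    congr 1
    have h5 : 1 - 2 / d' + 1 / q = (1 - 1 / p) * (1 / κ) := by
      rw [← hσ, hκσ]; ring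
    have h6 : 1 / q = (1 - 1 / p) * (1 / κ) - 1 + 2 / d' := by linarith
    rw [h6]
    ring
  rw [h3, ← h4]
  calc _ ≤ 8 * s ^ 2 * (CS ^ 2 * R ^ (2 * (1 - d / d'))) * (a * R ^ (d * (1 / q))) *
        (b ^ (1 / κ) * R ^ (d * (1 / p) * (1 / κ))) := by
        refine mul_le_mul (mul_le_mul_of_nonneg_left hN (by positivity)) h2
          (Real.rpow_nonneg (Real.rpow_nonneg hSum0 _) _) (by positivity)
    _ = _ := by ring

theorem exists_onDiagonalBound {d d' Creg CS : ℝ} (hd : 2 ≤ d) (hd' : d ≤ d') (hCreg : 0 < Creg)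
    (hCS : 0 < CS) {p q : ℝ≥0∞} (hp : 1 < p) (hq : 1 < q)
    (hpq : p⁻¹ + q⁻¹ < ENNReal.ofReal (2 / d')) (Mμ Mν : ℝ≥0) :
    ∃ γ g C₁ C₂ : ℝ, 0 < γ ∧ 0 < g ∧ 0 < C₁ ∧ 0 < C₂ ∧
      ∀ (V : Type u) [Infinite V] (G : SimpleGraph V) [G.LocallyFinite], G.Connected →
      ∀ N₁ N₂ : V → ℝ, VolumeRegular G d Creg N₁ → LocalSobolev G d d' CS N₂ →
      ∀ ω : Conductances G,
        (⨆ x, limsupAvg G p (mu ω) x) ≤ Mμ → (⨆ x, limsupAvg G q (nu ω) x) ≤ Mν →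
      ∀ N : V → ℝ, AvgControlled G p (mu ω) N → AvgControlled G q (nu ω) N →
      ∀ (x : V) (R : ℕ), 1 ≤ R → N x ≤ R → N₁ x ≤ R → N₂ x ≤ R →
        OnDiagonalBound ω x R d γ g C₁ C₂ := by
  obtain ⟨P, Q, hP, hQ, hPQ, hpP, hqQ⟩ := exists_real_exponents hp hq hpq
  set σ : ℝ := 1 - 2 / d' + 1 / Q with hσ
  set κ : ℝ := (1 - 1 / P) / σ with hκ
  set s : ℝ := 2 * (d' - 1) / (d' * σ) with hs
  set β : ℝ := 1 - 1 / κ with hβ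
  set a : ℝ := (2 * Mν + 1) * Creg ^ (1 / Q) with ha
  set b : ℝ := (2 * Mμ + 1) * Creg ^ (1 / P) with hb
  set S₀ : ℝ := 8 * s ^ 2 * CS ^ 2 * a * b ^ (1 / κ) with hS₀
  have hQ0 : 0 < 1 / Q := by positivity
  have hP0 : 0 < 1 / P := by positivity
  have hP1 : 1 / P < 1 := by rw [div_lt_one (by linarith)]; exact hP
  have hd1 : 2 / d' ≤ 1 := by rw [div_le_one (by linarith)]; linarith
  have hσ0 : 0 < σ := by rw [hσ]; linarith
  have hσp : σ < 1 - 1 / P := by rw [hσ]; linarith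
  have hκ1 : 1 < κ := by rw [hκ, one_lt_div hσ0]; exact hσp
  have hκσ : σ = (1 - 1 / P) / κ := by
    have : 1 - 1 / P ≠ 0 := by linarith
    rw [hκ, div_div_cancel₀ this]
  have hβ0 : 0 < β := by
    have : 1 / κ < 1 := by rw [div_lt_one (by linarith)]; exact hκ1
    linarith
  have hs0 : 0 < s := div_pos (by linarith) (mul_pos (by linarith) hσ0)
  have ha0 : 0 < a := by positivity
  have hb0 : 0 < b := by positivity
  have hS0 : 0 < S₀ := by positivity
  -- Nash's argument gives `γ = 1/β` and `C₁`; the pair `g`, `C₂` is read off from the `ℓ^Q` norm of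
  -- `ν` on the ball, a single term of which dominates `1/μ(y)`.
  refine ⟨1 / β, d * (1 / Q), (S₀ / (2 * β)) ^ (1 / β), a, by positivity,
    mul_pos (by linarith) hQ0, by positivity, ha0, ?_⟩
  intro V _ G _ hG N₁ N₂ hvol hsob ω hμ hν N hNμ hNν x R hR hNR hN₁R hN₂R
  have hR0 : (0 : ℝ) < R := by exact_mod_cast hR
  have hw := isWeight_conductance hG ω
  set A := ball G x R with hA
  have hAne : A.Nonempty := ⟨x, self_mem_ball G hG x R⟩
  have hcard : (A.card : ℝ) ≤ Creg * (R : ℝ) ^ d := (hvol x R hN₁R).2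
  have hnorm : ∀ {r : ℝ} {M : ℝ}, 0 < M → 1 < r → M * (A.card : ℝ) ^ (1 / r) ≤
      M * Creg ^ (1 / r) * (R : ℝ) ^ (d * (1 / r)) := by
    intro r M hM hr
    have hr0 : 0 ≤ 1 / r := by positivity
    rw [mul_assoc]
    refine mul_le_mul_of_nonneg_left ?_ hM.le
    rw [Real.rpow_mul hR0.le, ← Real.mul_rpow hCreg.le (Real.rpow_nonneg hR0.le _)]
    exact Real.rpow_le_rpow (Nat.cast_nonneg _) hcard hr0
  have hPle : (∑ z ∈ A, mu ω z ^ P) ^ (1 / P) ≤ b * (R : ℝ) ^ (d * (1 / P)) :=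
    (rpow_sum_le_of_avgNorm_le hAne hP hpP (mu_nonneg ω)
      (avgNorm_le_of_avgControlled hNμ hμ hNR)).trans (hnorm (by positivity) hP)
  have hNle : (∑ z ∈ A, nu ω z ^ Q) ^ (1 / Q) ≤ a * (R : ℝ) ^ (d * (1 / Q)) :=
    (rpow_sum_le_of_avgNorm_le hAne hQ hqQ (nu_nonneg ω)
      (avgNorm_le_of_avgControlled hNν hν hNR)).trans (hnorm (by positivity) hQ)
  refine ⟨fun y hy t ht => ?_, fun y hy => ?_⟩
  · have hnash : ∀ f : V → ℝ, (∀ z, 0 ≤ f z) → (∀ z, z ∉ A → f z = 0) →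
        ∑ z ∈ A, mu ω z * f z ≤ 1 → (∑ z ∈ A, mu ω z * f z ^ 2) ^ (1 + β) ≤
          (S₀ * (R : ℝ) ^ (2 - d * β)) * (∑ z ∈ A, mu ω z * f z ^ 2 -
            ∑ z ∈ A, ∑ w ∈ A, conductance ω z w * (f z * f w)) := fun f hf hfA hf1 =>
      nash_of_sobolev_scaled hG ω (hd.trans hd') hP hQ hPQ hσ hκ hs hκσ (zero_lt_one.trans hκ1) hR0
        hb0 ha0 (fun u hu => (hsob x R hN₂R u hu).trans (mul_le_mul_of_nonneg_left
          (sum_edgesMeetingBall_le u x R) (by positivity))) hPle hNle hf hfA hf1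
    have h7 := sum_mul_killedKernel_sq_le_of_nash hw hy hβ0 (by positivity) hnash ht
    refine h7.trans (le_of_eq ?_)
    have h8 : S₀ * (R : ℝ) ^ (2 - d * β) / (2 * β * t) =
        S₀ / (2 * β) * ((R : ℝ) ^ (-d * β) * ((R : ℝ) ^ 2 / t)) := by
      have : (R : ℝ) ^ (2 - d * β) = (R : ℝ) ^ (-d * β) * (R : ℝ) ^ 2 := by
        rw [← Real.rpow_natCast (R : ℝ) 2, ← Real.rpow_add hR0]
        congr 1
        push_cast
        ring
      rw [this]
      field_simp
    rw [h8, Real.mul_rpow (by positivity) (by positivity),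
      Real.mul_rpow (by positivity) (by positivity), ← Real.rpow_mul hR0.le]
    have h9 : -d * β * (1 / β) = -d := by
      rw [mul_assoc, mul_one_div_cancel hβ0.ne', mul_one]
    rw [h9, mul_assoc]
  · refine (one_div_mu_le_nu hG ω y).trans (le_trans ?_ hNle)
    have h1 : nu ω y ^ Q ≤ ∑ z ∈ A, nu ω z ^ Q :=
      Finset.single_le_sum (f := fun z => nu ω z ^ Q)
        (fun z _ => Real.rpow_nonneg (nu_nonneg ω z) _) hy
    calc nu ω y = (nu ω y ^ Q) ^ (1 / Q) := by
          rw [← Real.rpow_mul (nu_nonneg ω y), mul_one_div_cancel (by linarith), Real.rpow_one]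
      _ ≤ _ := Real.rpow_le_rpow (Real.rpow_nonneg (nu_nonneg ω y) _) h1 hQ0.le

end OnDiagonal

/-! ### Gaussian decay of the mass far from the start -/

section FarMass

variable {V : Type*} {c : V → V → ℝ} {m : V → ℝ} {A : Finset V} {y : V} {ρ : V → ℝ}

open Classical in
/-- The `ℓ²` mass of the killed kernel from `y` at time `t` on `{ρ ≥ r}`. -/
def farMass (c : V → V → ℝ) (m : V → ℝ) (A : Finset V) (y : V) (ρ : V → ℝ) (r t : ℝ) : ℝ :=
  ∑ z ∈ A with r ≤ ρ z, m z * killedKernel c m A y t z ^ 2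

theorem farMass_le (h : IsWeight c m) (r t : ℝ) :
    farMass c m A y ρ r t ≤ ∑ z ∈ A, m z * killedKernel c m A y t z ^ 2 :=
  Finset.sum_le_sum_of_subset_of_nonneg (Finset.filter_subset _ _)
    fun z _ _ => mul_nonneg (h.pos z).le (sq_nonneg _)

theorem sum_weighted_sq_le (h : IsWeight c m) (hy : y ∈ A) (hρ : ∀ z w, c z w ≠ 0 → |ρ z - ρ w| ≤ 1)
    (hρy : ρ y = 0) {lam t : ℝ} (hlam : 0 ≤ lam) (ht : 0 ≤ t) :
    ∑ z ∈ A, m z * (Real.exp (lam * ρ z) * killedKernel c m A y t z) ^ 2 ≤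
      Real.exp (2 * (Real.cosh lam - 1) * t) * (m y)⁻¹ := by
  classical
  have h1 := (isHeatSolution_killedKernel h hy).weighted_sq_le h
    (fun t ht z => killedKernel_nonneg h ht z) (ψ := fun z => lam * ρ z) (lam := lam)
    (fun z w hc => by
      rw [← mul_sub, abs_mul, abs_of_nonneg hlam]
      exact mul_le_of_le_one_right hlam (hρ z w hc)) le_rfl ht
  rw [sub_zero] at h1
  refine h1.trans (le_of_eq ?_)
  congr 1
  rw [Finset.sum_eq_single_of_mem y hy]
  · rw [hρy, killedKernel_zero, if_pos rfl]
    have := (h.pos y).ne'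
    simp only [mul_zero, Real.exp_zero, one_mul]
    field_simp
  · intro z _ hz
    rw [killedKernel_zero, if_neg hz]
    simp

/-- On `{ρ ≥ r}` the squared weight `exp(2 lam ρ)` is at least `exp(2 lam r)`, while at time `0` it
is `1` at the starting point. The price is the density `(m y)⁻¹`. -/
theorem farMass_le_exp (h : IsWeight c m) (hy : y ∈ A) (hρ : ∀ z w, c z w ≠ 0 → |ρ z - ρ w| ≤ 1)
    (hρy : ρ y = 0) {lam r t : ℝ} (hlam : 0 ≤ lam) (ht : 0 ≤ t) :
    farMass c m A y ρ r t ≤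
      Real.exp (2 * (Real.cosh lam - 1) * t - 2 * lam * r) * (m y)⁻¹ := by
  classical
  have h1 := sum_weighted_sq_le h hy hρ hρy hlam ht
  have h2 : Real.exp (2 * lam * r) * farMass c m A y ρ r t ≤
      ∑ z ∈ A, m z * (Real.exp (lam * ρ z) * killedKernel c m A y t z) ^ 2 := by
    rw [farMass, Finset.mul_sum]
    refine (Finset.sum_le_sum fun z hz => ?_).trans
      (Finset.sum_le_sum_of_subset_of_nonneg (Finset.filter_subset (fun z => r ≤ ρ z) A)
        fun z _ _ => mul_nonneg (h.pos z).le (sq_nonneg _))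
    rw [Finset.mem_filter] at hz
    rw [mul_pow, ← Real.exp_nat_mul, mul_left_comm]
    refine mul_le_mul_of_nonneg_left (mul_le_mul_of_nonneg_right ?_ (sq_nonneg _)) (h.pos z).le
    refine Real.exp_le_exp.mpr ?_
    push_cast
    nlinarith [mul_le_mul_of_nonneg_left hz.2 hlam]
  rw [Real.exp_sub, div_mul_eq_mul_div, le_div_iff₀ (Real.exp_pos _), mul_comm]
  exact h2.trans h1

/-- The weight `exp(lam min(ρ - r, 0))` equals `1` on `{ρ ≥ r}` and is at most `exp(-lam (r - r'))`
on `{ρ < r'}`. Mass beyond `r` at time `t` thus comes from mass beyond `r'` at the earlier time `s`,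
up to an exponentially small part of the total, and no starting density enters. -/
theorem farMass_le_step (h : IsWeight c m) (hy : y ∈ A) (hρ : ∀ z w, c z w ≠ 0 → |ρ z - ρ w| ≤ 1)
    {lam r r' s t : ℝ} (hlam : 0 ≤ lam) (hs : 0 ≤ s) (hst : s ≤ t) :
    farMass c m A y ρ r t ≤ Real.exp (2 * (Real.cosh lam - 1) * (t - s)) *
      (farMass c m A y ρ r' s + Real.exp (-(2 * lam * (r - r'))) *
        ∑ z ∈ A, m z * killedKernel c m A y s z ^ 2) := by
  classical
  set ψ : V → ℝ := fun z => lam * min (ρ z - r) 0 with hψ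
  have h1 := (isHeatSolution_killedKernel h hy).weighted_sq_le h
    (fun t ht z => killedKernel_nonneg h ht z) (ψ := ψ) (lam := lam)
    (fun z w hc => by
      rw [hψ, ← mul_sub, abs_mul, abs_of_nonneg hlam]
      refine mul_le_of_le_one_right hlam ((abs_min_sub_min_le_max _ _ _ _).trans ?_)
      have := hρ z w hc
      simpa using this) hs hst
  have h2 : farMass c m A y ρ r t ≤
      ∑ z ∈ A, m z * (Real.exp (ψ z) * killedKernel c m A y t z) ^ 2 := by
    refine (Finset.sum_le_sum fun z hz => ?_).trans
      (Finset.sum_le_sum_of_subset_of_nonneg (Finset.filter_subset (fun z => r ≤ ρ z) A)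
        fun z _ _ => mul_nonneg (h.pos z).le (sq_nonneg _))
    rw [Finset.mem_filter] at hz
    have : ψ z = 0 := by
      rw [hψ]
      simp only
      rw [min_eq_right (by linarith [hz.2]), mul_zero]
    rw [this, Real.exp_zero, one_mul]
  refine h2.trans (h1.trans (mul_le_mul_of_nonneg_left ?_ (Real.exp_pos _).le))
  rw [farMass, Finset.mul_sum, Finset.sum_filter, ← Finset.sum_add_distrib]
  refine Finset.sum_le_sum fun z _ => ?_
  have hψ0 : ψ z ≤ 0 := mul_nonpos_of_nonneg_of_nonpos hlam (min_le_right _ _)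
  have hm0 : 0 ≤ m z * killedKernel c m A y s z ^ 2 := mul_nonneg (h.pos z).le (sq_nonneg _)
  have e1 : m z * (Real.exp (ψ z) * killedKernel c m A y s z) ^ 2 =
      Real.exp (2 * ψ z) * (m z * killedKernel c m A y s z ^ 2) := by
    rw [mul_pow, ← Real.exp_nat_mul]
    push_cast
    ring
  rw [e1]
  split_ifs with hz
  · have h3 : Real.exp (2 * ψ z) ≤ 1 := Real.exp_le_one_iff.mpr (by linarith)
    have h4 := mul_le_mul_of_nonneg_right h3 hm0
    have h5 := mul_nonneg (Real.exp_pos (-(2 * lam * (r - r')))).le hm0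
    linarith
  · rw [zero_add]
    refine mul_le_mul_of_nonneg_right (Real.exp_le_exp.mpr ?_) hm0
    have h3 : min (ρ z - r) 0 ≤ r' - r := (min_le_left _ _).trans (by linarith [not_le.mp hz])
    have := mul_le_mul_of_nonneg_left h3 hlam
    simp only [hψ]
    linarith

theorem cosh_sub_one_le {x : ℝ} (h0 : 0 ≤ x) (h1 : x ≤ 1) : Real.cosh x - 1 ≤ x ^ 2 := by
  have h2 := Real.cosh_le_exp_half_sq x
  have hx : x ^ 2 ≤ 1 := pow_le_one₀ h0 h1
  have h3 := Real.exp_bound_div_one_sub_of_interval (x := x ^ 2 / 2) (by positivity) (by linarith)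
  have h4 : 1 / (1 - x ^ 2 / 2) ≤ 1 + x ^ 2 := by
    rw [div_le_iff₀ (by linarith)]
    nlinarith [sq_nonneg x]
  linarith

/-- Gaussian decay of the `ℓ²` mass far from the starting point, by iterating Davies' bound along
geometrically decreasing times. The starting density `(m y)⁻¹` enters with a stretched exponential
factor only. -/
theorem farMass_le_gaussian (h : IsWeight c m) (hy : y ∈ A)
    (hρ : ∀ z w, c z w ≠ 0 → |ρ z - ρ w| ≤ 1) (hρy : ρ y = 0) {K γ : ℝ} (hK : 0 ≤ K) (hγ : 0 < γ)
    (hdiag : ∀ t : ℝ, 0 < t → ∑ z ∈ A, m z * killedKernel c m A y t z ^ 2 ≤ K * t ^ (-γ))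
    {r t : ℝ} (hr : 0 < r) (hrt : r / 64 ≤ t) :
    farMass c m A y ρ r t ≤
      2 ^ (4 * (γ + 1)) * K * t ^ (-γ) * Real.exp (-(1 / 256 * (r ^ 2 / t))) +
      Real.exp (-(1 / 512 * (r ^ 2 / t) + 1 / 8 * √(r ^ 2 / t * r))) * (m y)⁻¹ := by
  have hm0 : 0 ≤ (m y)⁻¹ := inv_nonneg.mpr (h.pos y).le
  -- Induction along `(r, t) ↦ (7r/8, t/2)`: `t/r` falls by the factor `4/7` until it is at most
  -- `1/32`, while `Z = r²/t` grows by `49/32`, which leaves room in the exponents at every step.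
  have key : ∀ n : ℕ, ∀ r t : ℝ, 0 < r → r / 64 ≤ t → t ≤ (7 / 4) ^ n * (r / 32) →
      farMass c m A y ρ r t ≤
      2 ^ (4 * (γ + 1)) * K * t ^ (-γ) * Real.exp (-(1 / 256 * (r ^ 2 / t))) +
      Real.exp (-(1 / 512 * (r ^ 2 / t) + 1 / 8 * √(r ^ 2 / t * r))) * (m y)⁻¹ := by
    -- Here `t` and `r` are comparable, so slope `1` gives decay like `exp(-2r + 2t)`, while `Z ≤ 64
    -- r` and `√(Z r) ≤ 8 r`.
    have base : ∀ r t : ℝ, 0 < r → r / 64 ≤ t → t ≤ r / 32 →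
      farMass c m A y ρ r t ≤
      2 ^ (4 * (γ + 1)) * K * t ^ (-γ) * Real.exp (-(1 / 256 * (r ^ 2 / t))) +
      Real.exp (-(1 / 512 * (r ^ 2 / t) + 1 / 8 * √(r ^ 2 / t * r))) * (m y)⁻¹ := by
      intro r t hr hrt htr
      have ht : 0 < t := lt_of_lt_of_le (by positivity) hrt
      have h1 := farMass_le_exp h hy hρ hρy (r := r) zero_le_one ht.le
      have h2 := cosh_sub_one_le zero_le_one le_rfl
      have hZ : r ^ 2 / t ≤ 64 * r := by
        rw [div_le_iff₀ ht]
        nlinarith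
      have hsq : √(r ^ 2 / t * r) ≤ 8 * r := by
        refine Real.sqrt_le_iff.mpr ⟨by positivity, ?_⟩
        nlinarith
      have h3 : 2 * (Real.cosh 1 - 1) * t - 2 * 1 * r ≤
          -(1 / 512 * (r ^ 2 / t) + 1 / 8 * √(r ^ 2 / t * r)) := by
        nlinarith
      refine h1.trans ((mul_le_mul_of_nonneg_right (Real.exp_le_exp.mpr h3) hm0).trans ?_)
      refine le_add_of_nonneg_left ?_
      positivity
    intro n
    induction n with
    | zero =>
      intro r t hr hrt htr
      rw [pow_zero, one_mul] at htr
      exact base r t hr hrt htr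
    | succ n ih =>
      intro r t hr hrt htr
      by_cases htr' : t ≤ r / 32
      · exact base r t hr hrt htr'
      push Not at htr'
      have ht : 0 < t := lt_of_lt_of_le (by positivity) hrt
      set Z : ℝ := r ^ 2 / t with hZ
      have hZ0 : 0 < Z := by positivity
      have hKt : 0 ≤ K * t ^ (-γ) := by positivity
      set L : ℝ := 2 ^ (4 * (γ + 1)) with hL
      have hL0 : 0 < L := by positivity
      -- For small `Z` the constant `L` outweighs the Gaussian factor and the total mass is enough.
      -- For large `Z` a factor `exp(-Z/1024)` pays for the loss `2 · 2^γ` of each halving of time.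
      by_cases hZL : Z < 1024 * ((γ + 1) * Real.log 2)
      · have h1 : 1 ≤ L * Real.exp (-(1 / 256 * Z)) := by
          rw [hL, Real.rpow_def_of_pos two_pos, ← Real.exp_add]
          refine Real.one_le_exp ?_
          linarith
        calc _ ≤ K * t ^ (-γ) := (farMass_le h r t).trans (hdiag t ht)
          _ ≤ K * t ^ (-γ) * (L * Real.exp (-(1 / 256 * Z))) := le_mul_of_one_le_right hKt h1
          _ = L * K * t ^ (-γ) * Real.exp (-(1 / 256 * Z)) := by ring
          _ ≤ _ := le_add_of_nonneg_right (by positivity)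
      · push Not at hZL
        have h1 := ih (7 / 8 * r) (t / 2) (by positivity) (by linarith) (by
          rw [pow_succ] at htr
          nlinarith)
        -- This slope costs `exp(Z/1024)` over a time `t/2` and gains `exp(-Z/128)` over the
        -- distance `r/8`; `r/32 < t` ensures `lam ≤ 1`.
        set lam : ℝ := r / (32 * t) with hlam
        have hlam0 : 0 ≤ lam := by positivity
        have hlam1 : lam ≤ 1 := by
          rw [hlam, div_le_one (by positivity)]
          linarith
        have h2 := farMass_le_step h hy hρ (r := r) (r' := 7 / 8 * r) (s := t / 2) (t := t) hlam0
          (by positivity) (by linarith)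
        have h3 := hdiag (t / 2) (by positivity)
        have ht2 : (t / 2) ^ (-γ) = 2 ^ γ * t ^ (-γ) := by
          rw [Real.div_rpow ht.le two_pos.le, Real.rpow_neg two_pos.le]
          field_simp
        have hZ' : (7 / 8 * r) ^ 2 / (t / 2) = 49 / 32 * Z := by
          rw [hZ]; field_simp; norm_num
        rw [ht2] at h1 h3
        rw [hZ'] at h1
        have e1 : 2 * (Real.cosh lam - 1) * (t - t / 2) ≤ 1 / 1024 * Z := by
          have h4 := mul_le_mul_of_nonneg_right (cosh_sub_one_le hlam0 hlam1) ht.le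
          have h5 : lam ^ 2 * t = 1 / 1024 * Z := by
            rw [hlam, hZ]; field_simp; norm_num
          linarith
        have e2 : 2 * lam * (r - 7 / 8 * r) = 1 / 128 * Z := by
          rw [hlam, hZ]; field_simp; norm_num
        rw [e2] at h2
        have hsq : √(Z * r) ≤ √(49 / 32 * Z * (7 / 8 * r)) := by
          refine Real.sqrt_le_sqrt ?_
          have : 0 < Z * r := by positivity
          nlinarith
        have e3 : 2 * (2 ^ γ * Real.exp (-(1 / 1024 * Z))) ≤ 1 := by
          have h6 : (2 : ℝ) * 2 ^ γ = Real.exp ((γ + 1) * Real.log 2) := by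
            rw [mul_comm, ← Real.rpow_add_one two_ne_zero, Real.rpow_def_of_pos two_pos, mul_comm]
          rw [← mul_assoc, h6, ← Real.exp_add]
          refine Real.exp_le_one_iff.mpr ?_
          linarith
        have e4 : 2 * (2 : ℝ) ^ γ ≤ L := by
          rw [hL, mul_comm, ← Real.rpow_add_one two_ne_zero]
          exact Real.rpow_le_rpow_of_exponent_le one_le_two (by linarith)
        set T := K * t ^ (-γ) with hT
        have hbig : farMass c m A y ρ r t ≤ Real.exp (1 / 1024 * Z) *
            ((L * (2 ^ γ * T) * Real.exp (-(1 / 256 * (49 / 32 * Z))) +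
              Real.exp (-(1 / 512 * (49 / 32 * Z) + 1 / 8 * √(Z * r))) * (m y)⁻¹) +
              Real.exp (-(1 / 128 * Z)) * (2 ^ γ * T)) := by
          refine h2.trans ?_
          refine mul_le_mul (Real.exp_le_exp.mpr e1) ?_ ?_ (Real.exp_pos _).le
          · refine add_le_add (h1.trans (add_le_add (le_of_eq (by rw [hT]; ring)) ?_)) ?_
            · refine mul_le_mul_of_nonneg_right (Real.exp_le_exp.mpr ?_) hm0
              linarith
            · refine mul_le_mul_of_nonneg_left (h3.trans (le_of_eq (by rw [hT]; ring)))
                (Real.exp_pos _).le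
          · refine add_nonneg (Finset.sum_nonneg fun z _ => mul_nonneg (h.pos z).le (sq_nonneg _))
              (mul_nonneg (Real.exp_pos _).le
                (Finset.sum_nonneg fun z _ => mul_nonneg (h.pos z).le (sq_nonneg _)))
        refine hbig.trans ?_
        have f1 : Real.exp (1 / 1024 * Z) * (L * (2 ^ γ * T) *
            Real.exp (-(1 / 256 * (49 / 32 * Z)))) ≤
            1 / 2 * (L * T * Real.exp (-(1 / 256 * Z))) := by
          have g1 : Real.exp (1 / 1024 * Z) * Real.exp (-(1 / 256 * (49 / 32 * Z))) ≤
              Real.exp (-(1 / 1024 * Z)) * Real.exp (-(1 / 256 * Z)) := by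
            rw [← Real.exp_add, ← Real.exp_add]
            refine Real.exp_le_exp.mpr ?_
            linarith
          have g2 : 0 ≤ L * T * Real.exp (-(1 / 256 * Z)) := by positivity
          calc _ = L * (2 ^ γ * T) *
                (Real.exp (1 / 1024 * Z) * Real.exp (-(1 / 256 * (49 / 32 * Z)))) := by ring
            _ ≤ L * (2 ^ γ * T) * (Real.exp (-(1 / 1024 * Z)) * Real.exp (-(1 / 256 * Z))) :=
                mul_le_mul_of_nonneg_left g1 (by positivity)
            _ = (2 ^ γ * Real.exp (-(1 / 1024 * Z))) * (L * T * Real.exp (-(1 / 256 * Z))) := by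
                ring
            _ ≤ _ := mul_le_mul_of_nonneg_right (by linarith) g2
        have f2 : Real.exp (1 / 1024 * Z) * (Real.exp (-(1 / 128 * Z)) * (2 ^ γ * T)) ≤
            1 / 2 * (L * T * Real.exp (-(1 / 256 * Z))) := by
          have g1 : Real.exp (1 / 1024 * Z) * Real.exp (-(1 / 128 * Z)) ≤
              Real.exp (-(1 / 256 * Z)) := by
            rw [← Real.exp_add]
            refine Real.exp_le_exp.mpr ?_
            linarith
          calc _ = (2 ^ γ * T) * (Real.exp (1 / 1024 * Z) * Real.exp (-(1 / 128 * Z))) := by ring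
            _ ≤ (2 ^ γ * T) * Real.exp (-(1 / 256 * Z)) :=
                mul_le_mul_of_nonneg_left g1 (by positivity)
            _ ≤ (1 / 2 * L * T) * Real.exp (-(1 / 256 * Z)) := by
                refine mul_le_mul_of_nonneg_right ?_ (Real.exp_pos _).le
                exact mul_le_mul_of_nonneg_right (by linarith) hKt
            _ = _ := by ring
        have f3 : Real.exp (1 / 1024 * Z) *
            (Real.exp (-(1 / 512 * (49 / 32 * Z) + 1 / 8 * √(Z * r))) * (m y)⁻¹) ≤
            Real.exp (-(1 / 512 * Z + 1 / 8 * √(Z * r))) * (m y)⁻¹ := by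
          rw [← mul_assoc, ← Real.exp_add]
          refine mul_le_mul_of_nonneg_right (Real.exp_le_exp.mpr ?_) hm0
          linarith
        have f4 : L * K * t ^ (-γ) = L * T := by rw [hT]; ring
        rw [f4, mul_add, mul_add]
        linarith
  obtain ⟨n, hn⟩ := pow_unbounded_of_one_lt (t / (r / 32)) (by norm_num : (1 : ℝ) < 7 / 4)
  refine key n r t hr hrt ?_
  rw [div_lt_iff₀ (by positivity)] at hn
  exact hn.le

/-- Off-diagonal bounds from the mass far from both endpoints. -/
theorem killedKernel_le_of_farMass (h : IsWeight c m) {z : V} (hy : y ∈ A) (hz : z ∈ A)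
    {ρ ρ' : V → ℝ} {r t J F : ℝ} (hρ : ∀ w, r ≤ ρ w ∨ r ≤ ρ' w)
    (hJ0 : 0 ≤ J) (hJ : farMass c m A y ρ r t ≤ J) (hJ' : farMass c m A z ρ' r t ≤ J)
    (hF : ∑ w ∈ A, m w * killedKernel c m A y t w ^ 2 ≤ F)
    (hF' : ∑ w ∈ A, m w * killedKernel c m A z t w ^ 2 ≤ F) :
    killedKernel c m A y (t + t) z ≤ 2 * √(J * F) := by
  classical
  have hm := fun w => (h.pos w).le
  have cs : ∀ B : Finset V, ∑ w ∈ B, m w * (killedKernel c m A z t w * killedKernel c m A y t w) ≤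
      √((∑ w ∈ B, m w * killedKernel c m A z t w ^ 2) *
        ∑ w ∈ B, m w * killedKernel c m A y t w ^ 2) := by
    intro B
    refine Real.le_sqrt_of_sq_le ?_
    refine Finset.sum_sq_le_sum_mul_sum_of_sq_le_mul _
      (fun w _ => mul_nonneg (hm w) (sq_nonneg _)) (fun w _ => mul_nonneg (hm w) (sq_nonneg _))
      fun w _ => le_of_eq (by ring)
  -- Each midpoint is far from `y` or from `z`; Cauchy–Schwarz on each of the two parts pairs a far
  -- mass with a total mass.
  rw [killedKernel_add h hz hy,
    ← Finset.sum_filter_add_sum_filter_not A (fun w => r ≤ ρ w)]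
  have h1 : ∑ w ∈ A with r ≤ ρ w, m w * (killedKernel c m A z t w * killedKernel c m A y t w) ≤
      √(J * F) := by
    refine (cs _).trans (Real.sqrt_le_sqrt ?_)
    rw [mul_comm]
    refine mul_le_mul hJ ?_ (Finset.sum_nonneg fun w _ => mul_nonneg (hm w) (sq_nonneg _)) hJ0
    exact (Finset.sum_le_sum_of_subset_of_nonneg (Finset.filter_subset _ _)
      fun w _ _ => mul_nonneg (hm w) (sq_nonneg _)).trans hF'
  have h2 : ∑ w ∈ A with ¬ r ≤ ρ w, m w * (killedKernel c m A z t w * killedKernel c m A y t w) ≤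
      √(J * F) := by
    refine (cs _).trans (Real.sqrt_le_sqrt ?_)
    refine mul_le_mul (le_trans ?_ hJ') ?_
      (Finset.sum_nonneg fun w _ => mul_nonneg (hm w) (sq_nonneg _)) hJ0
    · refine Finset.sum_le_sum_of_subset_of_nonneg (fun w hw => ?_)
        fun w _ _ => mul_nonneg (hm w) (sq_nonneg _)
      rw [Finset.mem_filter] at hw ⊢
      exact ⟨hw.1, (hρ w).resolve_left hw.2⟩
    · exact (Finset.sum_le_sum_of_subset_of_nonneg (Finset.filter_subset _ _)
        fun w _ _ => mul_nonneg (hm w) (sq_nonneg _)).trans hF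
  linarith

/-- Davies' pointwise bound. -/
theorem killedKernel_le_exp (h : IsWeight c m) {z : V} (hy : y ∈ A) (hz : z ∈ A)
    (hρ : ∀ z w, c z w ≠ 0 → |ρ z - ρ w| ≤ 1) (hρy : ρ y = 0) {lam t H : ℝ} (hlam : 0 ≤ lam)
    (ht : 0 ≤ t) (hyH : (m y)⁻¹ ≤ H) (hzH : (m z)⁻¹ ≤ H) :
    killedKernel c m A y t z ≤ H * Real.exp ((Real.cosh lam - 1) * t - lam * ρ z) := by
  have h1 := sum_weighted_sq_le h hy hρ hρy hlam ht
  have h2 := (Finset.single_le_sum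
    (f := fun z => m z * (Real.exp (lam * ρ z) * killedKernel c m A y t z) ^ 2)
    (fun w _ => mul_nonneg (h.pos w).le (sq_nonneg _)) hz).trans h1
  have hH0 : 0 < H := (inv_pos.mpr (h.pos y)).trans_le hyH
  have hmz := h.pos z
  have h3 : (Real.exp (lam * ρ z) * killedKernel c m A y t z) ^ 2 ≤
      (H * Real.exp ((Real.cosh lam - 1) * t)) ^ 2 := by
    have h4 : (Real.exp (lam * ρ z) * killedKernel c m A y t z) ^ 2 ≤
        (m z)⁻¹ * (Real.exp (2 * (Real.cosh lam - 1) * t) * (m y)⁻¹) := by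
      rw [inv_mul_eq_div, le_div_iff₀ hmz, mul_comm]
      exact h2
    refine h4.trans ?_
    rw [mul_pow, ← Real.exp_nat_mul]
    have h5 : Real.exp (2 * (Real.cosh lam - 1) * t) =
        Real.exp ((2 : ℕ) * ((Real.cosh lam - 1) * t)) := by
      push_cast; ring_nf
    rw [h5]
    have h6 : (m z)⁻¹ * (m y)⁻¹ ≤ H * H :=
      mul_le_mul hzH hyH (inv_nonneg.mpr (h.pos y).le) hH0.le
    have := mul_le_mul_of_nonneg_right h6
      (Real.exp_pos ((2 : ℕ) * ((Real.cosh lam - 1) * t))).le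
    nlinarith
  have h7 := le_of_sq_le_sq h3 (by positivity)
  rw [Real.exp_sub, ← mul_div_assoc, le_div_iff₀ (Real.exp_pos _), mul_comm]
  exact h7

end FarMass

/-! ### Exponentials absorb powers -/

section Absorption

theorem exists_rpow_mul_exp_neg_sqrt_le {k a : ℝ} (hk : 0 ≤ k) (ha : 0 < a) :
    ∃ C : ℝ, 0 < C ∧ ∀ x : ℝ, 0 ≤ x → x ^ k * Real.exp (-(a * √x)) ≤ C := by
  -- For `x ≥ 1` this gives `x^k ≤ (√x)^n`, which the `n`-th term of the exponential series
  -- controls.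
  set n : ℕ := ⌈2 * k⌉₊ with hn
  refine ⟨1 + n.factorial / a ^ n, by positivity, fun x hx => ?_⟩
  have hexp : Real.exp (-(a * √x)) ≤ 1 := Real.exp_le_one_iff.mpr (by
    have : 0 ≤ a * √x := by positivity
    linarith)
  have hpos : 0 ≤ n.factorial / a ^ n := by positivity
  rcases le_total x 1 with h1 | h1
  · have h2 : x ^ k ≤ 1 := Real.rpow_le_one hx h1 hk
    have := mul_le_one₀ h2 (Real.exp_pos _).le hexp
    linarith
  · have h2 : x ^ k ≤ √x ^ n := by
      rw [Real.sqrt_eq_rpow, ← Real.rpow_natCast, ← Real.rpow_mul hx]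
      refine Real.rpow_le_rpow_of_exponent_le h1 ?_
      have := Nat.le_ceil (2 * k)
      rw [← hn] at this
      linarith
    have h3 := Real.pow_div_factorial_le_exp (a * √x) (by positivity) n
    rw [mul_pow, div_le_iff₀ (by positivity)] at h3
    have h4 : √x ^ n ≤ n.factorial / a ^ n * Real.exp (a * √x) := by
      rw [div_mul_eq_mul_div, le_div_iff₀ (by positivity)]
      linarith
    have h5 : x ^ k * Real.exp (-(a * √x)) ≤ n.factorial / a ^ n := by
      rw [Real.exp_neg, ← div_eq_mul_inv, div_le_iff₀ (Real.exp_pos _)]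
      exact h2.trans h4
    linarith

theorem exists_rpow_mul_exp_neg_le {k a : ℝ} (hk : 0 ≤ k) (ha : 0 < a) :
    ∃ C : ℝ, 0 < C ∧ ∀ x : ℝ, 0 ≤ x → x ^ k * Real.exp (-(a * x)) ≤ C := by
  obtain ⟨C, hC, h⟩ := exists_rpow_mul_exp_neg_sqrt_le hk ha
  refine ⟨1 + C, by positivity, fun x hx => ?_⟩
  rcases le_total x 1 with h1 | h1
  · have h2 : x ^ k ≤ 1 := Real.rpow_le_one hx h1 hk
    have h3 : Real.exp (-(a * x)) ≤ 1 := Real.exp_le_one_iff.mpr (by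
      have : 0 ≤ a * x := by positivity
      linarith)
    have := mul_le_one₀ h2 (Real.exp_pos _).le h3
    linarith
  · have h2 : √x ≤ x := Real.sqrt_le_iff.mpr ⟨hx, by nlinarith⟩
    have h3 : Real.exp (-(a * x)) ≤ Real.exp (-(a * √x)) :=
      Real.exp_le_exp.mpr (neg_le_neg (mul_le_mul_of_nonneg_left h2 ha.le))
    have := mul_le_mul_of_nonneg_left h3 (Real.rpow_nonneg hx k)
    linarith [h x hx]

end Absorption

/-! ### The graph distance as a weight function -/

section Distance

variable {V : Type u} {G : SimpleGraph V}

theorem abs_dist_sub_dist_le (hG : G.Connected) (ω : Conductances G) (y z w : V)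
    (h : conductance ω z w ≠ 0) : |(G.dist y z : ℝ) - G.dist y w| ≤ 1 := by
  have hadj : G.Adj z w := by
    by_contra h'
    exact h (conductance_of_not_adj ω h')
  have h1 : G.dist y z ≤ G.dist y w + 1 := by
    have := hG.dist_triangle (u := y) (v := w) (w := z)
    rwa [SimpleGraph.dist_eq_one_iff_adj.mpr hadj.symm] at this
  have h2 : G.dist y w ≤ G.dist y z + 1 := by
    have := hG.dist_triangle (u := y) (v := z) (w := w)
    rwa [SimpleGraph.dist_eq_one_iff_adj.mpr hadj] at this
  have h1' : (G.dist y z : ℝ) ≤ G.dist y w + 1 := by exact_mod_cast h1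
  have h2' : (G.dist y w : ℝ) ≤ G.dist y z + 1 := by exact_mod_cast h2
  rw [abs_le]
  constructor <;> linarith

theorem dist_triangle_real (hG : G.Connected) (x y z : V) :
    (G.dist x z : ℝ) ≤ G.dist x y + G.dist y z := by
  exact_mod_cast hG.dist_triangle (u := x) (v := y) (w := z)

theorem ball_mono [G.LocallyFinite] (hG : G.Connected) (x : V) {m n : ℕ} (h : m ≤ n) :
    ball G x m ⊆ ball G x n := fun y hy => by
  rw [mem_ball G hG] at hy ⊢
  exact hy.trans h

end Distance

/-! ### Gaussian and Poisson bounds for killed kernels -/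

section Gaussian

/-- Gaussian decay of the mass far from the starting point at scales comparable to the ball. -/
theorem exists_farMass_le_of_onDiagonalBound {d γ g C₁ C₂ : ℝ} (hd : 0 ≤ d) (hγ : 0 < γ)
    (hg : 0 < g) (hC₁ : 0 < C₁) (hC₂ : 0 < C₂) :
    ∃ C : ℝ, 0 < C ∧ ∀ (V : Type u) [Infinite V] (G : SimpleGraph V) [G.LocallyFinite],
      G.Connected → ∀ (ω : Conductances G) (x : V) (R : ℕ), 1 ≤ R →
      OnDiagonalBound ω x R d γ g C₁ C₂ → ∀ y ∈ ball G x R, ∀ r t : ℝ, 0 < r → r / 64 ≤ t →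
      1 / 2 ≤ r ^ 2 / t → (R : ℝ) ≤ 16 * r → t ≤ 2 * (R : ℝ) ^ 2 →
      farMass (conductance ω) (mu ω) (ball G x R) y (fun w => (G.dist y w : ℝ)) r t ≤
        C * ((R : ℝ) ^ (-d) * ((R : ℝ) ^ 2 / t) ^ γ) * Real.exp (-(1 / 512 * (r ^ 2 / t))) := by
  obtain ⟨C₃, hC₃, hab⟩ := exists_rpow_mul_exp_neg_sqrt_le (k := g + d) (a := 1 / 64)
    (by linarith) (by norm_num)
  refine ⟨2 ^ (4 * (γ + 1)) * C₁ + C₂ * C₃ * 2 ^ γ, by positivity, ?_⟩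
  intro V _ G _ hG ω x R hR hB v hv r t hr hrt hZ1 hRr htR
  have hw := isWeight_conductance hG ω
  have hR0 : (0 : ℝ) < R := by exact_mod_cast hR
  have ht : 0 < t := lt_of_lt_of_le (by positivity) hrt
  have h1 := farMass_le_gaussian hw hv (ρ := fun w => (G.dist v w : ℝ))
    (fun z w h => abs_dist_sub_dist_le hG ω v z w h) (by simp)
    (K := C₁ * (R : ℝ) ^ (-d) * ((R : ℝ) ^ 2) ^ γ) (γ := γ) (by positivity) hγ
    (fun s hs => (hB.sq_le v hv s hs).trans (le_of_eq (by
      rw [Real.div_rpow (by positivity) hs.le, Real.rpow_neg hs.le]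
      ring))) hr hrt
  refine h1.trans ?_
  have hBeq : (R : ℝ) ^ (-d) * ((R : ℝ) ^ 2) ^ γ * t ^ (-γ) =
      (R : ℝ) ^ (-d) * ((R : ℝ) ^ 2 / t) ^ γ := by
    rw [Real.div_rpow (by positivity) ht.le, Real.rpow_neg ht.le]
    ring
  -- Because `t ≤ 2 R²`, the term with the starting density can be given the same prefactor as the
  -- main term.
  have h6 : (1 : ℝ) ≤ 2 ^ γ * ((R : ℝ) ^ 2 / t) ^ γ := by
    rw [← Real.mul_rpow (by norm_num) (by positivity)]
    refine Real.one_le_rpow ?_ hγ.le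
    rw [← mul_div_assoc, one_le_div ht]
    exact htR
  obtain ⟨P, hP⟩ : ∃ P : ℝ, P = ((R : ℝ) ^ 2 / t) ^ γ := ⟨_, rfl⟩
  obtain ⟨Q, hQ⟩ : ∃ Q : ℝ, Q = (R : ℝ) ^ (-d) := ⟨_, rfl⟩
  obtain ⟨Z, hZ⟩ : ∃ Z : ℝ, Z = r ^ 2 / t := ⟨_, rfl⟩
  have hP0 : 0 < P := by rw [hP]; positivity
  have hQ0 : 0 < Q := by rw [hQ]; positivity
  have h7 : (R : ℝ) ^ g * Real.exp (-(1 / 64 * √(R : ℝ))) ≤ C₃ * Q := by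
    have := hab R hR0.le
    rw [Real.rpow_add hR0] at this
    rw [hQ, Real.rpow_neg hR0.le, ← div_eq_mul_inv, le_div_iff₀ (by positivity)]
    linarith
  rw [← hP] at h6
  rw [← hP, ← hQ] at hBeq
  rw [← hZ] at hZ1
  rw [← hP, ← hQ, ← hZ]
  -- As `r` is at least `R/16` and `Z ≥ 1/2`, the stretched exponential decays in `√R` and so beats
  -- `R^(g+d)`.
  have hsqrt : 1 / 64 * √(R : ℝ) ≤ 1 / 8 * √(Z * r) := by
    have h4 : √(R : ℝ) / 8 ≤ √(Z * r) := by
      refine Real.le_sqrt_of_sq_le ?_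
      rw [div_pow, Real.sq_sqrt hR0.le]
      nlinarith
    linarith
  have h3 : 2 ^ (4 * (γ + 1)) * (C₁ * Q * ((R : ℝ) ^ 2) ^ γ) * t ^ (-γ) *
      Real.exp (-(1 / 256 * Z)) ≤ 2 ^ (4 * (γ + 1)) * C₁ * (Q * P) * Real.exp (-(1 / 512 * Z)) := by
    have e1 : 2 ^ (4 * (γ + 1)) * (C₁ * Q * ((R : ℝ) ^ 2) ^ γ) * t ^ (-γ) =
        2 ^ (4 * (γ + 1)) * C₁ * (Q * P) := by rw [← hBeq]; ring
    rw [e1]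
    refine mul_le_mul_of_nonneg_left (Real.exp_le_exp.mpr ?_) (by positivity)
    linarith
  have h5 : Real.exp (-(1 / 512 * Z + 1 / 8 * √(Z * r))) * (mu ω v)⁻¹ ≤
      C₂ * C₃ * 2 ^ γ * (Q * P) * Real.exp (-(1 / 512 * Z)) := by
    calc _ ≤ (Real.exp (-(1 / 512 * Z)) * Real.exp (-(1 / 64 * √(R : ℝ)))) *
          (C₂ * (R : ℝ) ^ g) := by
          rw [← Real.exp_add]
          refine mul_le_mul (Real.exp_le_exp.mpr (by linarith)) (hB.inv_mu_le v hv)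
            (inv_nonneg.mpr (hw.pos v).le) (Real.exp_pos _).le
      _ = C₂ * ((R : ℝ) ^ g * Real.exp (-(1 / 64 * √(R : ℝ)))) * Real.exp (-(1 / 512 * Z)) := by
          ring
      _ ≤ C₂ * (C₃ * Q) * Real.exp (-(1 / 512 * Z)) :=
          mul_le_mul_of_nonneg_right (mul_le_mul_of_nonneg_left h7 hC₂.le) (Real.exp_pos _).le
      _ ≤ C₂ * (C₃ * Q) * (2 ^ γ * P) * Real.exp (-(1 / 512 * Z)) :=
          mul_le_mul_of_nonneg_right (le_mul_of_one_le_right (by positivity) h6)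
            (Real.exp_pos _).le
      _ = _ := by ring
  calc _ ≤ _ := add_le_add h3 h5
    _ = _ := by ring

/-- Gaussian bounds inside a ball, up to a polynomial factor in `R ^ 2 / t`. -/
theorem exists_killedKernel_gaussian {d γ g C₁ C₂ : ℝ} (hd : 0 ≤ d) (hγ : 0 < γ) (hg : 0 < g)
    (hC₁ : 0 < C₁) (hC₂ : 0 < C₂) :
    ∃ C : ℝ, 0 < C ∧ ∀ (V : Type u) [Infinite V] (G : SimpleGraph V) [G.LocallyFinite],
      G.Connected → ∀ (ω : Conductances G) (x : V) (R : ℕ), 1 ≤ R →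
      OnDiagonalBound ω x R d γ g C₁ C₂ → ∀ y ∈ ball G x R, ∀ z ∈ ball G x R, ∀ t : ℝ, 0 < t →
      (G.dist y z : ℝ) ≤ t → (R : ℝ) ^ 2 ≤ 64 * max ((G.dist y z : ℝ) ^ 2) t →
      killedKernel (conductance ω) (mu ω) (ball G x R) y t z ≤
        C * ((R : ℝ) ^ (-d) * ((R : ℝ) ^ 2 / t) ^ γ) *
          Real.exp (-(1 / 2048 * ((G.dist y z : ℝ) ^ 2 / t))) := by
  obtain ⟨C₄, hC₄, hfar⟩ := exists_farMass_le_of_onDiagonalBound.{u} hd hγ hg hC₁ hC₂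
  refine ⟨4 * ((C₄ + C₁) * 2 ^ γ), by positivity, ?_⟩
  intro V _ G _ hG ω x R hR hB y hy z hz t ht hDt hRD
  have hw := isWeight_conductance hG ω
  have hR0 : (0 : ℝ) < R := by exact_mod_cast hR
  have hhR : ∀ v ∈ ball G x R, (G.dist x v : ℝ) ≤ R := fun v hv => by
    exact_mod_cast (mem_ball G hG x v R).mp hv
  have hD2R : (G.dist y z : ℝ) ≤ 2 * R := by
    have := dist_triangle_real hG y x z
    rw [G.dist_comm (u := y) (v := x)] at this
    linarith [hhR y hy, hhR z hz]
  have hcover : ∀ w, (G.dist y z : ℝ) / 2 ≤ G.dist y w ∨ (G.dist y z : ℝ) / 2 ≤ G.dist z w := by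
    intro w
    by_contra hcon
    push Not at hcon
    have := dist_triangle_real hG y w z
    rw [G.dist_comm (u := w) (v := z)] at this
    linarith
  have hD0 : (0 : ℝ) ≤ G.dist y z := Nat.cast_nonneg _
  have hs : 0 < t / 2 := by positivity
  have hBs : (R : ℝ) ^ (-d) * ((R : ℝ) ^ 2 / (t / 2)) ^ γ =
      2 ^ γ * ((R : ℝ) ^ (-d) * ((R : ℝ) ^ 2 / t) ^ γ) := by
    have : (R : ℝ) ^ 2 / (t / 2) = 2 * ((R : ℝ) ^ 2 / t) := by field_simp
    rw [this, Real.mul_rpow two_pos.le (by positivity)]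
    ring
  have hB0 : 0 < (R : ℝ) ^ (-d) * ((R : ℝ) ^ 2 / t) ^ γ := by positivity
  have hF : ∀ v ∈ ball G x R, ∑ w ∈ ball G x R, mu ω w *
      killedKernel (conductance ω) (mu ω) (ball G x R) v (t / 2) w ^ 2 ≤
        C₁ * 2 ^ γ * ((R : ℝ) ^ (-d) * ((R : ℝ) ^ 2 / t) ^ γ) :=
    fun v hv => (hB.sq_le v hv (t / 2) hs).trans (le_of_eq (by rw [mul_assoc, hBs]; ring))
  have hJ := fun v hv => hfar V G hG ω x R hR hB v hv ((G.dist y z : ℝ) / 2) (t / 2)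
  rw [hBs] at hJ
  clear hfar hBs
  obtain ⟨B, hBdef⟩ : ∃ B, B = (R : ℝ) ^ (-d) * ((R : ℝ) ^ 2 / t) ^ γ := ⟨_, rfl⟩
  rw [← hBdef] at hF hB0 hJ ⊢
  have hJ' : ∀ v, v ∈ ball G x R → farMass (conductance ω) (mu ω) (ball G x R) v
      (fun w => (G.dist v w : ℝ)) 0 (t / 2) ≤ C₁ * 2 ^ γ * B :=
    fun v hv => (farMass_le hw _ _).trans (hF v hv)
  have htt : t / 2 + t / 2 = t := by ring
  obtain ⟨D, hD⟩ : ∃ D : ℝ, D = G.dist y z := ⟨_, rfl⟩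
  rw [← hD] at hDt hRD hD2R hcover hD0 hJ ⊢
  have hγ2 : (0 : ℝ) < 2 ^ γ := by positivity
  obtain ⟨T, hT⟩ : ∃ T : ℝ, T = 2 ^ γ := ⟨_, rfl⟩
  rw [← hT] at hF hJ hJ' hγ2 ⊢
  -- If `D² ≤ t` the Gaussian factor is at least `1/2` and radius `0`, that is the total mass,
  -- suffices. Otherwise far masses are taken at radius `D/2` and time `t/2`; the square root halves
  -- their exponent.
  rcases le_or_gt (D ^ 2) t with hcase | hcase
  · have h1 := killedKernel_le_of_farMass hw hy hz (r := 0)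
      (J := C₁ * T * B) (fun _ => Or.inl (Nat.cast_nonneg _)) (by positivity)
      (hJ' y hy) (hJ' z hz) (hF y hy) (hF z hz)
    rw [htt, Real.sqrt_mul_self (by positivity)] at h1
    have h2 : (1 : ℝ) / 2 ≤ Real.exp (-(1 / 2048 * (D ^ 2 / t))) := by
      have h3 : D ^ 2 / t ≤ 1 := (div_le_one ht).mpr hcase
      have := Real.add_one_le_exp (-(1 / 2048 * (D ^ 2 / t)))
      linarith
    have h4 : C₁ * T * B ≤ (C₄ + C₁) * T * B := by gcongr; linarith
    have h5 : 0 ≤ 4 * ((C₄ + C₁) * T) * B := by positivity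
    have := mul_le_mul_of_nonneg_left h2 h5
    linarith
  · have hDpos : 0 < D := by
      rcases hD0.eq_or_lt with h0 | h0
      · rw [← h0] at hcase
        norm_num at hcase
        linarith
      · exact h0
    have hRD' : (R : ℝ) ≤ 8 * D := by
      rw [max_eq_left hcase.le] at hRD
      exact le_of_sq_le_sq (by linarith) (by positivity)
    have hZ : (D / 2) ^ 2 / (t / 2) = D ^ 2 / t / 2 := by field_simp
    have hZ1 : 1 ≤ D ^ 2 / t := (one_le_div ht).mpr hcase.le
    have hJ := fun v hv => hJ v hv (by positivity) (by linarith) (by rw [hZ]; linarith)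
      (by linarith) (by nlinarith)
    rw [hZ] at hJ
    obtain ⟨Z, hZdef⟩ : ∃ Z, Z = D ^ 2 / t := ⟨_, rfl⟩
    rw [← hZdef] at hJ ⊢
    have h1 := killedKernel_le_of_farMass hw hy hz hcover (by positivity) (hJ y hy) (hJ z hz)
      (hF y hy) (hF z hz)
    rw [htt] at h1
    refine h1.trans ?_
    have h2 : C₄ * (T * B) * Real.exp (-(1 / 512 * (Z / 2))) * (C₁ * T * B) ≤
        ((C₄ + C₁) * T * B * Real.exp (-(1 / 2048 * Z))) ^ 2 := by
      have h3 : Real.exp (-(1 / 2048 * Z)) ^ 2 = Real.exp (-(1 / 512 * (Z / 2))) := by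
        rw [← Real.exp_nat_mul]
        congr 1
        push_cast
        ring
      rw [mul_pow, mul_pow, mul_pow, h3]
      have h4 : C₄ * C₁ ≤ (C₄ + C₁) ^ 2 := by nlinarith
      calc _ = C₄ * C₁ * (T ^ 2 * B ^ 2 * Real.exp (-(1 / 512 * (Z / 2)))) := by ring
        _ ≤ (C₄ + C₁) ^ 2 * (T ^ 2 * B ^ 2 * Real.exp (-(1 / 512 * (Z / 2)))) :=
            mul_le_mul_of_nonneg_right h4 (by positivity)
        _ = _ := by ring
    have h5 := Real.sqrt_le_iff.mpr ⟨by positivity, h2⟩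
    have h7 : 0 ≤ (C₄ + C₁) * T * B * Real.exp (-(1 / 2048 * Z)) := by positivity
    linarith

/-- Bounds for the kernel killed outside `B(x, 2R)`, from near the center to `B(x, 2R) \ B(x, R)`. -/
theorem exists_killedKernel_annulus_le {d γ g C₁ C₂ : ℝ} (hd : 0 ≤ d) (hγ : 0 < γ) (hg : 0 < g)
    (hC₁ : 0 < C₁) (hC₂ : 0 < C₂) :
    ∃ C : ℝ, 0 < C ∧ ∀ (V : Type u) [Infinite V] (G : SimpleGraph V) [G.LocallyFinite],
      G.Connected → ∀ (ω : Conductances G) (x : V) (R : ℕ), 1 ≤ R →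
      OnDiagonalBound ω x (2 * R) d γ g C₁ C₂ → ∀ (y : V) (t : ℝ), 2 * G.dist x y ≤ R →
      (G.dist x y : ℝ) ≤ t → ∀ s : ℝ, 0 ≤ s → s ≤ t → ∀ w ∈ ball G x (2 * R), w ∉ ball G x R →
      killedKernel (conductance ω) (mu ω) (ball G x (2 * R)) y s w ≤
        C * (R : ℝ) ^ (-d) * Real.exp (-(1 / 4096 * ((G.dist x y : ℝ) ^ 2 / t))) := by
  obtain ⟨C₀, hC₀, hgauss⟩ := exists_killedKernel_gaussian.{u} hd hγ hg hC₁ hC₂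
  obtain ⟨C₃, hC₃, hab⟩ := exists_rpow_mul_exp_neg_le (k := γ) (a := 1 / 4096) hγ.le (by norm_num)
  obtain ⟨C₄, hC₄, hab'⟩ := exists_rpow_mul_exp_neg_le (k := g + d) (a := 1 / 16)
    (by linarith) (by norm_num)
  refine ⟨C₀ * (16 ^ γ * C₃) + C₂ * 2 ^ g * C₄, by positivity, ?_⟩
  intro V _ G _ hG ω x R hR hB y t hxy hDt s hs hst w hw hwR
  have hW := isWeight_conductance hG ω
  have hR0 : (0 : ℝ) < R := by exact_mod_cast hR
  set D : ℝ := (G.dist x y : ℝ) with hD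
  have hD0 : 0 ≤ D := Nat.cast_nonneg _
  set D' : ℝ := (G.dist y w : ℝ) with hD'
  have hxy' : 2 * D ≤ R := by rw [hD]; exact_mod_cast hxy
  have hy : y ∈ ball G x (2 * R) := by
    rw [mem_ball G hG]
    omega
  have hD'R : (R : ℝ) / 2 ≤ D' := by
    have h1 : (R : ℝ) ≤ G.dist x w := by
      rw [mem_ball G hG] at hwR
      exact_mod_cast (not_le.mp hwR).le
    have := dist_triangle_real hG x y w
    linarith
  have hDD' : D ≤ D' := by linarith
  have hD'0 : 0 < D' := by linarith
  have hD't : D ^ 2 / t ≤ D := by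
    rcases hD0.eq_or_lt with h0 | h0
    · rw [← h0]; simp
    · rw [div_le_iff₀ (by linarith)]
      nlinarith
  set e : ℝ := Real.exp (-(1 / 4096 * (D ^ 2 / t))) with he
  have he0 : 0 < e := Real.exp_pos _
  -- If `s ≥ D'` the Gaussian bound applies, half of it absorbing the power of `D'²/s` and half
  -- giving `e`, since `D²/t ≤ D'²/s`. If `s < D'`, slope `1/2` gives decay `exp(-D'/4)`, where `D'`
  -- dominates both `R/2` and `D²/t`.
  rcases le_or_gt D' s with hcase | hcase
  · have hs0 : 0 < s := hD'0.trans_le hcase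
    have h1 := hgauss V G hG ω x (2 * R) (by omega) hB y hy w hw s hs0 hcase (by
      push_cast
      refine le_trans ?_ (mul_le_mul_of_nonneg_left (le_max_left _ _) (by norm_num))
      nlinarith)
    refine h1.trans ?_
    push_cast
    set Z : ℝ := D' ^ 2 / s with hZ
    have hZ0 : 0 ≤ Z := by positivity
    have h2 : ((2 * R : ℝ) ^ 2 / s) ^ γ ≤ 16 ^ γ * Z ^ γ := by
      rw [← Real.mul_rpow (by norm_num) hZ0]
      refine Real.rpow_le_rpow (by positivity) ?_ hγ.le
      rw [hZ, ← mul_div_assoc]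
      gcongr
      nlinarith
    have h3 : (2 * R : ℝ) ^ (-d) ≤ (R : ℝ) ^ (-d) :=
      Real.rpow_le_rpow_of_nonpos hR0 (by linarith) (by linarith)
    have h4 : Real.exp (-(1 / 2048 * Z)) ≤ Real.exp (-(1 / 4096 * Z)) * e := by
      rw [he, ← Real.exp_add]
      refine Real.exp_le_exp.mpr ?_
      have h5 : D ^ 2 / t ≤ Z := by
        rw [hZ]
        gcongr
      linarith
    calc _ ≤ C₀ * ((R : ℝ) ^ (-d) * (16 ^ γ * Z ^ γ)) * (Real.exp (-(1 / 4096 * Z)) * e) := by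
          gcongr
      _ = C₀ * (16 ^ γ * (Z ^ γ * Real.exp (-(1 / 4096 * Z)))) * (R : ℝ) ^ (-d) * e := by ring
      _ ≤ C₀ * (16 ^ γ * C₃) * (R : ℝ) ^ (-d) * e := by
          gcongr
          exact hab Z hZ0
      _ ≤ _ := by
          gcongr
          have : 0 ≤ C₂ * 2 ^ g * C₄ := by positivity
          linarith
  · have h1 := killedKernel_le_exp hW hy hw (ρ := fun z => (G.dist y z : ℝ))
      (fun z w h => abs_dist_sub_dist_le hG ω y z w h) (by simp) (lam := 1 / 2) (t := s)
      (by norm_num) hs (hB.inv_mu_le y hy) (hB.inv_mu_le w hw)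
    refine h1.trans ?_
    have h2 := cosh_sub_one_le (x := 1 / 2) (by norm_num) (by norm_num)
    have h3 : Real.exp ((Real.cosh (1 / 2) - 1) * s - 1 / 2 * D') ≤
        Real.exp (-(1 / 16 * R)) * e := by
      rw [he, ← Real.exp_add]
      refine Real.exp_le_exp.mpr ?_
      nlinarith
    push_cast
    have h4 : (R : ℝ) ^ g * Real.exp (-(1 / 16 * R)) ≤ C₄ * (R : ℝ) ^ (-d) := by
      have := hab' R hR0.le
      rw [Real.rpow_add hR0] at this
      rw [Real.rpow_neg hR0.le, ← div_eq_mul_inv, le_div_iff₀ (by positivity)]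
      linarith
    rw [Real.mul_rpow two_pos.le hR0.le]
    calc _ ≤ C₂ * (2 ^ g * (R : ℝ) ^ g) * (Real.exp (-(1 / 16 * R)) * e) := by gcongr
      _ = C₂ * 2 ^ g * ((R : ℝ) ^ g * Real.exp (-(1 / 16 * R))) * e := by ring
      _ ≤ C₂ * 2 ^ g * (C₄ * (R : ℝ) ^ (-d)) * e := by gcongr
      _ = C₂ * 2 ^ g * C₄ * (R : ℝ) ^ (-d) * e := by ring
      _ ≤ _ := by
          gcongr
          have : 0 ≤ C₀ * (16 ^ γ * C₃) := by positivity
          linarith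

/-- Gaussian upper bounds with the correct prefactor, uniformly over the dyadic balls. -/
theorem exists_killedKernel_le_near {d γ g C₁ C₂ : ℝ} (hd : 1 ≤ d) (hγ : 0 < γ) (hg : 0 < g)
    (hC₁ : 0 < C₁) (hC₂ : 0 < C₂) :
    ∃ C : ℝ, 0 < C ∧ ∀ (V : Type u) [Infinite V] (G : SimpleGraph V) [G.LocallyFinite],
      G.Connected → ∀ (ω : Conductances G) (x : V) (t : ℝ), 1 ≤ t →
      (∀ R : ℕ, 1 ≤ R → √t ≤ R → OnDiagonalBound ω x R d γ g C₁ C₂) →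
      ∀ y : V, (G.dist x y : ℝ) ≤ t → ∃ R₀ : ℕ, 1 ≤ R₀ ∧ G.dist x y ≤ R₀ ∧ ∀ k : ℕ,
      killedKernel (conductance ω) (mu ω) (ball G x (2 ^ k * R₀)) y t x ≤
        C * t ^ (-d / 2) * Real.exp (-(1 / 4096 * ((G.dist x y : ℝ) ^ 2 / t))) := by
  obtain ⟨Cg, hCg, hgauss⟩ := exists_killedKernel_gaussian.{u} (zero_le_one.trans hd) hγ hg hC₁ hC₂
  obtain ⟨Ca, hCa, hann⟩ := exists_killedKernel_annulus_le.{u} (zero_le_one.trans hd) hγ hg hC₁ hC₂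
  obtain ⟨C₃, hC₃, hab⟩ := exists_rpow_mul_exp_neg_le (k := γ) (a := 1 / 4096) hγ.le (by norm_num)
  refine ⟨Cg * (64 ^ γ * (C₃ * Real.exp (1 / 4096))) + 2 * Ca, by positivity, ?_⟩
  intro V _ G _ hG ω x t ht hB y hDt
  have hW := isWeight_conductance hG ω
  have ht0 : 0 < t := by linarith
  set D : ℝ := (G.dist x y : ℝ) with hD
  have hD0 : 0 ≤ D := Nat.cast_nonneg _
  have hsq1 : 1 ≤ √t := Real.one_le_sqrt.mpr ht
  have hsqt : √t ^ 2 = t := Real.sq_sqrt ht0.le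
  -- Large enough for the on-diagonal bounds and for `2 d(x,y) ≤ R₀`, yet at most `6 max(d(x,y),
  -- √t)`.
  set R₀ : ℕ := 2 * ⌈√t⌉₊ + 2 * G.dist x y with hR₀
  have hceil1 := Nat.le_ceil √t
  have hceil2 := (Nat.ceil_lt_add_one (Real.sqrt_nonneg t)).le
  have hR₀r : (R₀ : ℝ) = 2 * (⌈√t⌉₊ : ℝ) + 2 * D := by rw [hR₀, hD]; push_cast; ring
  have hR₀t : √t ≤ R₀ := by rw [hR₀r]; linarith
  have hR₀1r : (1 : ℝ) ≤ R₀ := hsq1.trans hR₀t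
  have hR₀1 : 1 ≤ R₀ := by exact_mod_cast hR₀1r
  have hR₀0 : (0 : ℝ) < R₀ := by linarith
  refine ⟨R₀, hR₀1, by omega, fun k => ?_⟩
  have hkR : ∀ k : ℕ, R₀ ≤ 2 ^ k * R₀ := fun k => Nat.le_mul_of_pos_left _ (by positivity)
  have hBk : ∀ k : ℕ, OnDiagonalBound ω x (2 ^ k * R₀) d γ g C₁ C₂ := fun k =>
    hB _ (hR₀1.trans (hkR k)) (hR₀t.trans (by exact_mod_cast hkR k))
  have hyk : ∀ k : ℕ, y ∈ ball G x (2 ^ k * R₀) := fun k => by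
    rw [mem_ball G hG]
    exact le_trans (by omega) (hkR k)
  set e : ℝ := Real.exp (-(1 / 4096 * (D ^ 2 / t))) with he
  have he0 : 0 < e := Real.exp_pos _
  have hRd : (R₀ : ℝ) ^ (-d) ≤ t ^ (-d / 2) := by
    have h1 : t ^ (-d / 2) = √t ^ (-d) := by
      rw [Real.sqrt_eq_rpow, ← Real.rpow_mul ht0.le]
      congr 1
      ring
    rw [h1]
    exact Real.rpow_le_rpow_of_nonpos (by linarith) hR₀t (by linarith)
  -- Each doubling adds the annulus bound at radius `2^k R₀`; since `d ≥ 1`, these contributions are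
  -- dominated by a geometric series of ratio `1/2`.
  have htele : ∀ k : ℕ, killedKernel (conductance ω) (mu ω) (ball G x (2 ^ k * R₀)) y t x ≤
      killedKernel (conductance ω) (mu ω) (ball G x R₀) y t x +
        Ca * (R₀ : ℝ) ^ (-d) * e * (2 - 2 * (1 / 2) ^ k) := by
    intro k
    induction k with
    | zero => simp
    | succ k ih =>
      have hstep : 2 ^ (k + 1) * R₀ = 2 * (2 ^ k * R₀) := by ring
      have h1 := killedKernel_le_add hW (ball_mono hG x (m := 2 ^ k * R₀) (n := 2 ^ (k + 1) * R₀)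
        (by rw [hstep]; omega)) (self_mem_ball G hG x _) (hyk k) ht0.le
        (M := Ca * ((2 ^ k * R₀ : ℕ) : ℝ) ^ (-d) * e) (by positivity) (by
          have hb := hBk (k + 1)
          rw [hstep] at hb ⊢
          exact hann V G hG ω x (2 ^ k * R₀) (hR₀1.trans (hkR k)) hb y t
            (le_trans (by omega) (hkR k)) hDt)
      have h2 : ((2 ^ k * R₀ : ℕ) : ℝ) ^ (-d) ≤ (1 / 2) ^ k * (R₀ : ℝ) ^ (-d) := by
        push_cast
        rw [Real.mul_rpow (by positivity) hR₀0.le]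
        refine mul_le_mul_of_nonneg_right ?_ (by positivity)
        have h3 : ((2 : ℝ) ^ k) ^ (-d) ≤ ((2 : ℝ) ^ k) ^ (-1 : ℝ) :=
          Real.rpow_le_rpow_of_exponent_le (one_le_pow₀ one_le_two) (by linarith)
        refine h3.trans (le_of_eq ?_)
        rw [Real.rpow_neg_one, one_div, inv_pow]
      have h4 : Ca * ((2 ^ k * R₀ : ℕ) : ℝ) ^ (-d) * e ≤ Ca * ((1 / 2) ^ k * (R₀ : ℝ) ^ (-d)) * e := by
        gcongr
      refine h1.trans ((add_le_add ih h4).trans (le_of_eq ?_))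
      rw [pow_succ]
      ring
  have hmain : killedKernel (conductance ω) (mu ω) (ball G x R₀) y t x ≤
      Cg * (64 ^ γ * (C₃ * Real.exp (1 / 4096))) * (R₀ : ℝ) ^ (-d) * e := by
    have hb := hBk 0
    have hy0 := hyk 0
    rw [pow_zero, one_mul] at hb hy0
    have hR₀sq : (R₀ : ℝ) ^ 2 ≤ 64 * max (D ^ 2) t := by
      have h1 : (R₀ : ℝ) ≤ 6 * max D √t := by
        rw [hR₀r]
        have := le_max_left D √t
        have := le_max_right D √t
        linarith
      have h2 : max D √t ^ 2 ≤ max (D ^ 2) t := by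
        rcases max_choice D √t with h | h
        · rw [h]; exact le_max_left _ _
        · rw [h, hsqt]; exact le_max_right _ _
      nlinarith
    have hsym : (G.dist y x : ℝ) = D := by rw [hD, SimpleGraph.dist_comm]
    have h1 := hgauss V G hG ω x R₀ hR₀1 hb y hy0 x (self_mem_ball G hG x R₀) t ht0
      (by rw [hsym]; exact hDt) (by rw [hsym]; exact hR₀sq)
    rw [hsym] at h1
    refine h1.trans ?_
    set Z : ℝ := D ^ 2 / t with hZ
    have hZ0 : 0 ≤ Z := by positivity
    -- The loss is a power of `1 + Z`, absorbed by half of the Gaussian.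
    have h2 : ((R₀ : ℝ) ^ 2 / t) ^ γ ≤ 64 ^ γ * (1 + Z) ^ γ := by
      rw [← Real.mul_rpow (by norm_num) (by positivity)]
      refine Real.rpow_le_rpow (by positivity) ?_ hγ.le
      rw [div_le_iff₀ ht0]
      have h3 : max (D ^ 2) t ≤ (1 + Z) * t := by
        have : Z * t = D ^ 2 := by rw [hZ]; field_simp
        refine max_le ?_ ?_ <;> nlinarith [sq_nonneg D]
      linarith
    have h4 : Real.exp (-(1 / 2048 * Z)) =
        Real.exp (-(1 / 4096 * (1 + Z))) * Real.exp (1 / 4096) * e := by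
      rw [he, ← Real.exp_add, ← Real.exp_add]
      ring_nf
    rw [h4]
    calc _ ≤ Cg * ((R₀ : ℝ) ^ (-d) * (64 ^ γ * (1 + Z) ^ γ)) *
          (Real.exp (-(1 / 4096 * (1 + Z))) * Real.exp (1 / 4096) * e) := by gcongr
      _ = Cg * (64 ^ γ * (((1 + Z) ^ γ * Real.exp (-(1 / 4096 * (1 + Z)))) *
            Real.exp (1 / 4096))) * (R₀ : ℝ) ^ (-d) * e := by ring
      _ ≤ _ := by
          gcongr
          exact hab (1 + Z) (by positivity)
  have h5 : Ca * (R₀ : ℝ) ^ (-d) * e * (2 - 2 * (1 / 2) ^ k) ≤ Ca * (R₀ : ℝ) ^ (-d) * e * 2 := by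
    refine mul_le_mul_of_nonneg_left ?_ (by positivity)
    have : (0 : ℝ) ≤ (1 / 2) ^ k := by positivity
    linarith
  calc _ ≤ _ := htele k
    _ ≤ Cg * (64 ^ γ * (C₃ * Real.exp (1 / 4096))) * (R₀ : ℝ) ^ (-d) * e +
          Ca * (R₀ : ℝ) ^ (-d) * e * 2 := add_le_add hmain h5
    _ = (Cg * (64 ^ γ * (C₃ * Real.exp (1 / 4096))) + 2 * Ca) * (R₀ : ℝ) ^ (-d) * e := by ring
    _ ≤ _ := by gcongr

/-- Bounds of Poisson type when the distance exceeds the time. -/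
theorem exists_killedKernel_le_far {d γ g C₁ C₂ : ℝ} (hd : 0 ≤ d) (hg : 0 < g) (hC₂ : 0 < C₂) :
    ∃ C : ℝ, 0 < C ∧ ∀ (V : Type u) [Infinite V] (G : SimpleGraph V) [G.LocallyFinite],
      G.Connected → ∀ (ω : Conductances G) (x : V) (t : ℝ), 0 < t →
      (∀ R : ℕ, 1 ≤ R → √t ≤ R → OnDiagonalBound ω x R d γ g C₁ C₂) →
      ∀ y : V, t ≤ (G.dist x y : ℝ) → ∀ R : ℕ, G.dist x y ≤ R →
      killedKernel (conductance ω) (mu ω) (ball G x R) x t y ≤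
        C * t ^ (-d / 2) * Real.exp (-(1 / 16 * (G.dist x y : ℝ) *
          max 1 (Real.log ((G.dist x y : ℝ) / t)))) := by
  obtain ⟨C₃, hC₃, hab⟩ := exists_rpow_mul_exp_neg_le (k := g + d / 2) (a := 1 / 16)
    (by linarith) (by norm_num)
  refine ⟨C₂ * C₃, by positivity, ?_⟩
  intro V _ G _ hG ω x t ht hB y htD R hR
  have hW := isWeight_conductance hG ω
  have hD1' : 1 ≤ G.dist x y := by
    have : (0 : ℝ) < G.dist x y := ht.trans_le htD
    exact_mod_cast this
  set D : ℝ := (G.dist x y : ℝ) with hD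
  have hD1 : 1 ≤ D := by rw [hD]; exact_mod_cast hD1'
  have hD0 : 0 < D := by linarith
  have hsq : √t ≤ (G.dist x y : ℝ) := Real.sqrt_le_iff.mpr ⟨hD0.le, by nlinarith⟩
  -- The speed measure is estimated at scale `d(x,y) ≥ √t`, so the bound does not depend on the
  -- killing radius `R`.
  have hb := hB (G.dist x y) hD1' hsq
  set ℓ : ℝ := Real.log (D / t) with hℓ
  have hℓ0 : 0 ≤ ℓ := Real.log_nonneg ((one_le_div ht).mpr htD)
  -- With slope `1 + log(D/t)/2`, `exp(lam) t = e √(D t)`, so the cost is at most `0.86 D` against a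
  -- gain of `D + D log(D/t)/2`.
  have h1 := killedKernel_le_exp hW (A := ball G x R) (self_mem_ball G hG x R)
    ((mem_ball G hG x y R).mpr hR) (ρ := fun z => (G.dist x z : ℝ))
    (fun z w h => abs_dist_sub_dist_le hG ω x z w h) (by simp) (lam := 1 + ℓ / 2) (t := t)
    (by positivity) ht.le (hb.inv_mu_le x (self_mem_ball G hG x _))
    (hb.inv_mu_le y ((mem_ball G hG x y _).mpr le_rfl))
  refine h1.trans ?_
  rw [← hD]
  set v : ℝ := Real.exp (-(ℓ / 2)) with hv
  have hv0 : 0 < v := Real.exp_pos _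
  have hv1 : v ≤ 1 := Real.exp_le_one_iff.mpr (by linarith)
  have hvt : t = D * v ^ 2 := by
    have h2 : v ^ 2 = t / D := by
      rw [hv, ← Real.exp_nat_mul]
      have : ((2 : ℕ) : ℝ) * -(ℓ / 2) = -ℓ := by push_cast; ring
      rw [this, Real.exp_neg, hℓ, Real.exp_log (by positivity), inv_div]
    rw [h2]; field_simp
  have he1 := Real.exp_one_lt_d9
  have he2 := Real.exp_one_gt_d9
  have hcosh : (Real.cosh (1 + ℓ / 2) - 1) * t ≤ 86 / 100 * D := by
    have h2 : Real.exp (1 + ℓ / 2) * v = Real.exp 1 := by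
      rw [hv, ← Real.exp_add]; ring_nf
    have h3 : Real.exp (-(1 + ℓ / 2)) ≤ 1 := Real.exp_le_one_iff.mpr (by linarith)
    have h4 : Real.cosh (1 + ℓ / 2) - 1 ≤ (Real.exp (1 + ℓ / 2) - 1) / 2 := by
      rw [Real.cosh_eq]; linarith
    have h5 : (Real.cosh (1 + ℓ / 2) - 1) * t ≤ D * ((Real.exp 1 * v - v ^ 2) / 2) := by
      refine (mul_le_mul_of_nonneg_right h4 ht.le).trans (le_of_eq ?_)
      rw [hvt, ← h2]
      ring
    refine h5.trans ?_
    have h6 : (Real.exp 1 * v - v ^ 2) / 2 ≤ 86 / 100 := by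
      nlinarith [mul_nonneg (sub_nonneg.mpr hv1) (by linarith : 0 ≤ Real.exp 1 - 1 - v)]
    nlinarith
  set μ : ℝ := max 1 ℓ with hμ
  have hμ1 : 1 ≤ μ := le_max_left _ _
  have hμl : μ ≤ 1 + ℓ := max_le (by linarith) (by linarith)
  have hexp : Real.exp ((Real.cosh (1 + ℓ / 2) - 1) * t - (1 + ℓ / 2) * D) ≤
      Real.exp (-(1 / 16 * D)) * Real.exp (-(1 / 16 * D * μ)) := by
    rw [← Real.exp_add]
    refine Real.exp_le_exp.mpr ?_
    have h2 : D * μ ≤ D * (1 + ℓ) := mul_le_mul_of_nonneg_left hμl hD0.le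
    have h3 : 0 ≤ D * ℓ := by positivity
    linarith
  have hpow : D ^ g * Real.exp (-(1 / 16 * D)) ≤ C₃ * t ^ (-d / 2) := by
    have h2 := hab D hD0.le
    rw [Real.rpow_add hD0] at h2
    have h3 : D ^ (-d / 2) ≤ t ^ (-d / 2) :=
      Real.rpow_le_rpow_of_nonpos ht htD (by linarith)
    have h4 : D ^ (d / 2) * D ^ (-d / 2) = 1 := by
      rw [← Real.rpow_add hD0]
      ring_nf
      exact Real.rpow_zero _
    calc D ^ g * Real.exp (-(1 / 16 * D))
        = (D ^ g * D ^ (d / 2) * Real.exp (-(1 / 16 * D))) * D ^ (-d / 2) := by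
          rw [mul_right_comm (D ^ g), mul_assoc (D ^ g * _), h4, mul_one]
      _ ≤ C₃ * D ^ (-d / 2) := mul_le_mul_of_nonneg_right h2 (by positivity)
      _ ≤ _ := mul_le_mul_of_nonneg_left h3 hC₃.le
  calc _ ≤ C₂ * D ^ g * (Real.exp (-(1 / 16 * D)) * Real.exp (-(1 / 16 * D * μ))) := by gcongr
    _ = C₂ * (D ^ g * Real.exp (-(1 / 16 * D))) * Real.exp (-(1 / 16 * D * μ)) := by ring
    _ ≤ C₂ * (C₃ * t ^ (-d / 2)) * Real.exp (-(1 / 16 * D * μ)) := by gcongr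
    _ = _ := by ring

end Gaussian

/-! ### The number of jumps is dominated by a Poisson law -/

section WaitingTimes

/-- The law of a sequence of independent exponential waiting times with mean `1`. -/
abbrev waitingLaw : Measure (ℕ → ℝ) := Measure.infinitePi fun _ : ℕ => expMeasure 1

instance isProbabilityMeasure_expMeasure_one : IsProbabilityMeasure (expMeasure 1) :=
  isProbabilityMeasure_expMeasure one_pos

/-- The time of the `n`-th jump. -/
def jumpTime (n : ℕ) (τ : ℕ → ℝ) : ℝ := ∑ i ∈ Finset.range n, τ i

theorem measurable_jumpTime (n : ℕ) : Measurable (jumpTime n) := by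
  unfold jumpTime
  fun_prop

theorem jumpTime_succ (n : ℕ) (τ : ℕ → ℝ) : jumpTime (n + 1) τ = jumpTime n τ + τ n :=
  Finset.sum_range_succ _ _

/-- The time of the `n`-th jump involves only the waiting times before index `n`, hence is
independent of `τ n`. -/
theorem lintegral_jumpTime_prod (n : ℕ) {F : ℝ → ℝ → ℝ≥0∞} (hF : Measurable (Function.uncurry F)) :
    ∫⁻ τ, F (jumpTime n τ) (τ n) ∂waitingLaw =
      ∫⁻ τ, ∫⁻ r, F (jumpTime n τ) r ∂(expMeasure 1) ∂waitingLaw := by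
  have hind : iIndepFun (fun (i : ℕ) (τ : ℕ → ℝ) => τ i) waitingLaw :=
    iIndepFun_infinitePi (X := fun _ x => x) (fun _ => measurable_id)
  have h1 : IndepFun (jumpTime n) (fun τ : ℕ → ℝ => τ n) waitingLaw := by
    have := hind.indepFun_sum_range_succ (fun i => measurable_pi_apply i) n
    convert this using 1
    ext τ
    simp [jumpTime]
  have h2 := (indepFun_iff_map_prod_eq_prod_map_map (measurable_jumpTime n).aemeasurable
    (measurable_pi_apply n).aemeasurable).mp h1
  have h3 : waitingLaw.map (fun τ : ℕ → ℝ => τ n) = expMeasure 1 :=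
    Measure.infinitePi_map_eval (fun _ : ℕ => expMeasure 1) n
  have h4 : ∫⁻ τ, F (jumpTime n τ) (τ n) ∂waitingLaw =
      ∫⁻ p, Function.uncurry F p ∂(waitingLaw.map fun τ => (jumpTime n τ, τ n)) := by
    rw [lintegral_map hF ((measurable_jumpTime n).prodMk (measurable_pi_apply n))]
    rfl
  rw [h4, h2, h3, lintegral_prod _ hF.aemeasurable,
    lintegral_map hF.lintegral_prod_right' (measurable_jumpTime n)]
  rfl

/-- The probability that a unit rate Poisson process has exactly `k` points in `(s, t]`. -/
def poissonWeight (k : ℕ) (t s : ℝ) : ℝ≥0∞ :=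
  if s ≤ t then ENNReal.ofReal ((t - s) ^ k / k.factorial * Real.exp (-(t - s))) else 0

theorem measurable_poissonWeight (k : ℕ) (t : ℝ) : Measurable (poissonWeight k t) := by
  unfold poissonWeight
  exact Measurable.ite measurableSet_Iic (by fun_prop) measurable_const

/-- Convolution with the exponential density integrates `(a - r)^k / k!` and so raises the Poisson
index by one. -/
theorem lintegral_poissonWeight_le (k : ℕ) (t s : ℝ) :
    ∫⁻ r, poissonWeight k t (s + r) ∂(expMeasure 1) ≤ poissonWeight (k + 1) t s := by
  have h0 : ∫⁻ r, poissonWeight k t (s + r) ∂(expMeasure 1) =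
      ∫⁻ r, exponentialPDF 1 r * poissonWeight k t (s + r) := by
    have : expMeasure 1 = volume.withDensity (exponentialPDF 1) := rfl
    rw [this, lintegral_withDensity_eq_lintegral_mul₀]
    · rfl
    · exact ((measurable_exponentialPDFReal 1).ennreal_ofReal).aemeasurable
    · exact ((measurable_poissonWeight k t).comp (measurable_const_add s)).aemeasurable
  rw [h0]
  by_cases hst : s ≤ t
  · set a : ℝ := t - s with ha
    have ha0 : 0 ≤ a := sub_nonneg.mpr hst
    -- The value `∞` on the null set `{0}` is free and allows integration over `Ioc 0 a`.
    have h1 : ∀ r, exponentialPDF 1 r * poissonWeight k t (s + r) ≤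
        (Set.Ioc 0 a).indicator
          (fun r => ENNReal.ofReal (Real.exp (-a) / k.factorial * (a - r) ^ k)) r +
        ({0} : Set ℝ).indicator (fun _ => ∞) r := by
      intro r
      rcases lt_trichotomy r 0 with hr | hr | hr
      · rw [exponentialPDF_of_neg hr, zero_mul]
        exact zero_le
      · rw [hr, Set.indicator_of_mem (s := ({0} : Set ℝ)) (Set.mem_singleton 0), add_top]
        exact le_top
      · refine le_add_of_le_of_nonneg ?_ zero_le
        rw [exponentialPDF_of_nonneg hr.le, poissonWeight]
        split_ifs with h
        · have hmem : r ∈ Set.Ioc 0 a := ⟨hr, by rw [ha]; linarith⟩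
          rw [Set.indicator_of_mem hmem, ← ENNReal.ofReal_mul (by positivity)]
          refine le_of_eq (congrArg ENNReal.ofReal ?_)
          have h2 : t - (s + r) = a - r := by rw [ha]; ring
          have h3 : Real.exp (-a) = Real.exp (-r) * Real.exp (-(a - r)) := by
            rw [← Real.exp_add]; ring_nf
          rw [h2, h3, one_mul, one_mul]
          ring
        · rw [mul_zero]
          exact zero_le
    have h4 : ∫⁻ r, ({0} : Set ℝ).indicator (fun _ => (∞ : ℝ≥0∞)) r = 0 := by
      rw [lintegral_indicator (measurableSet_singleton 0)]
      simp
    refine (lintegral_mono h1).trans ?_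
    rw [lintegral_add_right _ (measurable_const.indicator (measurableSet_singleton 0)), h4, add_zero,
      lintegral_indicator measurableSet_Ioc, poissonWeight, if_pos hst]
    have hcont : Continuous fun r : ℝ => Real.exp (-a) / k.factorial * (a - r) ^ k := by fun_prop
    rw [← ofReal_integral_eq_lintegral_ofReal]
    · refine ENNReal.ofReal_le_ofReal (le_of_eq ?_)
      rw [← intervalIntegral.integral_of_le ha0, intervalIntegral.integral_const_mul,
        intervalIntegral.integral_comp_sub_left (fun r => r ^ k) a, integral_pow, Nat.factorial_succ]
      push_cast
      simp only [sub_self, sub_zero, ne_eq, Nat.add_eq_zero_iff, one_ne_zero, and_false,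
        not_false_eq_true, zero_pow]
      have h5 : ((k : ℝ) + 1) ≠ 0 := by positivity
      have h6 : (k.factorial : ℝ) ≠ 0 := by positivity
      field_simp
      rw [ha]
      ring
    · exact (hcont.integrableOn_Icc).mono_set Set.Ioc_subset_Icc_self
    · refine (ae_restrict_iff' measurableSet_Ioc).mpr (Eventually.of_forall fun r hr => ?_)
      have : 0 ≤ a - r := by linarith [hr.2]
      exact mul_nonneg (by positivity) (pow_nonneg this k)
  · have h1 : ∀ r, exponentialPDF 1 r * poissonWeight k t (s + r) = 0 := by
      intro r
      rcases lt_or_ge r 0 with hr | hr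
      · rw [exponentialPDF_of_neg hr, zero_mul]
      · rw [poissonWeight, if_neg (by linarith), mul_zero]
    simp [h1]

theorem lintegral_poissonWeight_jumpTime_le (n k : ℕ) (t : ℝ) :
    ∫⁻ τ, poissonWeight k t (jumpTime n τ) ∂waitingLaw ≤ poissonWeight (k + n) t 0 := by
  induction n generalizing k with
  | zero => simp [jumpTime]
  | succ n ih =>
    simp_rw [jumpTime_succ]
    rw [lintegral_jumpTime_prod n (F := fun s r => poissonWeight k t (s + r))
      ((measurable_poissonWeight k t).comp (measurable_fst.add measurable_snd))]
    refine (lintegral_mono fun τ => lintegral_poissonWeight_le k t (jumpTime n τ)).trans ?_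
    refine (ih (k + 1)).trans (le_of_eq ?_)
    congr 1
    ring

theorem expMeasure_one_Ioi {a : ℝ} (ha : 0 ≤ a) :
    expMeasure 1 (Set.Ioi a) = ENNReal.ofReal (Real.exp (-a)) := by
  rw [← Set.compl_Iic, prob_compl_eq_one_sub measurableSet_Iic, ← ofReal_cdf,
    cdf_expMeasure_eq one_pos, if_pos ha, ← ENNReal.ofReal_one, ← ENNReal.ofReal_sub]
  · simp
  · have : Real.exp (-(1 * a)) ≤ 1 := Real.exp_le_one_iff.mpr (by linarith)
    linarith

theorem waitingLaw_jumpTime_le_lt (n : ℕ) (t : ℝ) :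
    waitingLaw {τ | jumpTime n τ ≤ t ∧ t < jumpTime (n + 1) τ} ≤ poissonWeight n t 0 := by
  set F : ℝ → ℝ → ℝ≥0∞ := fun s r =>
    ({p : ℝ × ℝ | p.1 ≤ t ∧ t < p.1 + p.2}).indicator (fun _ => 1) (s, r) with hF
  have hset : MeasurableSet {p : ℝ × ℝ | p.1 ≤ t ∧ t < p.1 + p.2} :=
    (measurableSet_le measurable_fst measurable_const).inter
      (measurableSet_lt measurable_const (measurable_fst.add measurable_snd))
  have hFm : Measurable (Function.uncurry F) := measurable_const.indicator hset
  have hs : MeasurableSet {τ : ℕ → ℝ | jumpTime n τ ≤ t ∧ t < jumpTime (n + 1) τ} :=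
    (measurableSet_le (measurable_jumpTime n) measurable_const).inter
      (measurableSet_lt measurable_const (measurable_jumpTime (n + 1)))
  have h1 : waitingLaw {τ | jumpTime n τ ≤ t ∧ t < jumpTime (n + 1) τ} =
      ∫⁻ τ, F (jumpTime n τ) (τ n) ∂waitingLaw := by
    rw [← lintegral_indicator_one hs]
    refine lintegral_congr fun τ => ?_
    simp only [hF, Set.indicator, Set.mem_ofPred_eq, jumpTime_succ, Pi.one_apply]
  rw [h1, lintegral_jumpTime_prod n hFm]
  have h2 : ∀ s, ∫⁻ r, F s r ∂(expMeasure 1) ≤ poissonWeight 0 t s := by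
    intro s
    rw [poissonWeight]
    split_ifs with h
    · have h3 : ∀ r, F s r = (Set.Ioi (t - s)).indicator 1 r := by
        intro r
        simp only [hF, Set.indicator, Set.mem_ofPred_eq, Set.mem_Ioi, sub_lt_iff_lt_add', h, true_and,
          Pi.one_apply]
      simp_rw [h3]
      rw [lintegral_indicator_one measurableSet_Ioi, expMeasure_one_Ioi (sub_nonneg.mpr h)]
      simp
    · have h3 : ∀ r, F s r = 0 := by
        intro r
        simp only [hF, Set.indicator, Set.mem_ofPred_eq, h, false_and, if_false]
      simp [h3]
  refine (lintegral_mono fun τ => h2 (jumpTime n τ)).trans ?_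
  simpa using lintegral_poissonWeight_jumpTime_le n 0 t

theorem ae_waiting_nonneg : ∀ᵐ τ ∂waitingLaw, ∀ i, 0 ≤ τ i := by
  rw [ae_all_iff]
  intro i
  have h3 : waitingLaw.map (fun τ : ℕ → ℝ => τ i) = expMeasure 1 :=
    Measure.infinitePi_map_eval (fun _ : ℕ => expMeasure 1) i
  have h4 : ∀ᵐ r ∂(waitingLaw.map (fun τ : ℕ → ℝ => τ i)), 0 ≤ r := by
    rw [h3, ae_iff]
    have h5 : {a : ℝ | ¬ 0 ≤ a} ⊆ (Set.Ioi 0)ᶜ := fun a ha => by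
      simp only [Set.mem_ofPred_eq, not_le] at ha
      simp [ha.le]
    refine measure_mono_null h5 ?_
    rw [prob_compl_eq_one_sub measurableSet_Ioi, expMeasure_one_Ioi le_rfl]
    simp
  exact ae_of_ae_map (measurable_pi_apply i).aemeasurable h4

/-- No explosion: if every jump time lies in `[0, t]`, the Poisson weight of index `0` there is at
least `exp(-t)`, whereas its integral at the `n`-th jump is at most `exp(-t) t^n / n!`. -/
theorem ae_exists_lt_jumpTime (t : ℝ) : ∀ᵐ τ ∂waitingLaw, ∃ n, t < jumpTime n τ := by
  rcases lt_or_ge t 0 with ht | ht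
  · exact Eventually.of_forall fun τ => ⟨0, by simpa [jumpTime] using ht⟩
  have hlim : Tendsto (fun n : ℕ => ENNReal.ofReal (t ^ n / n.factorial)) atTop (nhds 0) := by
    rw [← ENNReal.ofReal_zero]
    exact ENNReal.tendsto_ofReal (FloorSemiring.tendsto_pow_div_factorial_atTop t)
  have hbound : ∀ n, waitingLaw {τ | ∀ k, 0 ≤ jumpTime k τ ∧ jumpTime k τ ≤ t} ≤
      ENNReal.ofReal (t ^ n / n.factorial) := by
    intro n
    have h1 := lintegral_poissonWeight_jumpTime_le n 0 t
    rw [zero_add, poissonWeight, if_pos ht, sub_zero, ENNReal.ofReal_mul (by positivity)] at h1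
    have hms : MeasurableSet {τ : ℕ → ℝ | ∀ k, 0 ≤ jumpTime k τ ∧ jumpTime k τ ≤ t} := by
      simp only [Set.ofPred_forall]
      exact MeasurableSet.iInter fun k => (measurableSet_le measurable_const
        (measurable_jumpTime k)).inter (measurableSet_le (measurable_jumpTime k) measurable_const)
    have h2 : ENNReal.ofReal (Real.exp (-t)) *
        waitingLaw {τ | ∀ k, 0 ≤ jumpTime k τ ∧ jumpTime k τ ≤ t} ≤
        ∫⁻ τ, poissonWeight 0 t (jumpTime n τ) ∂waitingLaw := by
      rw [← lintegral_indicator_const hms]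
      refine lintegral_mono fun τ => ?_
      by_cases hτ : τ ∈ {τ : ℕ → ℝ | ∀ k, 0 ≤ jumpTime k τ ∧ jumpTime k τ ≤ t}
      swap
      · rw [Set.indicator_of_notMem hτ]
        exact zero_le
      rw [Set.indicator_of_mem hτ]
      rw [poissonWeight, if_pos (hτ n).2]
      refine ENNReal.ofReal_le_ofReal ?_
      simp only [pow_zero, Nat.factorial_zero, Nat.cast_one, div_one, one_mul]
      refine Real.exp_le_exp.mpr ?_
      linarith [(hτ n).1]
    have h3 := h2.trans h1
    rw [mul_comm] at h3
    refine (ENNReal.mul_le_mul_iff_left ?_ ENNReal.ofReal_ne_top).mp h3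
    exact (ENNReal.ofReal_pos.mpr (Real.exp_pos _)).ne'
  have h0 : waitingLaw {τ | ∀ k, 0 ≤ jumpTime k τ ∧ jumpTime k τ ≤ t} = 0 :=
    le_antisymm (ge_of_tendsto' hlim hbound) zero_le
  have h1 : ∀ᵐ τ ∂waitingLaw, ¬ ∀ k, 0 ≤ jumpTime k τ ∧ jumpTime k τ ≤ t := by
    rw [ae_iff]
    simpa using h0
  filter_upwards [h1, ae_waiting_nonneg] with τ hτ hτ0
  by_contra hcon
  push Not at hcon
  exact hτ fun k => ⟨Finset.sum_nonneg fun i _ => hτ0 i, hcon k⟩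

/-- With nonnegative waits and no explosion the counted set is a finite initial segment. For an
infinite set `ncard` would be `0`, hence the hypothesis `hex`. -/
theorem jumpTime_le_of_jumpCount_eq {t : ℝ} (ht : 0 ≤ t) {τ : ℕ → ℝ} (hτ : ∀ i, 0 ≤ τ i)
    (hex : ∃ n, t < jumpTime n τ) :
    jumpTime (jumpCount t τ) τ ≤ t ∧ t < jumpTime (jumpCount t τ + 1) τ := by
  classical
  have hmono : Monotone fun n => jumpTime n τ :=
    monotone_nat_of_le_succ fun n => by rw [jumpTime_succ]; linarith [hτ n]
  have hex' : ∃ n, t < jumpTime (n + 1) τ := by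
    obtain ⟨n, hn⟩ := hex
    exact ⟨n, hn.trans_le (hmono n.le_succ)⟩
  have hset : {k : ℕ | ∑ i ∈ Finset.range (k + 1), τ i ≤ t} =
      (Finset.range (Nat.find hex') : Set ℕ) := by
    ext k
    simp only [Set.mem_ofPred_eq, Finset.coe_range, Set.mem_Iio]
    constructor
    · intro hk
      by_contra hcon
      push Not at hcon
      have := Nat.find_spec hex'
      have h2 := hmono (Nat.succ_le_succ hcon)
      simp only [Nat.succ_eq_add_one] at h2
      change jumpTime (k + 1) τ ≤ t at hk
      linarith
    · intro hk
      exact not_lt.mp (Nat.find_min hex' hk)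
  have hcount : jumpCount t τ = Nat.find hex' := by
    rw [jumpCount, hset, Set.ncard_coe_finset, Finset.card_range]
  rw [hcount]
  refine ⟨?_, Nat.find_spec hex'⟩
  rcases Nat.eq_zero_or_pos (Nat.find hex') with h0 | h0
  · rw [h0]
    simpa [jumpTime] using ht
  · have := Nat.find_min hex' (Nat.sub_lt h0 one_pos)
    rw [show Nat.find hex' - 1 + 1 = Nat.find hex' by omega] at this
    exact not_lt.mp this

theorem waitingLaw_jumpCount_eq_le {t : ℝ} (ht : 0 ≤ t) (n : ℕ) :
    waitingLaw {τ | jumpCount t τ = n} ≤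
      ENNReal.ofReal (t ^ n / n.factorial * Real.exp (-t)) := by
  have h1 := waitingLaw_jumpTime_le_lt n t
  rw [poissonWeight, if_pos ht, sub_zero] at h1
  refine le_trans (measure_mono_ae ?_) h1
  filter_upwards [ae_waiting_nonneg, ae_exists_lt_jumpTime t] with τ hτ hex hcount
  have hcount : jumpCount t τ = n := hcount
  have := jumpTime_le_of_jumpCount_eq ht hτ hex
  rw [hcount] at this
  exact this

end WaitingTimes

/-! ### The jump chain and the killed iterates -/

section Chain

variable {V : Type*} {G : SimpleGraph V} [G.LocallyFinite] [MeasurableSpace V]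
  [DiscreteMeasurableSpace V]

/-- The law of the sequence of successive positions of the walk. -/
abbrev chainLaw (ω : Conductances G) (x : V) : Measure (ℕ → V) :=
  Kernel.trajMeasure (X := fun _ : ℕ => V) (Measure.dirac x) (jumpKernel ω)

theorem measurableSet_eval_eq (n : ℕ) (y : V) : MeasurableSet {z : ℕ → V | z n = y} :=
  (measurable_pi_apply (X := fun _ : ℕ => V) n) (MeasurableSet.of_discrete (s := ({y} : Set V)))

theorem chainLaw_zero (ω : Conductances G) {x y : V} (h : y ≠ x) :
    chainLaw ω x {z | z 0 = y} = 0 := by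
  have h0 : (chainLaw ω x).map (Preorder.frestrictLe (π := fun _ : ℕ => V) 0) =
      (Measure.dirac x).map (MeasurableEquiv.piUnique fun _ : Finset.Iic 0 => V).symm := by
    rw [chainLaw, Kernel.trajMeasure, Measure.map_comp _ _ (by fun_prop),
      Kernel.traj_map_frestrictLe, Kernel.partialTraj_self, Measure.id_comp]
  have hset : MeasurableSet {z : (Π _ : Finset.Iic 0, V) | z ⟨0, Finset.mem_Iic.mpr le_rfl⟩ = y} :=
    (measurable_pi_apply (X := fun _ : Finset.Iic 0 => V) _)
      (MeasurableSet.of_discrete (s := ({y} : Set V)))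
  have h1 := congrArg (fun μ => μ {z | z ⟨0, Finset.mem_Iic.mpr le_rfl⟩ = y}) h0
  beta_reduce at h1
  rw [Measure.map_apply (by fun_prop) hset,
    Measure.map_dirac' (MeasurableEquiv.piUnique fun _ : Finset.Iic 0 => V).symm.measurable,
    Measure.dirac_apply' _ hset] at h1
  refine Eq.trans h1 (Set.indicator_of_notMem ?_ _)
  exact fun h2 => h h2.symm

theorem jumpLaw_singleton [Infinite V] (hG : G.Connected) (ω : Conductances G) (w y : V) :
    jumpLaw ω w {y} = ENNReal.ofReal (conductance ω w y / mu ω w) := by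
  classical
  have hw := ((isWeight_conductance hG ω).pos w).ne'
  rw [jumpLaw, if_neg hw, Measure.finsetSum_apply]
  simp only [Measure.smul_apply, smul_eq_mul]
  by_cases h : G.Adj w y
  · rw [Finset.sum_eq_single_of_mem y ((G.mem_neighborFinset w y).mpr h)]
    · simp
    · intro b _ hb
      simp [hb]
  · rw [conductance_of_not_adj ω h, zero_div, ENNReal.ofReal_zero]
    refine Finset.sum_eq_zero fun b hb => ?_
    have : b ≠ y := by
      rintro rfl
      exact h ((G.mem_neighborFinset w b).mp hb)
    simp [this]

theorem chainLaw_succ [Infinite V] (hG : G.Connected) (ω : Conductances G) (x y : V) (n : ℕ) :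
    chainLaw ω x {z | z (n + 1) = y} = ∑ w ∈ G.neighborFinset y,
      chainLaw ω x {z | z n = w} * ENNReal.ofReal (conductance ω w y / mu ω w) := by
  classical
  have h1 := Kernel.map_frestrictLe_trajMeasure_compProd_eq_map_trajMeasure
    (X := fun _ : ℕ => V) (μ₀ := Measure.dirac x) (κ := jumpKernel ω) (a := n)
  have hmy : MeasurableSet ({y} : Set V) := MeasurableSet.of_discrete
  have hset : MeasurableSet (Set.univ ×ˢ ({y} : Set V) :
      Set ((Π _ : Finset.Iic n, V) × V)) := MeasurableSet.univ.prod hmy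
  have h2 := congrArg (fun μ => μ (Set.univ ×ˢ ({y} : Set V))) h1
  beta_reduce at h2
  rw [Measure.map_apply (by fun_prop) hset, Measure.compProd_apply_prod MeasurableSet.univ hmy,
    Measure.restrict_univ, lintegral_map (Kernel.measurable_coe _ hmy) (by fun_prop)] at h2
  have h3 : (fun z : ℕ → V => (Preorder.frestrictLe (π := fun _ => V) n z, z (n + 1))) ⁻¹'
      (Set.univ ×ˢ ({y} : Set V)) = {z | z (n + 1) = y} := by
    ext z
    simp
  rw [h3] at h2
  change _ = chainLaw ω x {z | z (n + 1) = y} at h2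
  rw [← h2]
  have h4 : ∀ z : ℕ → V, jumpKernel ω n (Preorder.frestrictLe (π := fun _ => V) n z) {y} =
      ∑ w ∈ G.neighborFinset y, ({z : ℕ → V | z n = w}).indicator
        (fun _ => ENNReal.ofReal (conductance ω w y / mu ω w)) z := by
    intro z
    have h5 : jumpKernel ω n (Preorder.frestrictLe (π := fun _ => V) n z) = jumpLaw ω (z n) := rfl
    rw [h5, jumpLaw_singleton hG]
    simp only [Set.indicator, Set.mem_ofPred_eq]
    rw [Finset.sum_ite_eq]
    split_ifs with h
    · rfl
    · rw [conductance_of_not_adj ω, zero_div, ENNReal.ofReal_zero]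
      intro h'
      exact h ((G.mem_neighborFinset y (z n)).mpr h'.symm)
  simp_rw [h4]
  rw [lintegral_finsetSum]
  · refine Finset.sum_congr rfl fun w _ => ?_
    rw [lintegral_indicator_const (measurableSet_eval_eq n w), mul_comm]
  · intro w _
    exact measurable_const.indicator (measurableSet_eval_eq n w)

theorem chainLaw_eq_zero_of_notMem_ball [Infinite V] (hG : G.Connected) (ω : Conductances G) (x : V)
    (n : ℕ) {y : V} (hy : y ∉ ball G x n) : chainLaw ω x {z | z n = y} = 0 := by
  induction n generalizing y with
  | zero =>
    refine chainLaw_zero ω ?_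
    rintro rfl
    exact hy (self_mem_ball G hG y 0)
  | succ n ih =>
    rw [chainLaw_succ hG]
    refine Finset.sum_eq_zero fun w hw => ?_
    rw [ih, zero_mul]
    rw [mem_ball G hG] at hy ⊢
    rw [SimpleGraph.mem_neighborFinset] at hw
    have := hG.dist_triangle (u := x) (v := w) (w := y)
    rw [SimpleGraph.dist_eq_one_iff_adj.mpr hw.symm] at this
    omega

/-- Within `n ≤ R` jumps the walk stays in the ball, so killing is not felt. Symmetry of the
conductances matches the forward recursion of the law with the recursion for its density. -/
theorem chainLaw_le_killedIter [Infinite V] (hG : G.Connected) (ω : Conductances G) (x : V) {R : ℕ}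
    (n : ℕ) (hn : n ≤ R) (y : V) :
    chainLaw ω x {z | z n = y} ≤
      ENNReal.ofReal (mu ω y * killedIter (conductance ω) (mu ω) (ball G x R) x n y) := by
  classical
  have hw := isWeight_conductance hG ω
  induction n generalizing y with
  | zero =>
    by_cases h : y = x
    · subst h
      rw [killedIter, if_pos rfl, mul_inv_cancel₀ (hw.pos y).ne', ENNReal.ofReal_one]
      exact prob_le_one
    · rw [chainLaw_zero ω h]
      exact zero_le
  | succ n ih =>
    by_cases hy : y ∈ ball G x R
    · rw [chainLaw_succ hG, killedIter, if_pos hy, mul_div_cancel₀ _ (hw.pos y).ne',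
        ← sum_neighborFinset_eq (G := G) (y := y) (fun z hz => conductance_of_not_adj ω hz)
          (fun z hz => killedIter_of_notMem (self_mem_ball G hG x R) n hz),
        ENNReal.ofReal_sum_of_nonneg fun w _ =>
          mul_nonneg (conductance_nonneg ω _ _) (killedIter_nonneg hw n w)]
      refine Finset.sum_le_sum fun w _ => ?_
      refine (mul_le_mul_left (ih (by omega) w) _).trans (le_of_eq ?_)
      rw [← ENNReal.ofReal_mul (mul_nonneg (hw.pos w).le (killedIter_nonneg hw n w))]
      congr 1
      have := (hw.pos w).ne'
      rw [conductance_symm ω w y]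
      field_simp
    · rw [chainLaw_eq_zero_of_notMem_ball hG ω x (n + 1) fun h => hy (ball_mono hG x hn h)]
      exact zero_le

/-- Decompose by the number of jumps. A partial sum over `n < N` is bounded by the kernel of any
ball of radius `R ≥ N`, so arbitrarily large radii suffice. Only countable subadditivity is used,
and no measurability of the walk. -/
theorem heatKernel_le_of_killedKernel_le [Infinite V] (hG : G.Connected) (ω : Conductances G)
    {x y : V} {t B : ℝ} (ht : 0 ≤ t)
    (hB : ∀ N : ℕ, ∃ R : ℕ, N ≤ R ∧
      killedKernel (conductance ω) (mu ω) (ball G x R) x t y ≤ B) :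
    heatKernel ω t x y ≤ B := by
  have hw := isWeight_conductance hG ω
  have hμ := hw.pos y
  have hB0 : 0 ≤ B := by
    obtain ⟨R, _, hR⟩ := hB 0
    exact (killedKernel_nonneg hw ht y).trans hR
  have h1 : walkLaw ω x {s | walk t s = y} ≤
      ∑' n : ℕ, chainLaw ω x {z | z n = y} * waitingLaw {τ | jumpCount t τ = n} := by
    have hsub : {s : (ℕ → V) × (ℕ → ℝ) | walk t s = y} ⊆
        ⋃ n : ℕ, {z : ℕ → V | z n = y} ×ˢ {τ : ℕ → ℝ | jumpCount t τ = n} := fun s hs =>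
      Set.mem_iUnion.mpr ⟨jumpCount t s.2, hs, rfl⟩
    refine (measure_mono hsub).trans ((measure_iUnion_le _).trans (le_of_eq ?_))
    refine tsum_congr fun n => ?_
    exact Measure.prod_prod _ _
  have h2 : ∑' n : ℕ, chainLaw ω x {z | z n = y} * waitingLaw {τ | jumpCount t τ = n} ≤
      ENNReal.ofReal (mu ω y * B) := by
    refine ENNReal.tsum_le_of_sum_range_le fun N => ?_
    obtain ⟨R, hNR, hR⟩ := hB N
    calc _ ≤ ∑ n ∈ Finset.range N,
          ENNReal.ofReal (mu ω y * killedIter (conductance ω) (mu ω) (ball G x R) x n y) *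
            ENNReal.ofReal (t ^ n / n.factorial * Real.exp (-t)) := by
          refine Finset.sum_le_sum fun n hn => mul_le_mul' ?_ (waitingLaw_jumpCount_eq_le ht n)
          exact chainLaw_le_killedIter hG ω x n ((Finset.mem_range.mp hn).le.trans hNR) y
      _ = ENNReal.ofReal (mu ω y * (Real.exp (-t) * ∑ n ∈ Finset.range N, t ^ n / n.factorial *
            killedIter (conductance ω) (mu ω) (ball G x R) x n y)) := by
          rw [Finset.mul_sum, Finset.mul_sum, ENNReal.ofReal_sum_of_nonneg]
          · refine Finset.sum_congr rfl fun n _ => ?_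
            rw [← ENNReal.ofReal_mul (mul_nonneg hμ.le (killedIter_nonneg hw n y))]
            congr 1
            ring
          · intro n _
            have := killedIter_nonneg (A := ball G x R) (y := x) hw n y
            positivity
      _ ≤ ENNReal.ofReal (mu ω y * B) := by
          refine ENNReal.ofReal_le_ofReal (mul_le_mul_of_nonneg_left (le_trans ?_ hR) hμ.le)
          refine mul_le_mul_of_nonneg_left ?_ (Real.exp_pos _).le
          refine (summable_killedIter hw (self_mem_ball G hG x R) t y).sum_le_tsum _ fun n _ => ?_
          exact mul_nonneg (by positivity) (killedIter_nonneg hw n y)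
  rw [heatKernel, div_le_iff₀ hμ, mul_comm]
  exact ENNReal.toReal_le_of_le_ofReal (by positivity) (h1.trans h2)

end Chain

/-! ### Positivity of time and the trivial diagonal bound -/

section Conclusion

variable {V : Type*} {G : SimpleGraph V} [G.LocallyFinite]

/-- At `n = 0` the upper volume bound would be `0`, but the ball contains its centre. This forces `t
> 0` in the theorem. -/
theorem pos_of_volumeRegular {d C : ℝ} (hd : d ≠ 0) (hG : G.Connected) {N₁ : V → ℝ}
    (h : VolumeRegular G d C N₁) (x : V) : 0 < N₁ x := by
  by_contra hcon
  have h1 := (h x 0 (by push_cast; linarith)).2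
  rw [Nat.cast_zero, Real.zero_rpow hd, mul_zero] at h1
  have h2 : 0 < (ball G x 0).card := Finset.card_pos.mpr ⟨x, self_mem_ball G hG x 0⟩
  have h3 : (0 : ℝ) < (ball G x 0).card := Nat.cast_pos.mpr h2
  linarith

theorem killedKernel_self_le {c : V → V → ℝ} {m : V → ℝ} {A : Finset V} (h : IsWeight c m) {x : V}
    (hx : x ∈ A) {t : ℝ} (ht : 0 ≤ t) : killedKernel c m A x t x ≤ (m x)⁻¹ := by
  have := killedKernel_le_exp (ρ := fun _ => 0) h hx hx (by simp) rfl (lam := 0) le_rfl ht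
    le_rfl le_rfl
  simpa using this

end Conclusion

end WeightedGraph

end

theorem theorem1p4 (d d' Creg CS : ℝ) (hd : 2 ≤ d) (hd' : d ≤ d') (hCreg : 0 < Creg) (hCS : 0 < CS)
    (p q : ℝ≥0∞) (hp : 1 < p) (hq : 1 < q) (hpq : p⁻¹ + q⁻¹ < ENNReal.ofReal (2 / d'))
    (Mμ Mν : ℝ≥0) :
    ∃ c₁ c₂ c₃ c₄ : ℝ, 0 < c₁ ∧ 0 < c₂ ∧ 0 < c₃ ∧ 0 < c₄ ∧
      ∀ (V : Type*) [Infinite V] [MeasurableSpace V] [DiscreteMeasurableSpace V]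
        (G : SimpleGraph V) [G.LocallyFinite], G.Connected →
      ∀ N₁ N₂ : V → ℝ, VolumeRegular G d Creg N₁ → LocalSobolev G d d' CS N₂ →
      ∀ ω : Conductances G,
        (⨆ x, limsupAvg G p (mu ω) x) ≤ Mμ → (⨆ x, limsupAvg G q (nu ω) x) ≤ Mν →
      ∀ N : V → ℝ, AvgControlled G p (mu ω) N → AvgControlled G q (nu ω) N →
      ∀ (t : ℝ) (x : V), max (N x) (2 * max (N₁ x) (N₂ x)) ≤ √t →
      ∀ y : V,
        ((G.dist x y : ℝ) ≤ c₁ * t →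
          heatKernel ω t x y ≤
            c₂ * t ^ (-d / 2) * Real.exp (-c₃ * (G.dist x y : ℝ) ^ 2 / t)) ∧
        (c₁ * t ≤ (G.dist x y : ℝ) →
          heatKernel ω t x y ≤
            c₂ * t ^ (-d / 2) *
              Real.exp (-c₄ * (G.dist x y : ℝ) *
                max 1 (Real.log ((G.dist x y : ℝ) / t)))) := by
  obtain ⟨γ, g, C₁, C₂, hγ, hg, hC₁, hC₂, hbound⟩ :=
    exists_onDiagonalBound hd hd' hCreg hCS hp hq hpq Mμ Mν
  obtain ⟨Cn, hCn, hnear⟩ := exists_killedKernel_le_near (by linarith : 1 ≤ d) hγ hg hC₁ hC₂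
  obtain ⟨Cf, hCf, hfar⟩ := exists_killedKernel_le_far (C₁ := C₁) (by linarith : 0 ≤ d) hg hC₂
  -- The threshold is `d(x,y) = t`; the prefactor adds up the near case, the far case and the case
  -- `t < 1`.
  refine ⟨1, Cn + Cf + C₂, 1 / 4096, 1 / 16, one_pos, by positivity, by norm_num, by norm_num, ?_⟩
  intro V _ _ _ G _ hG N₁ N₂ hN₁ hN₂ ω hμ hν N hNμ hNν t x htx y
  have hW := isWeight_conductance hG ω
  have hpos := pos_of_volumeRegular (by linarith : d ≠ 0) hG hN₁ x
  have h1 : N x ≤ √t := (le_max_left _ _).trans htx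
  have h2 : 2 * max (N₁ x) (N₂ x) ≤ √t := (le_max_right _ _).trans htx
  have h3 := le_max_left (N₁ x) (N₂ x)
  have h4 := le_max_right (N₁ x) (N₂ x)
  have hsq : 0 < √t := by linarith
  have ht : 0 < t := Real.sqrt_pos.mp hsq
  have hdiag : ∀ R : ℕ, 1 ≤ R → √t ≤ R → OnDiagonalBound ω x R d γ g C₁ C₂ := fun R hR htR =>
    hbound V G hG N₁ N₂ hN₁ hN₂ ω hμ hν N hNμ hNν x R hR (by linarith) (by linarith) (by linarith)
  rw [one_mul]
  constructor
  · intro hD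
    rw [show -(1 / 4096) * (G.dist x y : ℝ) ^ 2 / t = -(1 / 4096 * ((G.dist x y : ℝ) ^ 2 / t)) by
      ring]
    rcases le_or_gt 1 t with ht1 | ht1
    · obtain ⟨R₀, hR₀, hDR, hk⟩ := hnear V G hG ω x t ht1 hdiag y hD
      refine heatKernel_le_of_killedKernel_le hG ω ht.le fun n => ⟨2 ^ n * R₀, ?_, ?_⟩
      · exact Nat.lt_two_pow_self.le.trans (Nat.le_mul_of_pos_right _ hR₀)
      · have hy : y ∈ ball G x (2 ^ n * R₀) := (mem_ball G hG x y _).mpr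
          (hDR.trans (Nat.le_mul_of_pos_left _ (by positivity)))
        rw [← killedKernel_symm hW (self_mem_ball G hG x _) hy]
        refine (hk n).trans ?_
        gcongr
        linarith
    -- Distances are integers, so `d(x,y) ≤ t < 1` forces `y = x`; then `1/μ(x) ≤ C₂` from the ball
    -- of radius `1`, and `t^(-d/2) ≥ 1`.
    · have hyx : y = x := by
        have : G.dist x y = 0 := by
          have : (G.dist x y : ℝ) < 1 := hD.trans_lt ht1
          exact Nat.lt_one_iff.mp (by exact_mod_cast this)
        exact (hG.dist_eq_zero_iff.mp this).symm
      subst hyx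
      refine heatKernel_le_of_killedKernel_le hG ω ht.le fun n => ⟨n, le_rfl, ?_⟩
      refine (killedKernel_self_le hW (self_mem_ball G hG y n) ht.le).trans ?_
      have hsq1 : √t ≤ (1 : ℕ) := by
        rw [Nat.cast_one]
        exact Real.sqrt_le_iff.mpr ⟨zero_le_one, by linarith⟩
      have h5 := (hdiag 1 le_rfl hsq1).inv_mu_le y (self_mem_ball G hG y 1)
      rw [Nat.cast_one, Real.one_rpow, mul_one] at h5
      have h6 : 1 ≤ t ^ (-d / 2) :=
        Real.one_le_rpow_of_pos_of_le_one_of_nonpos ht ht1.le (by linarith)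
      rw [SimpleGraph.dist_self, Nat.cast_zero]
      simp only [ne_eq, OfNat.ofNat_ne_zero, not_false_eq_true, zero_pow, zero_div, mul_zero,
        neg_zero, Real.exp_zero, mul_one]
      nlinarith
  · intro hD
    rw [show -(1 / 16) * (G.dist x y : ℝ) * max 1 (Real.log ((G.dist x y : ℝ) / t)) =
      -(1 / 16 * (G.dist x y : ℝ) * max 1 (Real.log ((G.dist x y : ℝ) / t))) by ring]
    refine heatKernel_le_of_killedKernel_le hG ω ht.le fun n =>
      ⟨max n (G.dist x y), le_max_left _ _, ?_⟩
    refine (hfar V G hG ω x t ht hdiag y hD _ (le_max_right _ _)).trans ?_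
    gcongr
    linarith
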